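/- Let $d\ge 1$ be an integer and let $a\ge 0$. On $\mathbb{R}^{d+1}_+=\{X=(x,z): x\in\mathbb{R}^d,\ z>0\}$ consider the measure $d\omega_a(X)=z^a\,dx\,dz$, let $L^p_a=L^p(\mathbb{R}^{d+1}_+,d\omega_a)$, and for $1\le p,s<\infty$ let $L^{p}_tL^{s}_a$ be the space of measurable $F$ on $\mathbb{R}^{d+1}_+\times\mathbb{R}$ with $$\|F\|_{L^p_tL^s_a}=\Big(\int_{\mathbb{R}}\Big(\int_{\mathbb{R}^{d+1}_+}|F(X,t)|^s\,d\omega_a(X)\Big)^{p/s}dt\Big)^{1/p}<\infty .$$ For $X=(x,z)$, $Y=(y,\zeta)$ in $\mathbb{R}^{d+1}_+$ and $t\ne0$ let $$\mathbb{S}_a(X,Y,t)=\frac{e^{-i\,\mathrm{sgn}(t)\frac{(d+a+1)\pi}{4}}}{2^{\frac{2d+a+1}{2}}\pi^{\frac d2}}\,\frac{e^{i\frac{z^2+\zeta^2+|x-y|^2}{4t}}}{|t|^{\frac{d+a+1}{2}}}\Big(\frac{z\zeta}{2|t|}\Big)^{\frac{1-a}{2}}J_{\frac{a-1}{2}}\Big(\frac{z\zeta}{2|t|}\Big),$$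 where $J_\nu$ is the Bessel function of the first kind, let $\mathbb{S}_a(t)u(X)=\int_{\mathbb{R}^{d+1}_+}\mathbb{S}_a(X,Y,t)\,u(Y)\,d\omega_a(Y)$ for $t\ne 0$, $\mathbb{S}_a(0)u=u$, and $\mathbb{T}_a^\star(u)(X,t)=\mathbb{S}_a(t)u(X)$. Denote by $\mathscr{S}(\mathbb{R}^{d+1}_+)$ and $\mathscr{S}(\mathbb{R}^{d+1}_+\times\mathbb{R})$ the restrictions of the Schwartz functions on $\mathbb{R}^{d+1}$ and $\mathbb{R}^{d+2}$. The dual operator $\mathbb{T}_a$ is defined as follows: $\mathbb{T}_a(F)$ is the unique $g\in L^2_a$ (if there is exactly one) such that, for all $u\in\mathscr{S}(\mathbb{R}^{d+1}_+)$, $F\,\overline{\mathbb{T}_a^\star(u)}$ is integrable with respect to $d\omega_a\,dt$ and $$\int_{\mathbb{R}^{d+1}_+} g\,\overline{u}\;d\omega_a=\int_{\mathbb{R}}\int_{\mathbb{R}^{d+1}_+}F\,\overline{\mathbb{T}_a^\star(u)}\;d\omega_a\,dt .$$ For $\nu=\frac{a-1}{2}$ and $U\in\mathscr{S}(\mathbb{R}^{d+1}_+\times\mathbb{R})$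 let $$\widetilde{\mathcal H}_\nu(U)(\xi,\zeta,\tau)=\zeta^{-\nu}\int_0^\infty\Big(\int_{\mathbb{R}^d\times\mathbb{R}}e^{-2\pi i(\langle\xi,x\rangle+\tau t)}U(x,z,t)\,dx\,dt\Big)J_\nu(z\zeta)\,z^{\nu+1}\,dz$$ be the Fourier-Hankel transform, and let $$RU(\xi,\zeta)=\widetilde{\mathcal H}_\nu(U)\Big(\xi,\zeta,-\frac{4\pi^2|\xi|^2+\zeta^2}{2\pi}\Big),\qquad (\xi,\zeta)\in\mathbb{R}^{d+1}_+,$$ be its restriction to a portion of a paraboloid. (1) Let $q,r>2$ satisfy $\frac2q=(d+a+1)\big(\frac12-\frac1r\big)$, and let $q',r'$ be the conjugate exponents. There is a constant $C=C(d,a,r)>0$ such that, for every $F\in L^{q'}_tL^{r'}_a$, $\mathbb{T}_a(F)\in L^2_a$ is well defined and $$\|\mathbb{T}_a(F)\|_{L^2_a}\le C\,\|F\|_{L^{q'}_tL^{r'}_a},$$ and, for every $U\in\mathscr{S}(\mathbb{R}^{d+1}_+\times\mathbb{R})$, the Tomas-Stein type restriction inequality $\|RU\|_{L^2_a}\le C\,\|U\|_{L^{q'}_tL^{r'}_a}$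 holds. (2) For $q>2$, the pair $(q,q)$ satisfies the condition in (1) if and only if $q'=\frac{2(d+a+3)}{d+a+5}$. With $p=\frac{2(d+a+3)}{d+a+5}$ there is $C=C(d,a)>0$ such that, for every $F\in L^p(\mathbb{R}^{d+1}_+\times\mathbb{R},d\omega_a\,dt)$, $\mathbb{T}_a(F)\in L^2_a$ is well defined and $\|\mathbb{T}_a(F)\|_{L^2_a}\le C\|F\|_{L^p(d\omega_a dt)}$; and $\|RU\|_{L^2_a}\le C\|U\|_{L^p(d\omega_a dt)}$ for every $U\in\mathscr{S}(\mathbb{R}^{d+1}_+\times\mathbb{R})$. (3) For every $U\in\mathscr{S}(\mathbb{R}^{d+1}_+\times\mathbb{R})$, $\mathbb{T}_a(U)\in L^2_a$ is well defined; for almost every $X$ the function $t\mapsto\mathbb{S}_a(-t)(U(\cdot,t))(X)$ is integrable on $\mathbb{R}$ and $$\mathbb{T}_a(U)(X)=\int_{\mathbb{R}}\mathbb{S}_a(-t)(U(\cdot,t))(X)\,dt ;$$ moreover $RU\in L^2_a$ and $\|RU\|_{L^2_a}=\|\mathbb{T}_a(U)\|_{L^2_a}$. -/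

import Mathlib

open MeasureTheory Set
open scoped ENNReal ComplexConjugate SchwartzMap

noncomputable section

/-- Points `X = (x, z)`; the half-space is the set of those with `z > 0`, and it is singled out by
the measure `halfSpaceMeasure` below. -/
abbrev BulkPoint (d : ℕ) : Type := EuclideanSpace ℝ (Fin d) × ℝ

/-- The measure `z ^ a dz` on the half-line `z > 0`. -/
def halfLineMeasure (a : ℝ) : Measure ℝ :=
  (volume.restrict (Ioi (0 : ℝ))).withDensity (fun z => ENNReal.ofReal (z ^ a))

/-- The measure `dω_a(X) = z ^ a dx dz` on the half-space. -/
def halfSpaceMeasure (d : ℕ) (a : ℝ) : Measure (BulkPoint d) :=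
  (volume : Measure (EuclideanSpace ℝ (Fin d))).prod (halfLineMeasure a)

/-- The measure `dω_a(X) dt` on the product of the half-space with the time line. -/
def spaceTimeMeasure (d : ℕ) (a : ℝ) : Measure (BulkPoint d × ℝ) :=
  (halfSpaceMeasure d a).prod volume

/-- The Bessel function of the first kind `J_ν(x)`, for `x > 0`, by its power series.
(`Real.Gamma` vanishes at its poles, which agrees with the convention `1 / Γ = 0` there.) -/
def besselJ (ν x : ℝ) : ℝ :=
  ∑' k : ℕ, (-1 : ℝ) ^ k / ((k.factorial : ℝ) * Real.Gamma ((k : ℝ) + ν + 1))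
    * (x / 2) ^ (2 * (k : ℝ) + ν)

/-- The kernel `S_a(z, ζ, t)`, `t ≠ 0`, of the Schrödinger group of the Bessel operator
`∂_zz + (a / z) ∂_z` on the half-line with zero Neumann condition. -/
def besselKernel (a z ζ t : ℝ) : ℂ :=
  Complex.exp (-(Complex.I * (Real.sign t * ((a + 1) * Real.pi / 4) : ℝ)))
      / (((2 * |t|) ^ ((a + 1) / 2) : ℝ) : ℂ)
    * (((z * ζ / (2 * |t|)) ^ ((1 - a) / 2) * besselJ ((a - 1) / 2) (z * ζ / (2 * |t|)) : ℝ) : ℂ)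
    * Complex.exp (Complex.I * ((z ^ 2 + ζ ^ 2) / (4 * t) : ℝ))

/-- The kernel `(4 π i t) ^ (-d / 2) exp (i |x - y|² / (4 t))`, `t ≠ 0`, of the free Schrödinger
group on `ℝ^d` (principal branch of the power). -/
def freeKernel (d : ℕ) (x y : EuclideanSpace ℝ (Fin d)) (t : ℝ) : ℂ :=
  (4 * (Real.pi : ℂ) * Complex.I * (t : ℂ)) ^ (-(d : ℂ) / 2)
    * Complex.exp (Complex.I * (‖x - y‖ ^ 2 / (4 * t) : ℝ))

/-- The kernel of the Schrödinger propagator in the half-space with zero Neumann condition. -/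
def bulkKernel {d : ℕ} (a : ℝ) (X Y : BulkPoint d) (t : ℝ) : ℂ :=
  besselKernel a X.2 Y.2 t * freeKernel d X.1 Y.1 t

/-- The propagator at time `t`, as an integral operator (the identity when `t = 0`). -/
def propagator {d : ℕ} (a t : ℝ) (u : BulkPoint d → ℂ) (X : BulkPoint d) : ℂ :=
  if t = 0 then u X else ∫ Y, bulkKernel a X Y t * u Y ∂(halfSpaceMeasure d a)

/-- The Strichartz operator, which maps an initial datum `u` to the solution
`(X, t) ↦ (propagator at time t of u)(X)`. -/
def strichartz {d : ℕ} (a : ℝ) (u : BulkPoint d → ℂ) (p : BulkPoint d × ℝ) : ℂ :=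
  propagator a p.2 u p.1

/-- `g` is the image of `F` under the dual of the Strichartz operator: `⟨g, u⟩ = ⟨F, strichartz u⟩`
for all (restrictions to the half-space of) Schwartz functions `u`, where the integral on the right
has to converge absolutely. -/
def IsDualStrichartz {d : ℕ} (a : ℝ) (F : BulkPoint d × ℝ → ℂ)
    (g : Lp ℂ 2 (halfSpaceMeasure d a)) : Prop :=
  ∀ u : 𝓢(BulkPoint d, ℂ),
    Integrable (fun p => F p * conj (strichartz a u p)) (spaceTimeMeasure d a) ∧
    ∫ X, g X * conj (u X) ∂(halfSpaceMeasure d a)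
      = ∫ p, F p * conj (strichartz a u p) ∂(spaceTimeMeasure d a)

/-- The dual Strichartz operator. It is meant for those `F` for which there is exactly one `g` with
`IsDualStrichartz a F g`; the value is that `g`. -/
def dualStrichartz {d : ℕ} (a : ℝ) (F : BulkPoint d × ℝ → ℂ) : Lp ℂ 2 (halfSpaceMeasure d a) :=
  Classical.epsilon (fun g => IsDualStrichartz a F g)

/-- The norm of `L^q_t L^r_a` (time outside), for finite exponents. -/
def mixedNorm {d : ℕ} (a q r : ℝ) (F : BulkPoint d × ℝ → ℂ) : ℝ≥0∞ :=
  (∫⁻ t : ℝ, (∫⁻ X, ‖F (X, t)‖ₑ ^ r ∂(halfSpaceMeasure d a)) ^ (q / r)) ^ (1 / q)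

/-- Membership in `L^q_t L^r_a`. -/
def MemMixed {d : ℕ} (a q r : ℝ) (F : BulkPoint d × ℝ → ℂ) : Prop :=
  AEStronglyMeasurable F (spaceTimeMeasure d a) ∧ mixedNorm a q r F < ∞

/-- The modified Hankel transform of order `ν`. -/
def hankel (ν : ℝ) (φ : ℝ → ℂ) (z : ℝ) : ℂ :=
  ((z ^ (-ν) : ℝ) : ℂ) *
    ∫ ζ in Ioi (0 : ℝ), φ ζ * ((besselJ ν (z * ζ) : ℝ) : ℂ) * ((ζ ^ (ν + 1) : ℝ) : ℂ)

/-- The Fourier transform in the variables `(x, t)`, for fixed `z`. -/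
def fourierXT {d : ℕ} (U : BulkPoint d × ℝ → ℂ) (ξ : EuclideanSpace ℝ (Fin d)) (z τ : ℝ) : ℂ :=
  ∫ p : EuclideanSpace ℝ (Fin d) × ℝ,
    Complex.exp (-(2 * Real.pi * Complex.I * (inner ℝ ξ p.1 + τ * p.2 : ℝ))) * U ((p.1, z), p.2)

/-- The Fourier-Hankel transform: Fourier in `(x, t)`, Hankel of order `ν` in `z`. -/
def fourierHankel {d : ℕ} (ν : ℝ) (U : BulkPoint d × ℝ → ℂ)
    (ξ : EuclideanSpace ℝ (Fin d)) (ζ τ : ℝ) : ℂ :=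
  hankel ν (fun z => fourierXT U ξ z τ) ζ

/-- The restriction of the Fourier-Hankel transform of order `(a - 1) / 2` to the portion
`τ = -(4 π² |ξ|² + ζ²) / (2 π)`, `ζ > 0`, of a paraboloid, parametrized by `(ξ, ζ)`. -/
def paraboloidRestriction {d : ℕ} (a : ℝ) (U : BulkPoint d × ℝ → ℂ) (Ξ : BulkPoint d) : ℂ :=
  fourierHankel ((a - 1) / 2) U Ξ.1 Ξ.2
    (-((4 * Real.pi ^ 2 * ‖Ξ.1‖ ^ 2 + Ξ.2 ^ 2) / (2 * Real.pi)))

end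

/-!
The operator `∂_zz + (a / z) ∂_z + Δ_x` on the half-space is diagonalized by the Fourier-Bessel
transform `fourierBessel`, whose kernel `fourierBesselKernel` is the product of a plane wave in `x`
and an even entire Bessel function of the product of the last variables. Its heat kernel `bulkHeat`
is explicit at every complex time `w` with `0 ≤ re w`, `w ≠ 0`: for `0 < re w` this is Weber's second
exponential integral (`integral_weber`), and the boundary value `w = i t` is the Schrödinger kernel
(`bulkHeat_I_mul`). Poisson's integral for the Bessel function bounds the heat kernel by a constant
times `|w| ^ (-(d + a + 1) / 2)`, up to the imaginary axis (`norm_bulkHeat_le`).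

Since the heat kernel is positive with mass one at real times, the Fourier-Bessel transform is a
contraction of `L²`, and an approximate identity makes it isometric on bounded continuous integrable
functions (`eLpNorm_fourierBessel_eq`). Letting `re w` tend to zero identifies the Schrödinger group
with the multiplier `exp (-i t (4 π² |ξ|² + ζ²))` (`integral_exp_mul_fourierBessel_eq`); thus it is
bounded on `L²`, and from `L¹` to `L^∞` with the norm `O(|t| ^ (-(d + a + 1) / 2))`. Interpolating
(`lintegral_rpow_le_of_weak_bounds`) gives the decay `|t| ^ (-2 / q)` from `L^{r'}` to `L^r`.

For data `F` with enough integrability, the dual operator is, on the Fourier-Bessel side, the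
superposition `dualFourier` of the phases `exp (i t (4 π² |ξ|² + ζ²))` times the transforms of the
slices `F (·, t)`. Its squared norm is a double time integral of the inner products
`⟨S(s - t) F(t), F(s)⟩`, so the decay estimate and the Hardy–Littlewood–Sobolev inequality
(`lintegral_lintegral_mul_rpow_le`) bound it by the mixed norm. For general `F` the pairing
with a solution is bounded by that of truncations of `|F|` that carry the phase of the solution
(`lintegral_enorm_mul_strichartz_le`), and the Riesz representation theorem and the density of
Schwartz functions in `L²` give the dual operator.

For a Schwartz function `U`, Fubini's theorem identifies `dualFourier` with the restriction of the
Fourier-Hankel transform to the paraboloid (`paraboloidRestriction_eq`): the time frequency on the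
paraboloid is exactly the one of the phase. So the restriction inequality is the dual Strichartz
inequality read on the Fourier-Bessel side, and the equality of norms is Plancherel's identity, applied
to a function that decays rapidly because each time derivative of `U` produces a factor
`4 π² |ξ|² + ζ²`.
-/

/-! ### The Bessel series -/

/-- The entire function `∑ w ^ k / (k! Γ(k + c))`. With `c = ν + 1`, both `J_ν` and `I_ν` are powers
times this function: `J_ν(x) = (x / 2) ^ ν * besselEntire c (-x² / 4)`, and `I_ν` corresponds to
`x² / 4`. -/
noncomputable def besselEntire (c : ℝ) (w : ℂ) : ℂ :=
  ∑' k : ℕ, w ^ k / (((k.factorial : ℝ) * Real.Gamma (k + c) : ℝ) : ℂ)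

lemma sqrt_pi_div_factorial_mul_Gamma (k : ℕ) :
    √Real.pi / ((k.factorial : ℝ) * Real.Gamma (k + 1 / 2)) = 4 ^ k / ((2 * k).factorial : ℝ) := by
  induction k with
  | zero =>
    have : √Real.pi ≠ 0 := by positivity
    simp [-one_div, Real.Gamma_one_half_eq, this]
  | succ k ih =>
    have h1 : Real.Gamma (((k + 1 : ℕ) : ℝ) + 1 / 2)
        = (k + 1 / 2) * Real.Gamma (k + 1 / 2) := by
      rw [← Real.Gamma_add_one (by positivity)]; push_cast; ring_nf
    have hG : Real.Gamma ((k : ℝ) + 1 / 2) ≠ 0 := (Real.Gamma_pos_of_pos (by positivity)).ne'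
    rw [h1, show 2 * (k + 1) = 2 * k + 1 + 1 by ring, Nat.factorial_succ (2 * k + 1),
      Nat.factorial_succ (2 * k), Nat.factorial_succ k]
    rw [div_eq_div_iff (by positivity) (by positivity)] at ih ⊢
    push_cast
    linear_combination (4 * (k + 1) * (k + 1 / 2) : ℝ) * ih

/-- Rising factorials increase with the parameter. -/
lemma Gamma_half_ratio_le {c : ℝ} (hc : 1 / 2 ≤ c) (k : ℕ) :
    Real.Gamma (k + 1 / 2) * Real.Gamma c ≤ √Real.pi * Real.Gamma (k + c) := by
  induction k with
  | zero => simp [-one_div, Real.Gamma_one_half_eq]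
  | succ k ih =>
    have h (s : ℝ) (hs : 0 < s) : Real.Gamma (((k + 1 : ℕ) : ℝ) + s)
        = (k + s) * Real.Gamma (k + s) := by
      rw [← Real.Gamma_add_one (by positivity)]; push_cast; ring_nf
    rw [h _ (by norm_num), h c (by linarith)]
    have h3 : 0 < Real.Gamma (k + c) :=
      Real.Gamma_pos_of_pos (by have : (0 : ℝ) ≤ k := k.cast_nonneg; linarith)
    calc ((k : ℝ) + 1 / 2) * Real.Gamma (k + 1 / 2) * Real.Gamma c
        = (k + 1 / 2) * (Real.Gamma (k + 1 / 2) * Real.Gamma c) := by ring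
      _ ≤ (k + c) * (√Real.pi * Real.Gamma (k + c)) := by gcongr
      _ = _ := by ring

lemma besselCoeff_le {c : ℝ} (hc : 1 / 2 ≤ c) (k : ℕ) :
    1 / ((k.factorial : ℝ) * Real.Gamma (k + c))
      ≤ (Real.Gamma c)⁻¹ * (4 ^ k / ((2 * k).factorial : ℝ)) := by
  have h0 : 0 < Real.Gamma c := Real.Gamma_pos_of_pos (by linarith)
  have h1 : 0 < Real.Gamma (k + c) :=
    Real.Gamma_pos_of_pos (by have : (0 : ℝ) ≤ k := k.cast_nonneg; linarith)
  have h2 : 0 < Real.Gamma ((k : ℝ) + 1 / 2) := Real.Gamma_pos_of_pos (by positivity)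
  rw [← sqrt_pi_div_factorial_mul_Gamma, ← one_div, div_mul_div_comm, one_mul,
    div_le_div_iff₀ (by positivity) (by positivity)]
  have := mul_le_mul_of_nonneg_left (Gamma_half_ratio_le hc k) (Nat.cast_nonneg (k.factorial) (α := ℝ))
  linarith

lemma norm_besselEntire_term (c : ℝ) (hc : 1 / 2 ≤ c) (w : ℂ) (k : ℕ) :
    ‖w ^ k / (((k.factorial : ℝ) * Real.Gamma (k + c) : ℝ) : ℂ)‖
      = ‖w‖ ^ k / ((k.factorial : ℝ) * Real.Gamma (k + c)) := by
  have h1 : 0 < Real.Gamma (k + c) :=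
    Real.Gamma_pos_of_pos (by have : (0 : ℝ) ≤ k := k.cast_nonneg; linarith)
  rw [norm_div, norm_pow, Complex.norm_real, Real.norm_of_nonneg (by positivity)]

lemma summable_besselEntire_real {c : ℝ} (hc : 1 / 2 ≤ c) {x : ℝ} (hx : 0 ≤ x) :
    Summable fun k : ℕ => x ^ k / ((k.factorial : ℝ) * Real.Gamma (k + c)) := by
  have h := ((Real.hasSum_cosh (2 * √x)).mul_left (Real.Gamma c)⁻¹).summable
  refine h.of_nonneg_of_le (fun k => ?_) (fun k => ?_)
  · have h1 : 0 < Real.Gamma (k + c) :=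
      Real.Gamma_pos_of_pos (by have : (0 : ℝ) ≤ k := k.cast_nonneg; linarith)
    positivity
  · have := mul_le_mul_of_nonneg_left (besselCoeff_le hc k) (pow_nonneg hx k)
    have e : (2 * √x) ^ (2 * k) = 4 ^ k * x ^ k := by
      rw [pow_mul, mul_pow, Real.sq_sqrt hx, ← mul_pow]; norm_num
    rw [e]
    calc x ^ k / ((k.factorial : ℝ) * Real.Gamma (k + c))
        = x ^ k * (1 / ((k.factorial : ℝ) * Real.Gamma (k + c))) := by ring
      _ ≤ _ := this
      _ = _ := by ring

lemma summable_besselEntire {c : ℝ} (hc : 1 / 2 ≤ c) (w : ℂ) :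
    Summable fun k : ℕ => w ^ k / (((k.factorial : ℝ) * Real.Gamma (k + c) : ℝ) : ℂ) := by
  refine Summable.of_norm ?_
  simp_rw [norm_besselEntire_term c hc]
  exact summable_besselEntire_real hc (norm_nonneg w)

lemma continuous_besselEntire {c : ℝ} (hc : 1 / 2 ≤ c) : Continuous (besselEntire c) := by
  rw [continuous_iff_continuousAt]
  intro w
  have h : ContinuousOn (besselEntire c) (Metric.ball 0 (‖w‖ + 1)) := by
    refine continuousOn_tsum (fun k => by fun_prop)
      (summable_besselEntire_real hc (x := ‖w‖ + 1) (by positivity)) (fun k x hx => ?_)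
    rw [norm_besselEntire_term c hc]
    have h1 : 0 < Real.Gamma (k + c) :=
      Real.Gamma_pos_of_pos (by have : (0 : ℝ) ≤ k := k.cast_nonneg; linarith)
    have : ‖x‖ ≤ ‖w‖ + 1 := by simpa using (Metric.mem_ball.1 hx).le
    gcongr
  exact h.continuousAt (Metric.isOpen_ball.mem_nhds (by simp))

/-- A function with real Taylor coefficients takes real values on the real line. -/
lemma besselEntire_ofReal (c : ℝ) (x : ℝ) :
    besselEntire c x
      = ((∑' k : ℕ, x ^ k / ((k.factorial : ℝ) * Real.Gamma (k + c)) : ℝ) : ℂ) := by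
  rw [besselEntire, Complex.ofReal_tsum]
  push_cast
  rfl

lemma besselJ_eq {ν x : ℝ} (hx : 0 < x) :
    ((besselJ ν x : ℝ) : ℂ)
      = (((x / 2) ^ ν : ℝ) : ℂ) * besselEntire (ν + 1) ((-(x ^ 2 / 4) : ℝ) : ℂ) := by
  rw [besselEntire_ofReal, ← Complex.ofReal_mul, besselJ, ← tsum_mul_left]
  congr 2
  ext k
  rw [Real.rpow_add (by positivity), show (2 * (k : ℝ)) = ((2 * k : ℕ) : ℝ) by push_cast; ring,
    Real.rpow_natCast, pow_mul, add_assoc, show -(x ^ 2 / 4) = (-1) * (x / 2) ^ 2 by ring, mul_pow]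
  ring

/-- The representing measure of Poisson's integral: a probability measure on `[0, 1]` (a beta
distribution, or a point mass in the limiting case `c = 1 / 2`) whose moments are quotients of rising
factorials. -/
lemma exists_poisson_measure {c : ℝ} (hc : 1 / 2 ≤ c) :
    ∃ μ : Measure ℝ, IsProbabilityMeasure μ ∧ (∀ᵐ u ∂μ, u ∈ Icc (0 : ℝ) 1) ∧
      ∀ k : ℕ, ∫ u, u ^ k ∂μ
        = Real.Gamma (k + 1 / 2) * Real.Gamma c / (√Real.pi * Real.Gamma (k + c)) := by
  rcases hc.eq_or_lt with rfl | hc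
  · refine ⟨Measure.dirac 1, inferInstance, ?_, fun k => ?_⟩
    · rw [ae_dirac_eq]; simp
    · have h2 : 0 < Real.Gamma ((k : ℝ) + 1 / 2) := Real.Gamma_pos_of_pos (by positivity)
      have : √Real.pi ≠ 0 := by positivity
      rw [integral_dirac, one_pow, Real.Gamma_one_half_eq]
      field_simp
  · have hb : 0 < c - 1 / 2 := by linarith
    have hα : (0 : ℝ) < 1 / 2 := by norm_num
    refine ⟨ProbabilityTheory.betaMeasure (1 / 2) (c - 1 / 2),
      ProbabilityTheory.isProbabilityMeasureBeta hα hb, ?_, fun k => ?_⟩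
    · rw [ProbabilityTheory.betaMeasure, ae_withDensity_iff]
      · refine ae_of_all _ fun u hu => ?_
        rw [ProbabilityTheory.betaPDF_eq] at hu
        split_ifs at hu with h
        · exact ⟨h.1.le, h.2.le⟩
        · simp at hu
      · exact (ProbabilityTheory.measurable_betaPDFReal _ _).ennreal_ofReal
    · have hk : (0 : ℝ) < k + 1 / 2 := by positivity
      have hnn (α : ℝ) (hα : 0 < α) (x : ℝ) :
          0 ≤ ProbabilityTheory.betaPDFReal α (c - 1 / 2) x := by
        by_cases h : 0 < x ∧ x < 1
        · exact (ProbabilityTheory.betaPDFReal_pos h.1 h.2 hα hb).le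
        · simp [ProbabilityTheory.betaPDFReal, h]
      have h1 : ∫ x, ProbabilityTheory.betaPDFReal (k + 1 / 2) (c - 1 / 2) x = 1 := by
        rw [integral_eq_lintegral_of_nonneg_ae (ae_of_all _ (hnn _ hk))
          (ProbabilityTheory.measurable_betaPDFReal _ _).aestronglyMeasurable]
        have := ProbabilityTheory.lintegral_betaPDF_eq_one hk hb
        simp only [ProbabilityTheory.betaPDF] at this
        rw [this]; simp
      have hB := ProbabilityTheory.beta_pos hα hb
      have hBk := ProbabilityTheory.beta_pos hk hb
      have h2 : ∀ x : ℝ, ProbabilityTheory.betaPDFReal (1 / 2) (c - 1 / 2) x * x ^ k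
          = (ProbabilityTheory.beta (k + 1 / 2) (c - 1 / 2) /
              ProbabilityTheory.beta (1 / 2) (c - 1 / 2)) *
            ProbabilityTheory.betaPDFReal (k + 1 / 2) (c - 1 / 2) x := by
        intro x
        by_cases h : 0 < x ∧ x < 1
        · simp only [ProbabilityTheory.betaPDFReal, if_pos h]
          rw [show (k : ℝ) + 1 / 2 - 1 = k + (1 / 2 - 1) by ring, Real.rpow_add h.1,
            Real.rpow_natCast]
          generalize ProbabilityTheory.beta (k + 1 / 2) (c - 1 / 2) = B₁ at hBk
          generalize ProbabilityTheory.beta (1 / 2) (c - 1 / 2) = B₂ at hB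
          field_simp
        · simp [ProbabilityTheory.betaPDFReal, h]
      rw [ProbabilityTheory.betaMeasure]
      change ∫ u, u ^ k ∂(volume.withDensity fun x => ENNReal.ofReal _) = _
      rw [integral_withDensity_eq_integral_toReal_smul]
      · simp_rw [ENNReal.toReal_ofReal (hnn _ hα _), smul_eq_mul, h2]
        rw [integral_const_mul, h1, ProbabilityTheory.beta, ProbabilityTheory.beta,
          show (k : ℝ) + 1 / 2 + (c - 1 / 2) = k + c by ring,
          show (1 : ℝ) / 2 + (c - 1 / 2) = c by ring, Real.Gamma_one_half_eq]
        have h3 : 0 < Real.Gamma (k + c) := Real.Gamma_pos_of_pos (by positivity)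
        have h4 : 0 < Real.Gamma (c - 1 / 2) := Real.Gamma_pos_of_pos hb
        have h5 : 0 < Real.Gamma c := Real.Gamma_pos_of_pos (by linarith)
        have : √Real.pi ≠ 0 := by positivity
        generalize Real.Gamma (c - 1 / 2) = G at h4
        field_simp
      · exact (ProbabilityTheory.measurable_betaPDFReal _ _).ennreal_ofReal
      · exact ae_of_all _ fun _ => ENNReal.ofReal_lt_top

lemma norm_cosh_le (z : ℂ) : ‖Complex.cosh z‖ ≤ Real.exp |z.re| := by
  rw [Complex.cosh, norm_div, Complex.norm_ofNat, div_le_iff₀ (by norm_num)]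
  refine (norm_add_le _ _).trans ?_
  rw [Complex.norm_exp, Complex.norm_exp, Complex.neg_re]
  have h1 := Real.exp_le_exp.2 (le_abs_self z.re)
  have h2 := Real.exp_le_exp.2 (neg_le_abs z.re)
  linarith

/-- The bound `|x ^ (-ν) I_ν(x)| ≤ C exp |Re x|`, by Poisson's integral: `besselEntire c (x² / 4)` is
an average of `cosh (x √u)`, `0 ≤ u ≤ 1`. -/
lemma norm_besselEntire_le {c : ℝ} (hc : 1 / 2 ≤ c) (x : ℂ) :
    ‖besselEntire c (x ^ 2 / 4)‖ ≤ (Real.Gamma c)⁻¹ * Real.exp |x.re| := by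
  obtain ⟨μ, hμ, hsupp, hmom⟩ := exists_poisson_measure hc
  have hGc : 0 < Real.Gamma c := Real.Gamma_pos_of_pos (by linarith)
  let F : ℕ → ℝ → ℂ := fun k u => (x ^ (2 * k) / ((2 * k).factorial : ℂ)) * ((u ^ k : ℝ) : ℂ)
  have hpow : ∀ k : ℕ, Integrable (fun u : ℝ => u ^ k) μ := fun k => by
    refine Integrable.of_bound (C := 1) (by fun_prop) ?_
    filter_upwards [hsupp] with u hu
    rw [norm_pow, Real.norm_of_nonneg hu.1]
    exact pow_le_one₀ hu.1 hu.2
  have hint : ∀ k, Integrable (F k) μ := fun k => ((hpow k).ofReal).const_mul _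
  have hsumx : Summable fun k : ℕ => ‖x‖ ^ (2 * k) / ((2 * k).factorial : ℝ) :=
    (Real.hasSum_cosh ‖x‖).summable
  have hsum : Summable fun k => ∫ u, ‖F k u‖ ∂μ := by
    refine hsumx.of_nonneg_of_le (fun k => integral_nonneg fun _ => norm_nonneg _) (fun k => ?_)
    calc ∫ u, ‖F k u‖ ∂μ ≤ ∫ u, ‖x‖ ^ (2 * k) / ((2 * k).factorial : ℝ) ∂μ := by
          refine integral_mono_ae (hint k).norm (integrable_const _) ?_
          filter_upwards [hsupp] with u hu
          simp only [F, norm_mul, norm_div, norm_pow, Complex.norm_natCast, Complex.norm_real,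
            Real.norm_of_nonneg hu.1]
          exact mul_le_of_le_one_right (by positivity) (pow_le_one₀ hu.1 hu.2)
      _ = _ := by simp
  have key := (hasSum_integral_of_summable_integral_norm hint hsum).tsum_eq
  have e1 : besselEntire c (x ^ 2 / 4) = ((Real.Gamma c)⁻¹ : ℂ) * ∑' k, ∫ u, F k u ∂μ := by
    rw [besselEntire, ← tsum_mul_left]
    congr 1
    ext k
    simp only [F]
    rw [integral_const_mul, integral_complex_ofReal, hmom]
    have h3 : 0 < Real.Gamma (k + c) :=
      Real.Gamma_pos_of_pos (by have : (0 : ℝ) ≤ k := k.cast_nonneg; linarith)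
    have h4 : Real.Gamma ((k : ℝ) + 1 / 2) = √Real.pi * (2 * k).factorial / (k.factorial * 4 ^ k) := by
      have h5 := sqrt_pi_div_factorial_mul_Gamma k
      have h2 : 0 < Real.Gamma ((k : ℝ) + 1 / 2) := Real.Gamma_pos_of_pos (by positivity)
      rw [div_eq_div_iff (by positivity) (by positivity)] at h5
      rw [eq_div_iff (by positivity)]
      linarith
    rw [h4]
    have : (√Real.pi : ℂ) ≠ 0 := by
      have : √Real.pi ≠ 0 := by positivity
      exact_mod_cast this
    have h3' : (Real.Gamma (k + c) : ℂ) ≠ 0 := by exact_mod_cast h3.ne'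
    have h6 : (Real.Gamma c : ℂ) ≠ 0 := by exact_mod_cast hGc.ne'
    have h7 : ((k.factorial : ℕ) : ℂ) ≠ 0 := by exact_mod_cast k.factorial_ne_zero
    have h8 : (((2 * k).factorial : ℕ) : ℂ) ≠ 0 := by exact_mod_cast (2 * k).factorial_ne_zero
    push_cast
    field_simp
    rw [pow_mul, ← mul_pow]
    ring_nf
  rw [e1, key, norm_mul]
  have e2 : ‖((Real.Gamma c)⁻¹ : ℂ)‖ = (Real.Gamma c)⁻¹ := by
    rw [norm_inv, Complex.norm_real, Real.norm_of_nonneg hGc.le]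
  rw [e2]
  gcongr
  calc ‖∫ u, ∑' k, F k u ∂μ‖ ≤ ∫ u, Real.exp |x.re| ∂μ := by
        refine norm_integral_le_of_norm_le (integrable_const _) ?_
        filter_upwards [hsupp] with u hu
        have : ∑' k, F k u = Complex.cosh (x * (√u : ℝ)) := by
          rw [Complex.cosh_eq_tsum]
          congr 1
          ext k
          simp only [F]
          rw [mul_pow, pow_mul ((√u : ℝ) : ℂ), ← Complex.ofReal_pow √u 2, Real.sq_sqrt hu.1]
          push_cast
          ring
        rw [this]
        refine (norm_cosh_le _).trans (Real.exp_le_exp.2 ?_)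
        rw [Complex.re_mul_ofReal, abs_mul]
        refine mul_le_of_le_one_right (abs_nonneg _) ?_
        rw [abs_of_nonneg (Real.sqrt_nonneg _)]
        exact Real.sqrt_le_one.2 hu.2
    _ = _ := by simp

/-! ### The weighted half-line and Gaussian integrals -/

lemma measurable_ofReal_rpow (a : ℝ) : Measurable fun z : ℝ => ENNReal.ofReal (z ^ a) := by
  fun_prop

lemma ae_halfLine_pos (a : ℝ) : ∀ᵐ z ∂(halfLineMeasure a), 0 < z :=
  (withDensity_absolutelyContinuous _ _).ae_le (ae_restrict_mem measurableSet_Ioi)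

lemma integrable_halfLine_iff {E : Type*} [NormedAddCommGroup E] [NormedSpace ℝ E] {a : ℝ}
    {f : ℝ → E} :
    Integrable f (halfLineMeasure a) ↔ IntegrableOn (fun z => z ^ a • f z) (Ioi 0) := by
  rw [halfLineMeasure, integrable_withDensity_iff_integrable_smul' (measurable_ofReal_rpow a)
    (ae_of_all _ fun _ => ENNReal.ofReal_lt_top)]
  refine integrable_congr ?_
  filter_upwards [ae_restrict_mem measurableSet_Ioi] with z hz
  rw [ENNReal.toReal_ofReal (Real.rpow_nonneg (le_of_lt hz) a)]

lemma integral_halfLine {E : Type*} [NormedAddCommGroup E] [NormedSpace ℝ E] (a : ℝ) (f : ℝ → E) :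
    ∫ z, f z ∂(halfLineMeasure a) = ∫ z in Ioi 0, z ^ a • f z := by
  rw [halfLineMeasure, integral_withDensity_eq_integral_toReal_smul (measurable_ofReal_rpow a)
    (ae_of_all _ fun _ => ENNReal.ofReal_lt_top)]
  refine integral_congr_ae ?_
  filter_upwards [ae_restrict_mem measurableSet_Ioi] with z hz
  rw [ENNReal.toReal_ofReal (Real.rpow_nonneg (le_of_lt hz) a)]

lemma integrable_exp_neg_mul_sq_halfLine {a : ℝ} (ha : 0 ≤ a) {b : ℝ} (hb : 0 < b) :
    Integrable (fun z : ℝ => Real.exp (-b * z ^ 2)) (halfLineMeasure a) := by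
  rw [integrable_halfLine_iff]
  exact integrableOn_rpow_mul_exp_neg_mul_sq hb (by linarith)

lemma integral_exp_neg_mul_sq_halfLine {a : ℝ} (ha : 0 ≤ a) {b : ℝ} (hb : 0 < b) :
    ∫ z, Real.exp (-b * z ^ 2) ∂(halfLineMeasure a)
      = Real.Gamma ((a + 1) / 2) / 2 * b ^ (-((a + 1) / 2)) := by
  rw [integral_halfLine]
  have := integral_rpow_mul_exp_neg_mul_rpow (p := 2) (q := a) (b := b) (by norm_num)
    (by linarith) hb
  simp only [Real.rpow_two] at this
  simp only [smul_eq_mul, this]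
  rw [neg_div]
  ring

/-- The Gaussian integral with a complex parameter, by analytic continuation from the positive
reals: the left side is a complex moment generating function. -/
lemma integral_cexp_neg_mul_sq_halfLine {a : ℝ} (ha : 0 ≤ a) {w : ℂ} (hw : 0 < w.re) :
    ∫ z, Complex.exp (-w * (z : ℂ) ^ 2) ∂(halfLineMeasure a)
      = (Real.Gamma ((a + 1) / 2) : ℂ) / 2 * w ^ (-(((a + 1) / 2 : ℝ) : ℂ)) := by
  set X : ℝ → ℝ := fun z => -z ^ 2
  have hset : Ioi (0 : ℝ) ⊆ interior (ProbabilityTheory.integrableExpSet X (halfLineMeasure a)) := by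
    refine interior_maximal (fun b hb => ?_) isOpen_Ioi
    have := integrable_exp_neg_mul_sq_halfLine ha (mem_Ioi.1 hb)
    refine this.congr (ae_of_all _ fun z => ?_)
    simp only [X]
    ring_nf
  have hf : AnalyticOnNhd ℂ (ProbabilityTheory.complexMGF X (halfLineMeasure a)) {w | 0 < w.re} :=
    ProbabilityTheory.analyticOnNhd_complexMGF.mono fun w hw => hset hw
  have hopen : IsOpen {w : ℂ | 0 < w.re} := isOpen_lt continuous_const Complex.continuous_re
  have hg : AnalyticOnNhd ℂ
      (fun w : ℂ => (Real.Gamma ((a + 1) / 2) : ℂ) / 2 * w ^ (-(((a + 1) / 2 : ℝ) : ℂ)))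
      {w | 0 < w.re} := by
    refine DifferentiableOn.analyticOnNhd (fun w hw => ?_) hopen
    refine DifferentiableAt.differentiableWithinAt ?_
    exact (differentiableAt_id.cpow_const (Or.inl hw)).const_mul _
  have hconv : IsPreconnected {w : ℂ | 0 < w.re} :=
    (convex_halfSpace_re_gt 0).isPreconnected
  have hreal : ∀ b : ℝ, 0 < b → ProbabilityTheory.complexMGF X (halfLineMeasure a) b
      = (Real.Gamma ((a + 1) / 2) : ℂ) / 2 * (b : ℂ) ^ (-(((a + 1) / 2 : ℝ) : ℂ)) := by
    intro b hb
    rw [ProbabilityTheory.complexMGF_ofReal, ProbabilityTheory.mgf]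
    have e : ∀ z : ℝ, Real.exp (b * X z) = Real.exp (-b * z ^ 2) := fun z => by
      simp only [X]; ring_nf
    simp_rw [e]
    rw [integral_exp_neg_mul_sq_halfLine ha hb]
    push_cast
    rw [Complex.ofReal_cpow hb.le]
    push_cast
    rfl
  have hfreq : ∃ᶠ z in nhdsWithin (1 : ℂ) {1}ᶜ,
      ProbabilityTheory.complexMGF X (halfLineMeasure a) z
      = (Real.Gamma ((a + 1) / 2) : ℂ) / 2 * z ^ (-(((a + 1) / 2 : ℝ) : ℂ)) := by
    have hu : Filter.Tendsto (fun n : ℕ => (((1 : ℝ) + 1 / ((n : ℝ) + 1) : ℝ) : ℂ)) Filter.atTop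
        (nhdsWithin (1 : ℂ) {1}ᶜ) := by
      refine tendsto_nhdsWithin_iff.2 ⟨?_, Filter.Eventually.of_forall fun n => ?_⟩
      · have : Filter.Tendsto (fun n : ℕ => (1 : ℝ) + 1 / ((n : ℝ) + 1)) Filter.atTop (nhds (1 + 0)) :=
          tendsto_const_nhds.add tendsto_one_div_add_atTop_nhds_zero_nat
        have h := (Complex.continuous_ofReal.tendsto _).comp this
        simp only [add_zero, Complex.ofReal_one] at h
        exact h
      · have h1 : (0 : ℝ) < 1 / ((n : ℝ) + 1) := by positivity
        simp only [mem_compl_iff, mem_singleton_iff]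
        intro h
        have h2 : (1 : ℝ) + 1 / ((n : ℝ) + 1) = 1 := by exact_mod_cast h
        linarith
    exact hu.frequently (Filter.Frequently.of_forall fun n => hreal _ (by positivity))
  have := hf.eqOn_of_preconnected_of_frequently_eq hg hconv (z₀ := 1) (by simp) hfreq hw
  refine Eq.trans ?_ this
  rw [ProbabilityTheory.complexMGF]
  refine integral_congr_ae (ae_of_all _ fun z => ?_)
  simp only [X]
  push_cast
  ring_nf

lemma integral_pow_mul_halfLine {E : Type*} [NormedAddCommGroup E] [NormedSpace ℝ E] (a : ℝ) (n : ℕ)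
    (f : ℝ → E) :
    ∫ z, (z ^ (2 * n)) • f z ∂(halfLineMeasure a) = ∫ z, f z ∂(halfLineMeasure (a + 2 * n)) := by
  rw [integral_halfLine, integral_halfLine]
  refine setIntegral_congr_fun measurableSet_Ioi fun z hz => ?_
  rw [smul_smul, Real.rpow_add hz, show (2 * (n : ℝ)) = ((2 * n : ℕ) : ℝ) by push_cast; ring,
    Real.rpow_natCast]

lemma integrable_pow_mul_halfLine_iff {E : Type*} [NormedAddCommGroup E] [NormedSpace ℝ E] {a : ℝ}
    {n : ℕ} {f : ℝ → E} :
    Integrable (fun z => (z ^ (2 * n)) • f z) (halfLineMeasure a)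
      ↔ Integrable f (halfLineMeasure (a + 2 * n)) := by
  rw [integrable_halfLine_iff, integrable_halfLine_iff]
  refine integrableOn_congr_fun (fun z hz => ?_) measurableSet_Ioi
  rw [smul_smul, Real.rpow_add hz, show (2 * (n : ℝ)) = ((2 * n : ℕ) : ℝ) by push_cast; ring,
    Real.rpow_natCast]

lemma norm_cexp_neg_mul_sq' (w : ℂ) (z : ℝ) :
    ‖Complex.exp (-w * (z : ℂ) ^ 2)‖ = Real.exp (-w.re * z ^ 2) := by
  rw [Complex.norm_exp, ← Complex.ofReal_pow, Complex.re_mul_ofReal, Complex.neg_re]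

lemma integrable_cexp_neg_mul_sq_halfLine {a : ℝ} (ha : 0 ≤ a) {w : ℂ} (hw : 0 < w.re) :
    Integrable (fun z : ℝ => Complex.exp (-w * (z : ℂ) ^ 2)) (halfLineMeasure a) := by
  rw [← integrable_norm_iff (by fun_prop)]
  simp_rw [norm_cexp_neg_mul_sq']
  exact integrable_exp_neg_mul_sq_halfLine ha hw

/-! ### Weber's second exponential integral -/

/-- The Chu-Vandermonde identity for Gamma quotients. -/
lemma sum_choose_mul_descFactorial_div_Gamma (m n : ℕ) {c : ℝ} (hc : 0 < c) :
    ∑ k ∈ Finset.range (m + 1), (m.choose k : ℝ) * (n.descFactorial k : ℝ) / Real.Gamma (k + c)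
      = Real.Gamma (m + n + c) / (Real.Gamma (m + c) * Real.Gamma (n + c)) := by
  induction m generalizing n c with
  | zero =>
    have h : 0 < Real.Gamma (n + c) := Real.Gamma_pos_of_pos (by positivity)
    have h' : 0 < Real.Gamma c := Real.Gamma_pos_of_pos hc
    simp
    field_simp
  | succ m ih =>
    have key : ∑ k ∈ Finset.range (m + 1 + 1), ((m + 1).choose k : ℝ) * (n.descFactorial k : ℝ)
          / Real.Gamma (k + c)
        = ∑ k ∈ Finset.range (m + 1), (m.choose k : ℝ) * (n.descFactorial k : ℝ) / Real.Gamma (k + c)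
          + ∑ k ∈ Finset.range (m + 1), (m.choose k : ℝ) * (n.descFactorial (k + 1) : ℝ)
            / Real.Gamma (k + (c + 1)) := by
      rw [Finset.sum_range_succ' _ (m + 1), Finset.sum_range_succ' (fun k : ℕ =>
        (m.choose k : ℝ) * (n.descFactorial k : ℝ) / Real.Gamma (k + c)) m]
      simp_rw [Nat.choose_succ_succ', Nat.cast_add, add_mul, add_div, Finset.sum_add_distrib]
      rw [Finset.sum_range_succ (fun k : ℕ => (m.choose (k + 1) : ℝ) * _ / _)]
      simp only [Nat.choose_succ_self, Nat.cast_zero, zero_mul, zero_div, add_zero,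
        Nat.choose_zero_right]
      have : ∀ k : ℕ, (k : ℝ) + (1 : ℕ) + c = k + (c + 1) := fun k => by push_cast; ring
      simp_rw [this]
      ring
    rw [key, ih n hc]
    have hG (s : ℝ) (hs : 0 < s) : Real.Gamma (s + 1) = s * Real.Gamma s := Real.Gamma_add_one hs.ne'
    have hm : 0 < Real.Gamma (m + c) := Real.Gamma_pos_of_pos (by positivity)
    have hmn : 0 < Real.Gamma (m + n + c) := Real.Gamma_pos_of_pos (by positivity)
    have e1 : Real.Gamma (((m + 1 : ℕ) : ℝ) + c) = (m + c) * Real.Gamma (m + c) := by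
      rw [← hG _ (by positivity)]; push_cast; ring_nf
    have e2 : Real.Gamma (((m + 1 : ℕ) : ℝ) + n + c) = (m + n + c) * Real.Gamma (m + n + c) := by
      rw [← hG _ (by positivity)]; push_cast; ring_nf
    rw [e1, e2]
    cases n with
    | zero =>
      have h' : 0 < Real.Gamma c := Real.Gamma_pos_of_pos hc
      simp
      field_simp
    | succ n =>
      simp_rw [Nat.succ_descFactorial_succ, Nat.cast_mul]
      have := ih n (c := c + 1) (by positivity)
      have e3 : ∑ k ∈ Finset.range (m + 1), (m.choose k : ℝ) * (((n + 1 : ℕ) : ℝ) *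
            (n.descFactorial k : ℝ)) / Real.Gamma (k + (c + 1))
          = ((n + 1 : ℕ) : ℝ) * ∑ k ∈ Finset.range (m + 1), (m.choose k : ℝ) *
            (n.descFactorial k : ℝ) / Real.Gamma (k + (c + 1)) := by
        rw [Finset.mul_sum]
        exact Finset.sum_congr rfl fun k _ => by ring
      rw [e3, this]
      have hn : 0 < Real.Gamma (n + 1 + c) := Real.Gamma_pos_of_pos (by positivity)
      have f1 : Real.Gamma (m + n + (c + 1)) = Real.Gamma (m + (n + 1 : ℕ) + c) := by
        push_cast; ring_nf
      have f2 : Real.Gamma (m + (c + 1)) = (m + c) * Real.Gamma (m + c) := by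
        rw [← hG _ (by positivity)]; ring_nf
      have f3 : Real.Gamma (n + (c + 1)) = Real.Gamma ((n + 1 : ℕ) + c) := by
        push_cast; ring_nf
      have hn' : 0 < Real.Gamma ((n + 1 : ℕ) + c) := Real.Gamma_pos_of_pos (by positivity)
      have hmc : (m : ℝ) + c ≠ 0 := by positivity
      rw [f1, f2, f3]
      field_simp
      push_cast
      ring

lemma weber_term_eq {c : ℝ} (hc : 1 / 2 ≤ c) (A B : ℂ) (i j k : ℕ) :
    (A * B) ^ k / (((k.factorial : ℝ) * Real.Gamma (k + c) : ℝ) : ℂ) *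
        (A ^ i / (i.factorial : ℂ) * (B ^ j / (j.factorial : ℂ)))
      = A ^ (i + k) * B ^ (j + k) *
        ((((i + k).choose k : ℝ) * ((j + k).descFactorial k : ℝ) / Real.Gamma (k + c) /
          ((i + k).factorial * (j + k).factorial) : ℝ) : ℂ) := by
  have h1 : ((i + k).choose k : ℝ) = ((i + k).factorial : ℝ) / (i.factorial * k.factorial) := by
    rw [eq_div_iff (by positivity), ← Nat.add_choose_mul_factorial_mul_factorial i k]
    push_cast
    ring
  have h2 : ((j + k).descFactorial k : ℝ) = ((j + k).factorial : ℝ) / j.factorial := by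
    rw [eq_div_iff (by positivity)]
    have := Nat.factorial_mul_descFactorial (Nat.le_add_left k j)
    rw [Nat.add_sub_cancel] at this
    rw [← this]
    push_cast; ring
  have h4 : (Real.Gamma (k + c) : ℂ) ≠ 0 := by
    exact_mod_cast (Real.Gamma_pos_of_pos
      (by have : (0 : ℝ) ≤ k := k.cast_nonneg; linarith)).ne'
  have hf (n : ℕ) : ((n.factorial : ℕ) : ℂ) ≠ 0 := by exact_mod_cast n.factorial_ne_zero
  have := hf i
  have := hf j
  have := hf k
  have := hf (i + k)
  have := hf (j + k)
  rw [h1, h2]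
  push_cast
  field_simp
  ring

lemma HasSum.mul_prod_of_norm {ι κ : Type*} {f : ι → ℂ} {g : κ → ℂ} {a b : ℂ} (hf : HasSum f a)
    (hg : HasSum g b) (hfn : Summable fun i => ‖f i‖) (hgn : Summable fun i => ‖g i‖) :
    HasSum (fun p : ι × κ => f p.1 * g p.2) (a * b) :=
  HasSum.mul hf hg (summable_mul_of_summable_norm hfn hgn)

/-- The double series behind Weber's integral: it sums to `exp (A + B) * besselEntire c (A * B)`,
by expanding the exponentials and regrouping with the Chu-Vandermonde identity. -/
lemma hasSum_weber {c : ℝ} (hc : 1 / 2 ≤ c) (A B : ℂ) :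
    HasSum (fun p : ℕ × ℕ => A ^ p.1 * B ^ p.2 *
      ((Real.Gamma (p.1 + p.2 + c) / ((p.1.factorial * Real.Gamma (p.1 + c)) *
        (p.2.factorial * Real.Gamma (p.2 + c))) : ℝ) : ℂ))
      (Complex.exp (A + B) * besselEntire c (A * B)) := by
  have hexp (z : ℂ) : HasSum (fun k : ℕ => z ^ k / (k.factorial : ℂ)) (Complex.exp z) := by
    rw [Complex.exp_eq_exp_ℂ]; exact NormedSpace.expSeries_div_hasSum_exp z
  have hexpn (z : ℂ) : Summable (fun k : ℕ => ‖z ^ k / (k.factorial : ℂ)‖) :=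
    NormedSpace.norm_expSeries_div_summable z
  obtain ⟨b, hbdef⟩ : ∃ b : ℕ → ℂ, b = fun k : ℕ => (A * B) ^ k /
    (((k.factorial : ℝ) * Real.Gamma (k + c) : ℝ) : ℂ) := ⟨_, rfl⟩
  have hbs : HasSum b (besselEntire c (A * B)) := by
    rw [hbdef]; exact (summable_besselEntire hc (A * B)).hasSum
  have hb : Summable fun k => ‖b k‖ := by
    simp_rw [hbdef, norm_besselEntire_term c hc]
    exact summable_besselEntire_real hc (norm_nonneg _)
  obtain ⟨E, hE⟩ : ∃ E : ℂ → ℕ → ℂ, E = fun z k => z ^ k / (k.factorial : ℂ) := ⟨_, rfl⟩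
  replace hexp (z : ℂ) : HasSum (E z) (Complex.exp z) := by rw [hE]; exact hexp z
  replace hexpn (z : ℂ) : Summable fun k => ‖E z k‖ := by rw [hE]; exact hexpn z
  have he : HasSum (fun p : ℕ × ℕ => E A p.1 * E B p.2) (Complex.exp (A + B)) := by
    rw [Complex.exp_add]
    exact HasSum.mul_prod_of_norm (hexp A) (hexp B) (hexpn A) (hexpn B)
  have hen : Summable fun p : ℕ × ℕ => ‖E A p.1 * E B p.2‖ :=
    Summable.mul_norm (hexpn A) (hexpn B)
  have h3 : HasSum (fun x : ℕ × (ℕ × ℕ) => b x.1 * (E A x.2.1 * E B x.2.2))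
      (besselEntire c (A * B) * Complex.exp (A + B)) := by
    have := HasSum.mul_prod_of_norm hbs he hb hen
    exact this
  -- shift the exponents: `(k, (i, j))` contributes to the monomial `A ^ (i + k) * B ^ (j + k)`
  obtain ⟨φ, hφdef⟩ : ∃ φ : ℕ × (ℕ × ℕ) → (ℕ × ℕ) × ℕ,
    ∀ k i j, φ (k, (i, j)) = ((i + k, j + k), k) :=
    ⟨fun x => ((x.2.1 + x.1, x.2.2 + x.1), x.1), fun _ _ _ => rfl⟩
  have hφ : Function.Injective φ := by
    rintro ⟨k, i, j⟩ ⟨k', i', j'⟩ h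
    simp only [hφdef, Prod.mk.injEq] at h
    simp only [Prod.mk.injEq]
    omega
  obtain ⟨H, hHdef⟩ : ∃ H : (ℕ × ℕ) × ℕ → ℂ, ∀ m n k, H ((m, n), k) = A ^ m * B ^ n *
    (((m.choose k : ℝ) * (n.descFactorial k : ℝ) / Real.Gamma (k + c) /
      (m.factorial * n.factorial) : ℝ) : ℂ) :=
    ⟨fun y => A ^ y.1.1 * B ^ y.1.2 *
      (((y.1.1.choose y.2 : ℝ) * (y.1.2.descFactorial y.2 : ℝ) / Real.Gamma (y.2 + c) /
      (y.1.1.factorial * y.1.2.factorial) : ℝ) : ℂ), fun _ _ _ => rfl⟩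
  have hH : HasSum H (Complex.exp (A + B) * besselEntire c (A * B)) := by
    refine (hφ.hasSum_iff ?_).1 ?_
    · rintro ⟨⟨m, n⟩, k⟩ hx
      rw [hHdef]
      by_cases hm : k ≤ m
      · by_cases hn : k ≤ n
        · exact absurd ⟨(k, (m - k, n - k)), by simp [hφdef, hm, hn]⟩ hx
        · simp [Nat.descFactorial_eq_zero_iff_lt.2 (not_le.1 hn)]
      · simp [Nat.choose_eq_zero_of_lt (not_le.1 hm)]
    · rw [mul_comm]
      refine h3.congr_fun ?_
      rintro ⟨k, i, j⟩
      rw [Function.comp, hφdef, hHdef, hbdef, hE]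
      exact (weber_term_eq hc A B i j k).symm
  refine hH.prod_fiberwise fun p => ?_
  obtain ⟨m, n⟩ := p
  have hfin : HasSum (fun k => H ((m, n), k)) _ := hasSum_sum_of_ne_finset_zero
    (s := Finset.range (m + 1)) (fun k hk => by
      have : m < k := by simpa [Nat.lt_succ_iff] using hk
      rw [hHdef, Nat.choose_eq_zero_of_lt this]
      simp)
  convert hfin using 1
  simp only [hHdef]
  rw [← Finset.mul_sum, ← Complex.ofReal_sum, ← Finset.sum_div,
    sum_choose_mul_descFactorial_div_Gamma _ _ (by linarith : 0 < c), div_div]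
  congr 3
  ring

lemma cpow_neg_natCast_add {w : ℂ} (hw : 0 < w.re) (m : ℕ) (c : ℝ) :
    w ^ (-((m + c : ℝ) : ℂ)) = (w⁻¹) ^ m * w ^ (-(c : ℂ)) := by
  have h0 : w ≠ 0 := by rintro rfl; simp at hw
  push_cast
  rw [neg_add, Complex.cpow_add _ _ h0, Complex.cpow_neg, Complex.cpow_natCast, inv_pow]

/-- Weber's second exponential integral, with complex parameters. -/
lemma integral_weber {a : ℝ} (ha : 0 ≤ a) {w : ℂ} (hw : 0 < w.re) (P Q : ℂ) :
    ∫ k, Complex.exp (-w * (k : ℂ) ^ 2) * (besselEntire ((a + 1) / 2) (-P * (k : ℂ) ^ 2) *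
        besselEntire ((a + 1) / 2) (-Q * (k : ℂ) ^ 2)) ∂(halfLineMeasure a)
      = 1 / 2 * w ^ (-(((a + 1) / 2 : ℝ) : ℂ)) * Complex.exp (-(P + Q) / w)
        * besselEntire ((a + 1) / 2) (P * Q / w ^ 2) := by
  set c := (a + 1) / 2 with hcdef
  have hc : 1 / 2 ≤ c := by rw [hcdef]; linarith
  have h0 : w ≠ 0 := by rintro rfl; simp at hw
  let C : ℕ × ℕ → ℝ := fun p => 1 / ((p.1.factorial * Real.Gamma (p.1 + c)) *
        (p.2.factorial * Real.Gamma (p.2 + c)))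
  have hC (p : ℕ × ℕ) : 0 ≤ C p := by
    have h (n : ℕ) : 0 < Real.Gamma (n + c) :=
      Real.Gamma_pos_of_pos (by have : (0 : ℝ) ≤ n := n.cast_nonneg; linarith)
    have := h p.1
    have := h p.2
    positivity
  let F : ℕ × ℕ → ℝ → ℂ := fun p k => ((-P) ^ p.1 * (-Q) ^ p.2 * (C p : ℂ)) *
    (k ^ (2 * (p.1 + p.2)) • Complex.exp (-w * (k : ℂ) ^ 2))
  have han (n : ℕ) : 0 ≤ a + 2 * (n : ℝ) := by positivity
  have hcn (n : ℕ) : (a + 2 * (n : ℝ) + 1) / 2 = n + c := by rw [hcdef]; ring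
  have hint (p : ℕ × ℕ) : Integrable (F p) (halfLineMeasure a) :=
    (integrable_pow_mul_halfLine_iff.2
      (integrable_cexp_neg_mul_sq_halfLine (han (p.1 + p.2)) hw)).const_mul _
  have hval (p : ℕ × ℕ) : ∫ k, F p k ∂(halfLineMeasure a)
      = (1 / 2 * w ^ (-(c : ℂ))) * ((-P / w) ^ p.1 * (-Q / w) ^ p.2 *
      ((Real.Gamma (p.1 + p.2 + c) / ((p.1.factorial * Real.Gamma (p.1 + c)) *
        (p.2.factorial * Real.Gamma (p.2 + c))) : ℝ) : ℂ)) := by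
    simp only [F]
    rw [integral_const_mul, integral_pow_mul_halfLine,
      integral_cexp_neg_mul_sq_halfLine (han (p.1 + p.2)) hw, hcn, cpow_neg_natCast_add hw]
    simp only [C]
    push_cast
    rw [pow_add]
    simp only [div_pow, inv_pow]
    field_simp
  have hnorm (p : ℕ × ℕ) : ∫ k, ‖F p k‖ ∂(halfLineMeasure a)
      = (1 / 2 * w.re ^ (-c)) * ((‖P‖ / w.re) ^ p.1 * (‖Q‖ / w.re) ^ p.2 *
      (Real.Gamma (p.1 + p.2 + c) / ((p.1.factorial * Real.Gamma (p.1 + c)) *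
        (p.2.factorial * Real.Gamma (p.2 + c))))) := by
    have e (k : ℝ) : ‖F p k‖ = (‖P‖ ^ p.1 * ‖Q‖ ^ p.2 * C p) *
        (k ^ (2 * (p.1 + p.2)) • Real.exp (-w.re * k ^ 2)) := by
      simp only [F, norm_mul, norm_pow, norm_neg, Complex.norm_real, norm_smul,
        norm_cexp_neg_mul_sq', Real.norm_of_nonneg (hC p), smul_eq_mul, Real.norm_eq_abs]
      rw [pow_mul |k|, sq_abs, ← pow_mul]
    simp_rw [e]
    rw [integral_const_mul, integral_pow_mul_halfLine,
      integral_exp_neg_mul_sq_halfLine (han (p.1 + p.2)) hw, hcn, neg_add, Real.rpow_add hw,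
      Real.rpow_neg hw.le, Real.rpow_natCast]
    simp only [C]
    push_cast
    rw [pow_add]
    simp only [div_pow]
    field_simp
  have hsum : Summable fun p => ∫ k, ‖F p k‖ ∂(halfLineMeasure a) := by
    simp_rw [hnorm]
    refine Summable.mul_left _ ?_
    have := (hasSum_weber hc ((‖P‖ / w.re : ℝ) : ℂ) ((‖Q‖ / w.re : ℝ) : ℂ)).summable
    exact_mod_cast this
  have key := hasSum_integral_of_summable_integral_norm hint hsum
  simp_rw [hval] at key
  have := key.unique ((hasSum_weber hc (-P / w) (-Q / w)).mul_left _)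
  have e1 (k : ℝ) : ∑' p, F p k = Complex.exp (-w * (k : ℂ) ^ 2) *
      (besselEntire c (-P * (k : ℂ) ^ 2) * besselEntire c (-Q * (k : ℂ) ^ 2)) := by
    have hs (P : ℂ) : Summable fun n : ℕ => ‖(-P * (k : ℂ) ^ 2) ^ n /
        (((n.factorial : ℝ) * Real.Gamma (n + c) : ℝ) : ℂ)‖ := by
      simp_rw [norm_besselEntire_term c hc]
      exact summable_besselEntire_real hc (norm_nonneg _)
    rw [besselEntire, besselEntire, tsum_mul_tsum_of_summable_norm (hs P) (hs Q), ← tsum_mul_left]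
    congr 1
    ext p
    simp only [F, C]
    rw [Complex.real_smul]
    push_cast
    rw [mul_pow, mul_pow, mul_add, pow_add, pow_mul, pow_mul]
    ring
  simp_rw [e1] at this
  rw [this, show -P / w + -Q / w = -(P + Q) / w by ring,
    show -P / w * (-Q / w) = P * Q / w ^ 2 by field_simp]
  ring

/-! ### The Fourier-Bessel kernel and the heat kernel in complex time -/

lemma ofReal_mul_cpow {r : ℝ} (hr : 0 < r) {w : ℂ} (hw : w ≠ 0) (s : ℂ) :
    ((r : ℂ) * w) ^ s = (r : ℂ) ^ s * w ^ s := by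
  have hr' : (r : ℂ) ≠ 0 := by exact_mod_cast hr.ne'
  rw [Complex.cpow_def_of_ne_zero (mul_ne_zero hr' hw), Complex.cpow_def_of_ne_zero hr',
    Complex.cpow_def_of_ne_zero hw, Complex.log_ofReal_mul hr hw, add_mul, Complex.exp_add,
    Complex.ofReal_log hr.le]

/-- The kernel `(k z) ^ (-ν) J_ν(k z)`, `ν = (a - 1) / 2`, of the Hankel transform for the measure
`z ^ a dz`, extended to all real arguments as an even entire function of `k z`. -/
noncomputable def hankelKernel (a k z : ℝ) : ℂ :=
  ((2 ^ ((1 - a) / 2) : ℝ) : ℂ) * besselEntire ((a + 1) / 2) ((-((k * z) ^ 2 / 4) : ℝ) : ℂ)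

/-- The kernel of the Fourier-Bessel transform on the half-space: Fourier in `x`, Hankel in `z`. -/
noncomputable def fourierBesselKernel {d : ℕ} (a : ℝ) (Ξ X : BulkPoint d) : ℂ :=
  Complex.exp (-(2 * Real.pi * Complex.I * (inner ℝ Ξ.1 X.1 : ℝ))) * hankelKernel a Ξ.2 X.2

/-- The symbol of minus the operator `Δ_x + ∂_zz + (a / z) ∂_z` under the Fourier-Bessel transform. -/
noncomputable def bulkSymbol {d : ℕ} (Ξ : BulkPoint d) : ℝ :=
  4 * Real.pi ^ 2 * ‖Ξ.1‖ ^ 2 + Ξ.2 ^ 2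

/-- The Bessel heat kernel at the complex time `w`; the value `w = i t` is the Schrödinger
kernel. -/
noncomputable def besselHeat (a : ℝ) (w : ℂ) (z ζ : ℝ) : ℂ :=
  (2 * w) ^ (-(((a + 1) / 2 : ℝ) : ℂ)) * ((2 ^ ((1 - a) / 2) : ℝ) : ℂ)
    * (besselEntire ((a + 1) / 2) (((z * ζ : ℝ) / (2 * w)) ^ 2 / 4)
    * Complex.exp (-((z ^ 2 + ζ ^ 2 : ℝ) / (4 * w))))

/-- The Euclidean heat kernel at the complex time `w`. -/
noncomputable def freeHeat {d : ℕ} (w : ℂ) (x y : EuclideanSpace ℝ (Fin d)) : ℂ :=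
  (4 * (Real.pi : ℂ) * w) ^ (-(d : ℂ) / 2) * Complex.exp (-((‖x - y‖ ^ 2 : ℝ) / (4 * w)))

/-- The heat kernel of the half-space (zero Neumann condition) at the complex time `w`. -/
noncomputable def bulkHeat {d : ℕ} (a : ℝ) (w : ℂ) (X Y : BulkPoint d) : ℂ :=
  besselHeat a w X.2 Y.2 * freeHeat w X.1 Y.1

section kernels

variable {d : ℕ} {a : ℝ}

lemma half_le_order (ha : 0 ≤ a) : 1 / 2 ≤ (a + 1) / 2 := by linarith

lemma conj_hankelKernel (k z : ℝ) : conj (hankelKernel a k z) = hankelKernel a k z := by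
  rw [hankelKernel, besselEntire_ofReal, ← Complex.ofReal_mul, Complex.conj_ofReal]

lemma hankelKernel_comm (k z : ℝ) : hankelKernel a k z = hankelKernel a z k := by
  rw [hankelKernel, hankelKernel, mul_comm k z]

/-- A uniform bound for the Hankel kernel. -/
noncomputable def hankelBound (a : ℝ) : ℝ := 2 ^ ((1 - a) / 2) * (Real.Gamma ((a + 1) / 2))⁻¹

lemma hankelBound_pos (ha : 0 ≤ a) : 0 < hankelBound a := by
  have : 0 < Real.Gamma ((a + 1) / 2) := Real.Gamma_pos_of_pos (by linarith)
  unfold hankelBound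
  positivity

lemma norm_hankelKernel_le (ha : 0 ≤ a) (k z : ℝ) : ‖hankelKernel a k z‖ ≤ hankelBound a := by
  have h := norm_besselEntire_le (half_le_order ha) (Complex.I * ((k * z : ℝ) : ℂ))
  have e : (Complex.I * ((k * z : ℝ) : ℂ)) ^ 2 / 4 = ((-((k * z) ^ 2 / 4) : ℝ) : ℂ) := by
    rw [mul_pow, Complex.I_sq]; push_cast; ring
  rw [e] at h
  have h0 : (Complex.I * ((k * z : ℝ) : ℂ)).re = 0 := by simp
  rw [h0, abs_zero, Real.exp_zero, mul_one] at h
  rw [hankelKernel, norm_mul, Complex.norm_real, Real.norm_of_nonneg (by positivity), hankelBound]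
  gcongr

lemma continuous_hankelKernel (ha : 0 ≤ a) :
    Continuous fun p : ℝ × ℝ => hankelKernel a p.1 p.2 := by
  unfold hankelKernel
  have := continuous_besselEntire (half_le_order ha)
  fun_prop

lemma fourierBesselKernel_comm (Ξ X : BulkPoint d) :
    fourierBesselKernel a Ξ X = fourierBesselKernel a X Ξ := by
  rw [fourierBesselKernel, fourierBesselKernel, hankelKernel_comm, real_inner_comm]

lemma norm_fourierBesselKernel_le (ha : 0 ≤ a) (Ξ X : BulkPoint d) :
    ‖fourierBesselKernel a Ξ X‖ ≤ hankelBound a := by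
  rw [fourierBesselKernel, norm_mul]
  have : ‖Complex.exp (-(2 * Real.pi * Complex.I * (inner ℝ Ξ.1 X.1 : ℝ)))‖ = 1 := by
    rw [show -(2 * Real.pi * Complex.I * ((inner ℝ Ξ.1 X.1 : ℝ) : ℂ))
      = ((-(2 * Real.pi * inner ℝ Ξ.1 X.1) : ℝ) : ℂ) * Complex.I by push_cast; ring]
    exact Complex.norm_exp_ofReal_mul_I _
  rw [this, one_mul]
  exact norm_hankelKernel_le ha _ _

lemma continuous_fourierBesselKernel (ha : 0 ≤ a) :
    Continuous fun p : BulkPoint d × BulkPoint d => fourierBesselKernel a p.1 p.2 := by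
  unfold fourierBesselKernel
  have h2 : Continuous fun p : BulkPoint d × BulkPoint d => hankelKernel a p.1.2 p.2.2 := by
    have h3 : Continuous fun p : BulkPoint d × BulkPoint d => (p.1.2, p.2.2) := by fun_prop
    have h4 := (continuous_hankelKernel ha).comp h3
    exact h4
  have h1 : Continuous fun p : BulkPoint d × BulkPoint d =>
      Complex.exp (-(2 * Real.pi * Complex.I * (inner ℝ p.1.1 p.2.1 : ℝ))) := by fun_prop
  have h := h1.mul h2
  exact h

lemma continuous_bulkSymbol : Continuous (bulkSymbol (d := d)) := by
  unfold bulkSymbol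
  fun_prop

lemma bulkSymbol_nonneg (Ξ : BulkPoint d) : 0 ≤ bulkSymbol Ξ := by
  unfold bulkSymbol
  positivity

/-! ### Integral formulas for the heat kernel -/

/-- Weber's formula: the Bessel heat kernel in terms of the Hankel transform. -/
lemma integral_hankelKernel_mul (ha : 0 ≤ a) {w : ℂ} (hw : 0 < w.re) (z ζ : ℝ) :
    ∫ k, Complex.exp (-w * (k : ℂ) ^ 2) * (hankelKernel a k z * hankelKernel a k ζ)
        ∂(halfLineMeasure a) = besselHeat a w z ζ := by
  have h := integral_weber ha hw ((z ^ 2 / 4 : ℝ) : ℂ) ((ζ ^ 2 / 4 : ℝ) : ℂ)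
  have h0 : w ≠ 0 := by rintro rfl; simp at hw
  have e (k : ℝ) : Complex.exp (-w * (k : ℂ) ^ 2) * (hankelKernel a k z * hankelKernel a k ζ)
      = ((2 ^ ((1 - a) / 2) : ℝ) : ℂ) ^ 2 * (Complex.exp (-w * (k : ℂ) ^ 2) *
        (besselEntire ((a + 1) / 2) (-((z ^ 2 / 4 : ℝ) : ℂ) * (k : ℂ) ^ 2) *
        besselEntire ((a + 1) / 2) (-((ζ ^ 2 / 4 : ℝ) : ℂ) * (k : ℂ) ^ 2))) := by
    rw [hankelKernel, hankelKernel,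
      show ((-((k * z) ^ 2 / 4) : ℝ) : ℂ) = -((z ^ 2 / 4 : ℝ) : ℂ) * (k : ℂ) ^ 2 by push_cast; ring,
      show ((-((k * ζ) ^ 2 / 4) : ℝ) : ℂ) = -((ζ ^ 2 / 4 : ℝ) : ℂ) * (k : ℂ) ^ 2 by push_cast; ring]
    ring
  simp_rw [e]
  rw [integral_const_mul, h, besselHeat]
  rw [show (2 * w : ℂ) = ((2 : ℝ) : ℂ) * w by push_cast; ring,
    ofReal_mul_cpow (by norm_num) h0, show (-(((a + 1) / 2 : ℝ) : ℂ)) = ((-((a + 1) / 2) : ℝ) : ℂ) by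
      push_cast; ring, ← Complex.ofReal_cpow (by norm_num)]
  have e2 : (2 : ℝ) ^ ((1 - a) / 2) * (1 / 2) = 2 ^ (-((a + 1) / 2)) := by
    rw [show (1 - a) / 2 = -((a + 1) / 2) + 1 by ring, Real.rpow_add (by norm_num), Real.rpow_one]
    ring
  have e3 : ((z ^ 2 / 4 : ℝ) : ℂ) * ((ζ ^ 2 / 4 : ℝ) : ℂ) / w ^ 2
      = ((z * ζ : ℝ) / (((2 : ℝ) : ℂ) * w)) ^ 2 / 4 := by
    push_cast; field_simp; ring
  have e4 : -(((z ^ 2 / 4 : ℝ) : ℂ) + ((ζ ^ 2 / 4 : ℝ) : ℂ)) / w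
      = -((z ^ 2 + ζ ^ 2 : ℝ) / (4 * w)) := by
    push_cast; field_simp
  rw [e3, e4, ← e2]
  push_cast
  ring

/-- Gaussian average of the Bessel heat kernel at a real time. -/
lemma integral_besselHeat_mul_gaussian (ha : 0 ≤ a) {ε s : ℝ} (hε : 0 < ε) (hs : 0 ≤ s) (z : ℝ) :
    ∫ ζ, besselHeat a ε z ζ * Complex.exp (-(s : ℂ) * (ζ : ℂ) ^ 2) ∂(halfLineMeasure a)
      = (((1 + 4 * ε * s) ^ (-((a + 1) / 2)) * Real.exp (-(s * z ^ 2 / (1 + 4 * ε * s))) : ℝ) : ℂ) := by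
  have hw : 0 < (((1 + 4 * ε * s) / (4 * ε) : ℝ) : ℂ).re := by
    rw [Complex.ofReal_re]; positivity
  have hc : 0 < Real.Gamma ((a + 1) / 2) := Real.Gamma_pos_of_pos (by linarith)
  have hb0 : besselEntire ((a + 1) / 2) 0 = ((Real.Gamma ((a + 1) / 2))⁻¹ : ℝ) := by
    rw [besselEntire, tsum_eq_single 0 (fun k hk => by simp [hk])]
    simp
  have h := integral_weber ha hw ((-(z ^ 2 / (16 * ε ^ 2)) : ℝ) : ℂ) 0
  simp only [neg_zero, zero_mul, mul_zero, zero_div, hb0] at h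
  have e (ζ : ℝ) : besselHeat a ε z ζ * Complex.exp (-(s : ℂ) * (ζ : ℂ) ^ 2)
      = ((Real.Gamma ((a + 1) / 2) * ((2 * ε) ^ (-((a + 1) / 2)) * 2 ^ ((1 - a) / 2) *
          Real.exp (-(z ^ 2 / (4 * ε)))) : ℝ) : ℂ) *
        (Complex.exp (-(((1 + 4 * ε * s) / (4 * ε) : ℝ) : ℂ) * (ζ : ℂ) ^ 2) *
        (besselEntire ((a + 1) / 2) (-((-(z ^ 2 / (16 * ε ^ 2)) : ℝ) : ℂ) * (ζ : ℂ) ^ 2) *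
          ((Real.Gamma ((a + 1) / 2))⁻¹ : ℝ))) := by
    have hε' : (ε : ℂ) ≠ 0 := by exact_mod_cast hε.ne'
    rw [besselHeat, show (2 * (ε : ℂ)) = ((2 * ε : ℝ) : ℂ) by push_cast; ring,
      show (-(((a + 1) / 2 : ℝ) : ℂ)) = ((-((a + 1) / 2) : ℝ) : ℂ) by push_cast; ring,
      ← Complex.ofReal_cpow (by positivity),
      show (((z * ζ : ℝ) : ℂ) / ((2 * ε : ℝ) : ℂ)) ^ 2 / 4
        = -((-(z ^ 2 / (16 * ε ^ 2)) : ℝ) : ℂ) * (ζ : ℂ) ^ 2 by push_cast; field_simp; ring]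
    have e1 : Complex.exp (-((z ^ 2 + ζ ^ 2 : ℝ) / (4 * (ε : ℂ)))) *
        Complex.exp (-(s : ℂ) * (ζ : ℂ) ^ 2) = ((Real.exp (-(z ^ 2 / (4 * ε))) : ℝ) : ℂ) *
        Complex.exp (-(((1 + 4 * ε * s) / (4 * ε) : ℝ) : ℂ) * (ζ : ℂ) ^ 2) := by
      rw [Complex.ofReal_exp, ← Complex.exp_add, ← Complex.exp_add]
      congr 1
      push_cast
      field_simp
      ring
    have hc' : (Real.Gamma ((a + 1) / 2) : ℂ) ≠ 0 := by exact_mod_cast hc.ne'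
    rw [mul_assoc, mul_assoc (besselEntire _ _), e1]
    push_cast
    field_simp
  simp_rw [e]
  rw [integral_const_mul, h, show (-(((a + 1) / 2 : ℝ) : ℂ)) = ((-((a + 1) / 2) : ℝ) : ℂ) by
    push_cast; ring, ← Complex.ofReal_cpow (by positivity), add_zero,
    ← Complex.ofReal_neg, neg_neg, ← Complex.ofReal_div, ← Complex.ofReal_exp,
    show (1 / 2 : ℂ) = ((1 / 2 : ℝ) : ℂ) by push_cast; ring]
  simp only [← Complex.ofReal_mul]
  congr 1
  have h1 : Real.exp (-(z ^ 2 / (4 * ε))) *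
      Real.exp (z ^ 2 / (16 * ε ^ 2) / ((1 + 4 * ε * s) / (4 * ε)))
      = Real.exp (-(s * z ^ 2 / (1 + 4 * ε * s))) := by
    rw [← Real.exp_add]
    congr 1
    have : 1 + 4 * ε * s ≠ 0 := by positivity
    field_simp
    ring
  have h2 : (2 * ε) ^ (-((a + 1) / 2)) * ((1 + 4 * ε * s) / (4 * ε)) ^ (-((a + 1) / 2))
      * 2 ^ ((1 - a) / 2) * (1 / 2) = (1 + 4 * ε * s) ^ (-((a + 1) / 2)) := by
    have hp : (0 : ℝ) < 1 + 4 * ε * s := by positivity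
    rw [← Real.mul_rpow (by positivity) (div_nonneg hp.le (by positivity)),
      show 2 * ε * ((1 + 4 * ε * s) / (4 * ε)) = (1 + 4 * ε * s) * 2⁻¹ by field_simp; norm_num,
      Real.mul_rpow hp.le (by norm_num), Real.inv_rpow (by norm_num),
      Real.rpow_neg (by norm_num : (0 : ℝ) ≤ 2), inv_inv, mul_assoc, mul_assoc, ← mul_assoc (2 ^ _), ← Real.rpow_add (by norm_num),
      show (a + 1) / 2 + (1 - a) / 2 = 1 by ring]
    norm_num
  rw [← h1, ← h2]
  field_simp

lemma integral_freeHeat_mul_gaussian {ε s : ℝ} (hε : 0 < ε) (hs : 0 ≤ s)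
    (x : EuclideanSpace ℝ (Fin d)) :
    ∫ y, freeHeat (d := d) ε x y * Complex.exp (-(s : ℂ) * (‖x - y‖ : ℂ) ^ 2)
      = (((1 + 4 * ε * s) ^ (-(d : ℝ) / 2) : ℝ) : ℂ) := by
  have hb : 0 < (((1 + 4 * ε * s) / (4 * ε) : ℝ) : ℂ).re := by
    rw [Complex.ofReal_re]; positivity
  have hε' : (ε : ℂ) ≠ 0 := by exact_mod_cast hε.ne'
  have e (y : EuclideanSpace ℝ (Fin d)) :
      freeHeat (d := d) ε x y * Complex.exp (-(s : ℂ) * (‖x - y‖ : ℂ) ^ 2)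
      = (4 * (Real.pi : ℂ) * ε) ^ (-(d : ℂ) / 2) *
        Complex.exp (-(((1 + 4 * ε * s) / (4 * ε) : ℝ) : ℂ) * (‖x - y‖ : ℂ) ^ 2) := by
    rw [freeHeat, mul_assoc, ← Complex.exp_add]
    congr 2
    push_cast
    field_simp
    ring
  simp_rw [e]
  rw [integral_const_mul, integral_sub_left_eq_self (fun y : EuclideanSpace ℝ (Fin d) =>
    Complex.exp (-(((1 + 4 * ε * s) / (4 * ε) : ℝ) : ℂ) * (‖y‖ : ℂ) ^ 2)) volume x,
    GaussianFourier.integral_cexp_neg_mul_sq_norm hb, finrank_euclideanSpace_fin,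
    show 4 * (Real.pi : ℂ) * ε = ((4 * Real.pi * ε : ℝ) : ℂ) by push_cast; ring,
    show (-(d : ℂ) / 2) = ((-(d : ℝ) / 2 : ℝ) : ℂ) by push_cast; ring,
    show ((d : ℂ) / 2) = (((d : ℝ) / 2 : ℝ) : ℂ) by push_cast; ring, ← Complex.ofReal_div,
    ← Complex.ofReal_cpow (by positivity), ← Complex.ofReal_cpow (by positivity),
    ← Complex.ofReal_mul]
  congr 1
  rw [neg_div, Real.rpow_neg (by positivity), Real.rpow_neg (by positivity),
    ← Real.inv_rpow (by positivity), ← Real.inv_rpow (by positivity),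
    ← Real.mul_rpow (by positivity) (by positivity)]
  congr 1
  field_simp

lemma integral_fourier_gaussian {w : ℂ} (hw : 0 < w.re) (x y : EuclideanSpace ℝ (Fin d)) :
    ∫ ξ : EuclideanSpace ℝ (Fin d), Complex.exp (-w * ((4 * Real.pi ^ 2 * ‖ξ‖ ^ 2 : ℝ) : ℂ)) *
      (Complex.exp (-(2 * Real.pi * Complex.I * (inner ℝ ξ x : ℝ))) *
        conj (Complex.exp (-(2 * Real.pi * Complex.I * (inner ℝ ξ y : ℝ))))) = freeHeat w x y := by
  have h0 : w ≠ 0 := by rintro rfl; simp at hw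
  have hpi : (Real.pi : ℂ) ≠ 0 := by exact_mod_cast Real.pi_ne_zero
  have hb : 0 < (((4 * Real.pi ^ 2 : ℝ) : ℂ) * w).re := by
    rw [Complex.re_ofReal_mul]; positivity
  have h := GaussianFourier.integral_cexp_neg_mul_sq_norm_add hb (-(2 * Real.pi * Complex.I)) (x - y)
  have e (ξ : EuclideanSpace ℝ (Fin d)) :
      Complex.exp (-w * ((4 * Real.pi ^ 2 * ‖ξ‖ ^ 2 : ℝ) : ℂ)) *
      (Complex.exp (-(2 * Real.pi * Complex.I * (inner ℝ ξ x : ℝ))) *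
        conj (Complex.exp (-(2 * Real.pi * Complex.I * (inner ℝ ξ y : ℝ)))))
      = Complex.exp (-(((4 * Real.pi ^ 2 : ℝ) : ℂ) * w) * (‖ξ‖ : ℂ) ^ 2 +
        (-(2 * Real.pi * Complex.I)) * (inner ℝ (x - y) ξ : ℝ)) := by
    rw [← Complex.exp_conj, ← Complex.exp_add, ← Complex.exp_add]
    congr 1
    rw [inner_sub_left, real_inner_comm x ξ, real_inner_comm y ξ]
    simp only [map_neg, map_mul, Complex.conj_ofReal, Complex.conj_I, map_ofNat]
    push_cast
    ring
  simp_rw [e]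
  rw [h, finrank_euclideanSpace_fin, freeHeat]
  congr 1
  · have hp : (4 * (Real.pi : ℂ) * w) = ((4 * Real.pi : ℝ) : ℂ) * w := by push_cast; ring
    have hq : (Real.pi : ℂ) / (((4 * Real.pi ^ 2 : ℝ) : ℂ) * w)
        = (4 * (Real.pi : ℂ) * w)⁻¹ := by
      push_cast; field_simp
    rw [hq, Complex.inv_cpow, neg_div, Complex.cpow_neg]
    rw [hp]
    intro h
    rw [Complex.arg_real_mul _ (by positivity)] at h
    have := Complex.abs_arg_lt_pi_div_two_iff.2 (Or.inl hw)
    rw [h, abs_of_pos Real.pi_pos] at this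
    linarith [Real.pi_pos]
  · congr 1
    push_cast
    field_simp
    rw [Complex.I_sq]
    ring

end kernels

section bulk

variable {d : ℕ} {a : ℝ}

instance instSigmaFiniteHalfLine (a : ℝ) : SigmaFinite (halfLineMeasure a) :=
  SigmaFinite.withDensity_ofReal _

instance instSigmaFiniteHalfSpace (d : ℕ) (a : ℝ) : SigmaFinite (halfSpaceMeasure d a) := by
  unfold halfSpaceMeasure
  infer_instance

instance instSigmaFiniteSpaceTime (d : ℕ) (a : ℝ) : SigmaFinite (spaceTimeMeasure d a) := by
  unfold spaceTimeMeasure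
  infer_instance

lemma ae_halfSpace_pos (d : ℕ) (a : ℝ) : ∀ᵐ X ∂(halfSpaceMeasure d a), 0 < X.2 :=
  Measure.quasiMeasurePreserving_snd.ae (ae_halfLine_pos a)

/-- The heat kernel is the superposition of its Fourier-Bessel modes. -/
lemma integral_fourierBesselKernel_mul (ha : 0 ≤ a) {w : ℂ} (hw : 0 < w.re) (X Y : BulkPoint d) :
    ∫ Ξ, Complex.exp (-w * (bulkSymbol Ξ : ℂ)) *
        (fourierBesselKernel a Ξ X * conj (fourierBesselKernel a Ξ Y)) ∂(halfSpaceMeasure d a)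
      = bulkHeat a w X Y := by
  have e (Ξ : BulkPoint d) : Complex.exp (-w * (bulkSymbol Ξ : ℂ)) *
        (fourierBesselKernel a Ξ X * conj (fourierBesselKernel a Ξ Y))
      = (Complex.exp (-w * ((4 * Real.pi ^ 2 * ‖Ξ.1‖ ^ 2 : ℝ) : ℂ)) *
      (Complex.exp (-(2 * Real.pi * Complex.I * (inner ℝ Ξ.1 X.1 : ℝ))) *
        conj (Complex.exp (-(2 * Real.pi * Complex.I * (inner ℝ Ξ.1 Y.1 : ℝ)))))) *
      (Complex.exp (-w * (Ξ.2 : ℂ) ^ 2) * (hankelKernel a Ξ.2 X.2 * hankelKernel a Ξ.2 Y.2)) := by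
    rw [bulkSymbol, fourierBesselKernel, fourierBesselKernel, map_mul, conj_hankelKernel,
      Complex.ofReal_add, mul_add, Complex.exp_add, Complex.ofReal_pow Ξ.2]
    ring
  simp_rw [e]
  rw [halfSpaceMeasure, integral_prod_mul (fun ξ : EuclideanSpace ℝ (Fin d) =>
      Complex.exp (-w * ((4 * Real.pi ^ 2 * ‖ξ‖ ^ 2 : ℝ) : ℂ)) *
      (Complex.exp (-(2 * Real.pi * Complex.I * (inner ℝ ξ X.1 : ℝ))) *
        conj (Complex.exp (-(2 * Real.pi * Complex.I * (inner ℝ ξ Y.1 : ℝ))))))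
      (fun k : ℝ => Complex.exp (-w * (k : ℂ) ^ 2) *
        (hankelKernel a k X.2 * hankelKernel a k Y.2)),
    integral_fourier_gaussian hw, integral_hankelKernel_mul ha hw, mul_comm, bulkHeat]

lemma norm_exp_neg_mul_bulkSymbol (w : ℂ) (Ξ : BulkPoint d) :
    ‖Complex.exp (-w * (bulkSymbol Ξ : ℂ))‖ = Real.exp (-w.re * bulkSymbol Ξ) := by
  rw [Complex.norm_exp, Complex.re_mul_ofReal, Complex.neg_re]

lemma integrable_exp_neg_mul_bulkSymbol (ha : 0 ≤ a) {ε : ℝ} (hε : 0 < ε) :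
    Integrable (fun Ξ => Real.exp (-ε * bulkSymbol Ξ)) (halfSpaceMeasure d a) := by
  have h1 : Integrable fun ξ : EuclideanSpace ℝ (Fin d) =>
      Real.exp (-(ε * (4 * Real.pi ^ 2)) * ‖ξ‖ ^ 2) := by
    have hb : 0 < (((ε * (4 * Real.pi ^ 2) : ℝ)) : ℂ).re := by
      rw [Complex.ofReal_re]; positivity
    have := (GaussianFourier.integrable_cexp_neg_mul_sq_norm_add hb 0
      (0 : EuclideanSpace ℝ (Fin d))).norm
    refine this.congr (ae_of_all _ fun ξ => ?_)
    simp only [zero_mul, add_zero]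
    rw [← Complex.ofReal_neg, ← Complex.ofReal_pow, ← Complex.ofReal_mul, ← Complex.ofReal_exp,
      Complex.norm_real, Real.norm_of_nonneg (Real.exp_pos _).le]
  have h := h1.mul_prod (integrable_exp_neg_mul_sq_halfLine ha hε)
  refine h.congr (ae_of_all _ fun Ξ => ?_)
  simp only
  rw [← Real.exp_add, bulkSymbol]
  ring_nf

lemma besselHeat_comm (w : ℂ) (z ζ : ℝ) : besselHeat a w z ζ = besselHeat a w ζ z := by
  rw [besselHeat, besselHeat, mul_comm z ζ, add_comm (z ^ 2)]

lemma bulkHeat_comm (w : ℂ) (X Y : BulkPoint d) : bulkHeat a w X Y = bulkHeat a w Y X := by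
  rw [bulkHeat, bulkHeat, besselHeat_comm, freeHeat, freeHeat, norm_sub_rev]

lemma re_inv_nonneg {w : ℂ} (hw : 0 ≤ w.re) : 0 ≤ (w⁻¹).re := by
  rw [Complex.inv_re]
  exact div_nonneg hw (Complex.normSq_nonneg w)

lemma norm_cpow_ofReal_exponent {w : ℂ} (hw : w ≠ 0) (s : ℝ) : ‖w ^ (s : ℂ)‖ = ‖w‖ ^ s := by
  rw [Complex.norm_cpow_of_ne_zero hw]
  simp

lemma norm_besselHeat_le (ha : 0 ≤ a) {w : ℂ} (hw : 0 ≤ w.re) (hw0 : w ≠ 0) (z ζ : ℝ) :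
    ‖besselHeat a w z ζ‖ ≤ hankelBound a * (2 * ‖w‖) ^ (-((a + 1) / 2)) := by
  set ρ := (w⁻¹).re with hρdef
  have hρ : 0 ≤ ρ := re_inv_nonneg hw
  have h1 := norm_besselEntire_le (half_le_order ha) (((z * ζ : ℝ) : ℂ) / (2 * w))
  have h2 : (((z * ζ : ℝ) : ℂ) / (2 * w)).re = z * ζ / 2 * ρ := by
    rw [show ((z * ζ : ℝ) : ℂ) / (2 * w) = ((z * ζ / 2 : ℝ) : ℂ) * w⁻¹ by
      push_cast; field_simp, Complex.re_ofReal_mul]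
  have h3 : ‖Complex.exp (-((z ^ 2 + ζ ^ 2 : ℝ) / (4 * w)))‖
      = Real.exp (-((z ^ 2 + ζ ^ 2) / 4 * ρ)) := by
    rw [show -(((z ^ 2 + ζ ^ 2 : ℝ) : ℂ) / (4 * w)) = ((-((z ^ 2 + ζ ^ 2) / 4) : ℝ) : ℂ) * w⁻¹ by
      push_cast; field_simp, Complex.norm_exp, Complex.re_ofReal_mul, neg_mul]
  rw [besselHeat, norm_mul, norm_mul, norm_mul, h3, Complex.norm_real,
    Real.norm_of_nonneg (by positivity), ← Complex.ofReal_neg,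
    norm_cpow_ofReal_exponent (mul_ne_zero two_ne_zero hw0), norm_mul, Complex.norm_ofNat]
  rw [h2] at h1
  have h4 : ‖besselEntire ((a + 1) / 2) ((((z * ζ : ℝ) : ℂ) / (2 * w)) ^ 2 / 4)‖ *
      Real.exp (-((z ^ 2 + ζ ^ 2) / 4 * ρ)) ≤ (Real.Gamma ((a + 1) / 2))⁻¹ := by
    have hG : 0 < Real.Gamma ((a + 1) / 2) := Real.Gamma_pos_of_pos (by linarith)
    calc _ ≤ (Real.Gamma ((a + 1) / 2))⁻¹ * Real.exp |z * ζ / 2 * ρ| *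
          Real.exp (-((z ^ 2 + ζ ^ 2) / 4 * ρ)) := by gcongr
      _ = (Real.Gamma ((a + 1) / 2))⁻¹ * Real.exp (|z * ζ / 2 * ρ| + -((z ^ 2 + ζ ^ 2) / 4 * ρ)) := by
          rw [Real.exp_add]; ring
      _ ≤ (Real.Gamma ((a + 1) / 2))⁻¹ * 1 := by
          gcongr
          rw [Real.exp_le_one_iff, abs_mul, abs_of_nonneg hρ, ← sub_eq_add_neg, ← sub_mul]
          refine mul_nonpos_of_nonpos_of_nonneg ?_ hρ
          rw [abs_div, abs_of_pos (by norm_num : (0 : ℝ) < 2)]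
          have : |z * ζ| ≤ (z ^ 2 + ζ ^ 2) / 2 :=
            abs_le.2 ⟨by nlinarith [sq_nonneg (z + ζ)], by nlinarith [sq_nonneg (z - ζ)]⟩
          linarith
      _ = _ := mul_one _
  calc _ ≤ (2 * ‖w‖) ^ (-((a + 1) / 2)) * 2 ^ ((1 - a) / 2) * (Real.Gamma ((a + 1) / 2))⁻¹ := by
        gcongr
    _ = _ := by rw [hankelBound]; ring

lemma norm_freeHeat_le {w : ℂ} (hw : 0 ≤ w.re) (hw0 : w ≠ 0) (x y : EuclideanSpace ℝ (Fin d)) :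
    ‖freeHeat w x y‖ ≤ (4 * Real.pi * ‖w‖) ^ (-(d : ℝ) / 2) := by
  have hpi : (4 * (Real.pi : ℂ) * w) ≠ 0 :=
    mul_ne_zero (mul_ne_zero (by norm_num) (by exact_mod_cast Real.pi_ne_zero)) hw0
  rw [freeHeat, norm_mul, show (-(d : ℂ) / 2) = ((-(d : ℝ) / 2 : ℝ) : ℂ) by push_cast; ring,
    norm_cpow_ofReal_exponent hpi, norm_mul, norm_mul, Complex.norm_ofNat, Complex.norm_real,
    Real.norm_of_nonneg Real.pi_pos.le]
  refine mul_le_of_le_one_right (by positivity) ?_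
  rw [show -(((‖x - y‖ ^ 2 : ℝ) : ℂ) / (4 * w)) = ((-(‖x - y‖ ^ 2 / 4) : ℝ) : ℂ) * w⁻¹ by
      push_cast; field_simp, Complex.norm_exp, Complex.re_ofReal_mul, Real.exp_le_one_iff]
  refine mul_nonpos_of_nonpos_of_nonneg ?_ (re_inv_nonneg hw)
  have : 0 ≤ ‖x - y‖ ^ 2 / 4 := by positivity
  linarith

/-- The constant of the dispersive estimate. -/
noncomputable def dispersiveConst (d : ℕ) (a : ℝ) : ℝ :=
  hankelBound a * 2 ^ (-((a + 1) / 2)) * (4 * Real.pi) ^ (-(d : ℝ) / 2)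

lemma dispersiveConst_pos (ha : 0 ≤ a) : 0 < dispersiveConst d a := by
  have := hankelBound_pos ha
  unfold dispersiveConst
  positivity

/-- The dispersive estimate, uniformly in the closed right half-plane of times. -/
lemma norm_bulkHeat_le (ha : 0 ≤ a) {w : ℂ} (hw : 0 ≤ w.re) (hw0 : w ≠ 0) (X Y : BulkPoint d) :
    ‖bulkHeat a w X Y‖ ≤ dispersiveConst d a * ‖w‖ ^ (-(((d : ℝ) + a + 1) / 2)) := by
  have hn : 0 < ‖w‖ := norm_pos_iff.2 hw0
  rw [bulkHeat, norm_mul]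
  calc _ ≤ (hankelBound a * (2 * ‖w‖) ^ (-((a + 1) / 2))) *
        (4 * Real.pi * ‖w‖) ^ (-(d : ℝ) / 2) := by
        have := hankelBound_pos ha
        gcongr
        · exact norm_besselHeat_le ha hw hw0 _ _
        · exact norm_freeHeat_le hw hw0 _ _
    _ = _ := by
        rw [Real.mul_rpow (by norm_num) hn.le, Real.mul_rpow (by positivity) hn.le, dispersiveConst,
          show -(((d : ℝ) + a + 1) / 2) = -((a + 1) / 2) + -(d : ℝ) / 2 by ring, Real.rpow_add hn]
        ring

/-! ### Real times: positivity and unit mass -/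

lemma bulkHeat_ofReal_nonneg (ha : 0 ≤ a) {ε : ℝ} (hε : 0 < ε) (X Y : BulkPoint d) :
    ∃ r : ℝ, 0 ≤ r ∧ bulkHeat a ε X Y = r := by
  have hG (k : ℕ) : 0 < Real.Gamma (k + (a + 1) / 2) := Real.Gamma_pos_of_pos (by positivity)
  refine ⟨(2 * ε) ^ (-((a + 1) / 2)) * 2 ^ ((1 - a) / 2) *
    ((∑' k : ℕ, ((X.2 * Y.2 / (2 * ε)) ^ 2 / 4) ^ k /
      ((k.factorial : ℝ) * Real.Gamma (k + (a + 1) / 2))) *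
      Real.exp (-((X.2 ^ 2 + Y.2 ^ 2) / (4 * ε)))) *
    ((4 * Real.pi * ε) ^ (-(d : ℝ) / 2) * Real.exp (-(‖X.1 - Y.1‖ ^ 2 / (4 * ε)))), ?_, ?_⟩
  · have : 0 ≤ ∑' k : ℕ, ((X.2 * Y.2 / (2 * ε)) ^ 2 / 4) ^ k /
      ((k.factorial : ℝ) * Real.Gamma (k + (a + 1) / 2)) :=
      tsum_nonneg fun k => by have := hG k; positivity
    positivity
  · rw [bulkHeat, besselHeat, freeHeat]
    simp only [Complex.ofReal_mul]
    rw [← besselEntire_ofReal, Complex.ofReal_exp, Complex.ofReal_exp,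
      Complex.ofReal_cpow (by positivity : 0 ≤ 2 * ε),
      Complex.ofReal_cpow (by positivity : 0 ≤ 4 * Real.pi * ε)]
    push_cast
    rfl

lemma integral_bulkHeat_mul_gaussian (ha : 0 ≤ a) {ε s σ : ℝ} (hε : 0 < ε) (hs : 0 ≤ s) (hσ : 0 ≤ σ)
    (X : BulkPoint d) :
    ∫ Y, bulkHeat a ε X Y * (Complex.exp (-(s : ℂ) * (Y.2 : ℂ) ^ 2) *
        Complex.exp (-(σ : ℂ) * (‖X.1 - Y.1‖ : ℂ) ^ 2)) ∂(halfSpaceMeasure d a)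
      = (((1 + 4 * ε * s) ^ (-((a + 1) / 2)) * Real.exp (-(s * X.2 ^ 2 / (1 + 4 * ε * s))) *
          (1 + 4 * ε * σ) ^ (-(d : ℝ) / 2) : ℝ) : ℂ) := by
  have e (Y : BulkPoint d) : bulkHeat a ε X Y * (Complex.exp (-(s : ℂ) * (Y.2 : ℂ) ^ 2) *
        Complex.exp (-(σ : ℂ) * (‖X.1 - Y.1‖ : ℂ) ^ 2))
      = (freeHeat (d := d) ε X.1 Y.1 * Complex.exp (-(σ : ℂ) * (‖X.1 - Y.1‖ : ℂ) ^ 2)) *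
        (besselHeat a ε X.2 Y.2 * Complex.exp (-(s : ℂ) * (Y.2 : ℂ) ^ 2)) := by
    rw [bulkHeat]; ring
  simp_rw [e]
  rw [halfSpaceMeasure, integral_prod_mul
      (fun y => freeHeat (d := d) ε X.1 y * Complex.exp (-(σ : ℂ) * (‖X.1 - y‖ : ℂ) ^ 2))
      (fun ζ => besselHeat a ε X.2 ζ * Complex.exp (-(s : ℂ) * (ζ : ℂ) ^ 2)),
    integral_besselHeat_mul_gaussian ha hε hs, integral_freeHeat_mul_gaussian hε hσ,
    ← Complex.ofReal_mul]
  congr 1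
  ring

lemma integral_bulkHeat (ha : 0 ≤ a) {ε : ℝ} (hε : 0 < ε) (X : BulkPoint d) :
    ∫ Y, bulkHeat a ε X Y ∂(halfSpaceMeasure d a) = 1 := by
  have := integral_bulkHeat_mul_gaussian ha hε le_rfl le_rfl X
  simpa using this

lemma integrable_bulkHeat (ha : 0 ≤ a) {ε : ℝ} (hε : 0 < ε) (X : BulkPoint d) :
    Integrable (fun Y => bulkHeat a ε X Y) (halfSpaceMeasure d a) := by
  refine not_imp_comm.1 integral_undef ?_
  rw [integral_bulkHeat ha hε]
  exact one_ne_zero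

lemma integral_norm_bulkHeat (ha : 0 ≤ a) {ε : ℝ} (hε : 0 < ε) (X : BulkPoint d) :
    ∫ Y, ‖bulkHeat a ε X Y‖ ∂(halfSpaceMeasure d a) = 1 := by
  have h : ∀ Y : BulkPoint d, ((‖bulkHeat a ε X Y‖ : ℝ) : ℂ) = bulkHeat a ε X Y := fun Y => by
    obtain ⟨r, hr, e⟩ := bulkHeat_ofReal_nonneg ha hε X Y
    rw [e, Complex.norm_real, Real.norm_of_nonneg hr]
  have : ∫ Y, ((‖bulkHeat a ε X Y‖ : ℝ) : ℂ) ∂(halfSpaceMeasure d a) = 1 := by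
    simp_rw [h]; exact integral_bulkHeat ha hε X
  rw [integral_complex_ofReal] at this
  exact_mod_cast this

lemma lintegral_enorm_bulkHeat (ha : 0 ≤ a) {ε : ℝ} (hε : 0 < ε) (X : BulkPoint d) :
    ∫⁻ Y, ‖bulkHeat a ε X Y‖ₑ ∂(halfSpaceMeasure d a) = 1 := by
  rw [← ofReal_integral_norm_eq_lintegral_enorm (integrable_bulkHeat ha hε X),
    integral_norm_bulkHeat ha hε, ENNReal.ofReal_one]

/-! ### Imaginary times: the Schrödinger kernel -/

lemma I_mul_ofReal_ne_zero {t : ℝ} (ht : t ≠ 0) : Complex.I * (t : ℂ) ≠ 0 :=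
  mul_ne_zero Complex.I_ne_zero (by exact_mod_cast ht)

lemma besselHeat_I_mul {t : ℝ} (ht : t ≠ 0) {z ζ : ℝ} (hz : 0 < z) (hζ : 0 < ζ) :
    besselHeat a (Complex.I * t) z ζ = besselKernel a z ζ t := by
  have hta : 0 < |t| := abs_pos.2 ht
  have htc : (t : ℂ) ≠ 0 := by exact_mod_cast ht
  have hx : 0 < z * ζ / (2 * |t|) := by positivity
  rw [besselHeat, besselKernel, Complex.ofReal_mul ((z * ζ / (2 * |t|)) ^ ((1 - a) / 2)),
    besselJ_eq hx, show (a - 1) / 2 + 1 = (a + 1) / 2 by ring]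
  have e1 : (2 * (Complex.I * (t : ℂ))) ^ (-(((a + 1) / 2 : ℝ) : ℂ))
      = Complex.exp (-(Complex.I * (Real.sign t * ((a + 1) * Real.pi / 4) : ℝ)))
      / (((2 * |t|) ^ ((a + 1) / 2) : ℝ) : ℂ) := by
    have h1 : Complex.I * (Real.sign t : ℂ) ≠ 0 := by
      refine mul_ne_zero Complex.I_ne_zero ?_
      exact_mod_cast (fun h => ht (Real.sign_eq_zero_iff.1 h))
    have h2 : (2 * (Complex.I * (t : ℂ))) = ((2 * |t| : ℝ) : ℂ) * (Complex.I * (Real.sign t : ℂ)) := by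
      have : (t : ℂ) = (|t| : ℝ) * (Real.sign t : ℝ) := by
        rw [← Complex.ofReal_mul]
        rcases lt_or_gt_of_ne ht with h | h
        · rw [abs_of_neg h, Real.sign_of_neg h]; simp
        · rw [abs_of_pos h, Real.sign_of_pos h]; simp
      rw [this]; push_cast; ring
    have h3 : Complex.log (Complex.I * (Real.sign t : ℂ)) = Complex.I * (Real.sign t * (Real.pi / 2) : ℝ) := by
      rcases lt_or_gt_of_ne ht with h | h
      · rw [Real.sign_of_neg h]
        push_cast
        rw [mul_neg, mul_one, Complex.log_neg_I]
        ring
      · rw [Real.sign_of_pos h]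
        push_cast
        rw [mul_one, Complex.log_I]
        ring
    rw [h2, ofReal_mul_cpow (by positivity) h1, ← Complex.ofReal_neg,
      ← Complex.ofReal_cpow (by positivity), Real.rpow_neg (by positivity),
      Complex.cpow_def_of_ne_zero h1, h3, Complex.ofReal_inv, div_eq_mul_inv (Complex.exp _), mul_comm]
    congr 2
    push_cast
    ring
  have e2 : (((z * ζ : ℝ) : ℂ) / (2 * (Complex.I * t))) ^ 2 / 4
      = ((-((z * ζ / (2 * |t|)) ^ 2 / 4) : ℝ) : ℂ) := by
    rw [div_pow (z * ζ), mul_pow 2 |t|, sq_abs, div_pow, mul_pow, mul_pow, Complex.I_sq]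
    push_cast
    field_simp
  have e3 : -(((z ^ 2 + ζ ^ 2 : ℝ) : ℂ) / (4 * (Complex.I * t)))
      = Complex.I * ((z ^ 2 + ζ ^ 2) / (4 * t) : ℝ) := by
    push_cast
    field_simp
    rw [Complex.I_sq]
    ring
  have e4 : ((2 ^ ((1 - a) / 2) : ℝ) : ℂ) = (((z * ζ / (2 * |t|)) ^ ((1 - a) / 2) : ℝ) : ℂ) *
      (((z * ζ / (2 * |t|) / 2) ^ ((a - 1) / 2) : ℝ) : ℂ) := by
    rw [← Complex.ofReal_mul]
    congr 1
    rw [Real.div_rpow hx.le (by norm_num), mul_div_assoc', ← Real.rpow_add hx,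
      show (1 - a) / 2 + (a - 1) / 2 = 0 by ring, Real.rpow_zero, one_div,
      show (a - 1) / 2 = -((1 - a) / 2) by ring, Real.rpow_neg (by norm_num), inv_inv]
  rw [e1, e2, e3, e4]
  ring

lemma bulkHeat_I_mul {t : ℝ} (ht : t ≠ 0) {X Y : BulkPoint d} (hX : 0 < X.2) (hY : 0 < Y.2) :
    bulkHeat a (Complex.I * t) X Y = bulkKernel a X Y t := by
  have htc : (t : ℂ) ≠ 0 := by exact_mod_cast ht
  rw [bulkHeat, bulkKernel, besselHeat_I_mul ht hX hY, freeHeat, freeKernel]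
  congr 3
  · ring
  · push_cast
    field_simp
    rw [Complex.I_sq]
    ring

lemma continuous_bulkHeat (ha : 0 ≤ a) (w : ℂ) :
    Continuous fun p : BulkPoint d × BulkPoint d => bulkHeat a w p.1 p.2 := by
  have := continuous_besselEntire (half_le_order ha)
  unfold bulkHeat besselHeat freeHeat
  fun_prop

lemma measurable_bulkHeat (ha : 0 ≤ a) :
    Measurable fun p : ℂ × (BulkPoint d × BulkPoint d) => bulkHeat a p.1 p.2.1 p.2.2 := by
  have := (continuous_besselEntire (half_le_order ha)).measurable
  unfold bulkHeat besselHeat freeHeat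
  fun_prop

lemma tendsto_bulkHeat (ha : 0 ≤ a) {t : ℝ} (ht : t ≠ 0) (X Y : BulkPoint d) :
    Filter.Tendsto (fun ε : ℝ => bulkHeat a (ε + Complex.I * t) X Y) (nhdsWithin 0 (Ioi 0))
      (nhds (bulkHeat a (Complex.I * t) X Y)) := by
  have h0 := I_mul_ofReal_ne_zero ht
  have h1 : 2 * (Complex.I * (t : ℂ)) ∈ Complex.slitPlane := by
    right; simpa using ht
  have h2 : 4 * (Real.pi : ℂ) * (Complex.I * (t : ℂ)) ∈ Complex.slitPlane := by
    right; simpa using ht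
  have hc : ContinuousAt (fun w : ℂ => bulkHeat a w X Y) (Complex.I * t) := by
    have hb := continuous_besselEntire (half_le_order ha)
    unfold bulkHeat besselHeat freeHeat
    refine ((ContinuousAt.mul ?_ continuousAt_const).mul (ContinuousAt.mul ?_ ?_)).mul
      (ContinuousAt.mul ?_ ?_)
    · exact ContinuousAt.cpow (by fun_prop) continuousAt_const h1
    · refine hb.continuousAt.comp ?_
      exact ((continuousAt_const.div (by fun_prop) (by simpa using h0)).pow 2).div_const 4
    · refine Complex.continuous_exp.continuousAt.comp ?_
      exact (continuousAt_const.div (by fun_prop) (by simpa using h0)).neg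
    · exact ContinuousAt.cpow (by fun_prop) continuousAt_const h2
    · refine Complex.continuous_exp.continuousAt.comp ?_
      exact (continuousAt_const.div (by fun_prop) (by simpa using h0)).neg
  have h3 : Filter.Tendsto (fun ε : ℝ => (ε : ℂ) + Complex.I * t) (nhdsWithin 0 (Ioi 0))
      (nhds (Complex.I * t)) := by
    have : Continuous fun ε : ℝ => (ε : ℂ) + Complex.I * t := by fun_prop
    have h := (this.tendsto 0).mono_left (nhdsWithin_le_nhds (s := Ioi 0))
    simpa using h
  exact hc.tendsto.comp h3

end bulk

/-! ### Square-integrable functions -/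

section square

variable {α : Type*} [MeasurableSpace α] {μ : Measure α}

lemma eLpNorm_two_sq (f : α → ℂ) : eLpNorm f 2 μ ^ 2 = ∫⁻ x, ‖f x‖ₑ ^ 2 ∂μ := by
  have := eLpNorm_nnreal_pow_eq_lintegral (f := f) (μ := μ) (p := 2) two_ne_zero
  simpa using this

lemma lintegral_enorm_mul_le_eLpNorm_two {f g : α → ℂ} (hf : AEStronglyMeasurable f μ)
    (hg : AEStronglyMeasurable g μ) :
    ∫⁻ x, ‖f x‖ₑ * ‖g x‖ₑ ∂μ ≤ eLpNorm f 2 μ * eLpNorm g 2 μ := by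
  have := ENNReal.lintegral_mul_le_Lp_mul_Lq μ (p := 2) (q := 2)
    (by constructor <;> norm_num) hf.enorm hg.enorm
  simpa [eLpNorm_eq_lintegral_rpow_enorm_toReal (p := 2) two_ne_zero ENNReal.ofNat_ne_top] using this

lemma integrable_mul_conj_of_memLp_two {f g : α → ℂ} (hf : MemLp f 2 μ) (hg : MemLp g 2 μ) :
    Integrable (fun x => f x * conj (g x)) μ := by
  refine ⟨hf.1.mul (Complex.continuous_conj.comp_aestronglyMeasurable hg.1), ?_⟩
  have : ∀ x, ‖f x * conj (g x)‖ₑ = ‖f x‖ₑ * ‖g x‖ₑ := fun x => by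
    rw [enorm_mul, RCLike.enorm_conj]
  simp_rw [HasFiniteIntegral, this]
  exact (lintegral_enorm_mul_le_eLpNorm_two hf.1 hg.1).trans_lt (ENNReal.mul_lt_top hf.2 hg.2)

/-- A function is bounded in `L²` when it is so on each set of an exhaustion. -/
lemma eLpNorm_two_le_of_spanningSets [SigmaFinite μ] {f : α → ℂ} {C : ℝ≥0∞}
    (h : ∀ n, ∫⁻ x in spanningSets μ n, ‖f x‖ₑ ^ 2 ∂μ ≤ C ^ 2) : eLpNorm f 2 μ ≤ C := by
  rw [← ENNReal.pow_le_pow_left_iff (two_ne_zero), eLpNorm_two_sq]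
  have h1 := setLIntegral_iUnion_of_directed (μ := μ) (fun x => ‖f x‖ₑ ^ 2)
    (directed_of_isDirected_le (monotone_spanningSets μ))
  rw [iUnion_spanningSets, Measure.restrict_univ] at h1
  rw [h1]
  exact iSup_le h

end square

/-! ### The Fourier-Bessel transform -/

/-- The Fourier-Bessel transform of a function on the half-space. -/
noncomputable def fourierBessel {d : ℕ} (a : ℝ) (f : BulkPoint d → ℂ) (Ξ : BulkPoint d) : ℂ :=
  ∫ X, fourierBesselKernel a Ξ X * f X ∂(halfSpaceMeasure d a)

section transform

variable {d : ℕ} {a : ℝ} {f g : BulkPoint d → ℂ}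

lemma integrable_fourierBesselKernel_mul (ha : 0 ≤ a) (hf : Integrable f (halfSpaceMeasure d a))
    (Ξ : BulkPoint d) :
    Integrable (fun X => fourierBesselKernel a Ξ X * f X) (halfSpaceMeasure d a) := by
  refine hf.bdd_mul (c := hankelBound a) ?_ (ae_of_all _ fun X => norm_fourierBesselKernel_le ha Ξ X)
  have h : Continuous fun X : BulkPoint d => fourierBesselKernel a Ξ X := by
    have h2 : Continuous fun X : BulkPoint d => (Ξ, X) := by fun_prop
    have h3 := (continuous_fourierBesselKernel ha).comp h2
    exact h3
  exact h.aestronglyMeasurable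

lemma norm_fourierBessel_le (ha : 0 ≤ a) (hf : Integrable f (halfSpaceMeasure d a))
    (Ξ : BulkPoint d) :
    ‖fourierBessel a f Ξ‖ ≤ hankelBound a * ∫ X, ‖f X‖ ∂(halfSpaceMeasure d a) := by
  rw [fourierBessel, ← integral_const_mul]
  refine norm_integral_le_of_norm_le (hf.norm.const_mul _) (ae_of_all _ fun X => ?_)
  rw [norm_mul]
  gcongr
  exact norm_fourierBesselKernel_le ha Ξ X

lemma continuous_fourierBessel (ha : 0 ≤ a) (hf : Integrable f (halfSpaceMeasure d a)) :
    Continuous (fourierBessel a f) := by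
  refine continuous_of_dominated (bound := fun X => hankelBound a * ‖f X‖)
    (fun Ξ => (integrable_fourierBesselKernel_mul ha hf Ξ).1) (fun Ξ => ae_of_all _ fun X => ?_)
    (hf.norm.const_mul _) (ae_of_all _ fun X => ?_)
  · rw [norm_mul]
    gcongr
    exact norm_fourierBesselKernel_le ha Ξ X
  · have h2 : Continuous fun Ξ : BulkPoint d => (Ξ, X) := by fun_prop
    have h3 := (continuous_fourierBesselKernel ha).comp h2
    have h4 := h3.mul (continuous_const (y := f X))
    exact h4

/-- The damped product of two transforms is the quadratic form of the heat kernel. -/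
lemma integral_exp_mul_fourierBessel (ha : 0 ≤ a) (hf : Integrable f (halfSpaceMeasure d a))
    (hg : Integrable g (halfSpaceMeasure d a)) {w : ℂ} (hw : 0 < w.re) :
    ∫ Ξ, Complex.exp (-w * (bulkSymbol Ξ : ℂ)) * (fourierBessel a f Ξ * conj (fourierBessel a g Ξ))
        ∂(halfSpaceMeasure d a)
      = ∫ p, bulkHeat a w p.1 p.2 * (f p.1 * conj (g p.2))
          ∂((halfSpaceMeasure d a).prod (halfSpaceMeasure d a)) := by
  set ω := halfSpaceMeasure d a
  let Φ : BulkPoint d → BulkPoint d × BulkPoint d → ℂ := fun Ξ p =>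
    (Complex.exp (-w * (bulkSymbol Ξ : ℂ)) *
      (fourierBesselKernel a Ξ p.1 * conj (fourierBesselKernel a Ξ p.2))) * (f p.1 * conj (g p.2))
  have hgc : Integrable (fun X => conj (g X)) ω :=
    ⟨Complex.continuous_conj.comp_aestronglyMeasurable hg.1, by
      simpa only [HasFiniteIntegral, RCLike.enorm_conj] using hg.2⟩
  have hfg : Integrable (fun p : BulkPoint d × BulkPoint d => f p.1 * conj (g p.2)) (ω.prod ω) :=
    hf.mul_prod hgc
  have hcont : Continuous fun q : BulkPoint d × (BulkPoint d × BulkPoint d) =>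
      fourierBesselKernel a q.1 q.2.1 * conj (fourierBesselKernel a q.1 q.2.2) := by
    have h1 : Continuous fun q : BulkPoint d × (BulkPoint d × BulkPoint d) => (q.1, q.2.1) := by
      fun_prop
    have h2 : Continuous fun q : BulkPoint d × (BulkPoint d × BulkPoint d) => (q.1, q.2.2) := by
      fun_prop
    have h3 := ((continuous_fourierBesselKernel ha).comp h1).mul
      (Complex.continuous_conj.comp ((continuous_fourierBesselKernel ha).comp h2))
    exact h3
  have hbase : Integrable (fun q : BulkPoint d × (BulkPoint d × BulkPoint d) =>
      Complex.exp (-w * (bulkSymbol q.1 : ℂ)) * (f q.2.1 * conj (g q.2.2))) (ω.prod (ω.prod ω)) := by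
    have h : Integrable (fun Ξ : BulkPoint d => Complex.exp (-w * (bulkSymbol Ξ : ℂ))) ω := by
      have hc := continuous_bulkSymbol (d := d)
      rw [← integrable_norm_iff (by fun_prop)]
      simp_rw [norm_exp_neg_mul_bulkSymbol]
      exact integrable_exp_neg_mul_bulkSymbol ha hw
    exact h.mul_prod hfg
  have hint : Integrable (Function.uncurry Φ) (ω.prod (ω.prod ω)) := by
    have h := hbase.bdd_mul (c := hankelBound a * hankelBound a) hcont.aestronglyMeasurable
      (ae_of_all _ fun q => ?_)
    · refine h.congr (ae_of_all _ fun q => ?_)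
      simp only [Φ, Function.uncurry]
      ring
    · rw [norm_mul, RCLike.norm_conj]
      have := hankelBound_pos ha
      gcongr <;> exact norm_fourierBesselKernel_le ha _ _
  have h1 (Ξ : BulkPoint d) : Complex.exp (-w * (bulkSymbol Ξ : ℂ)) *
      (fourierBessel a f Ξ * conj (fourierBessel a g Ξ)) = ∫ p, Φ Ξ p ∂(ω.prod ω) := by
    simp only [Φ, fourierBessel]
    rw [← integral_conj, ← integral_prod_mul, ← integral_const_mul]
    refine integral_congr_ae (ae_of_all _ fun p => ?_)
    simp only [map_mul]
    ring
  simp_rw [h1]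
  rw [integral_integral_swap hint]
  refine integral_congr_ae (ae_of_all _ fun p => ?_)
  simp only [Φ]
  rw [integral_mul_const, integral_fourierBesselKernel_mul ha hw]

lemma lintegral_bulkHeat_quadratic_le (ha : 0 ≤ a) {ε : ℝ} (hε : 0 < ε)
    (hf : Integrable f (halfSpaceMeasure d a)) :
    ∫⁻ p, ‖bulkHeat a ε p.1 p.2 * (f p.1 * conj (f p.2))‖ₑ
          ∂((halfSpaceMeasure d a).prod (halfSpaceMeasure d a))
      ≤ ∫⁻ X, ‖f X‖ₑ ^ 2 ∂(halfSpaceMeasure d a) := by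
  set ω := halfSpaceMeasure d a
  have hK := (continuous_bulkHeat (d := d) ha (ε : ℂ)).measurable.enorm
  have hf2 : AEMeasurable (fun X => ‖f X‖ₑ ^ 2) ω := hf.1.enorm.pow_const 2
  have hm1 : AEMeasurable (fun p : BulkPoint d × BulkPoint d =>
      ‖bulkHeat a ε p.1 p.2‖ₑ * ‖f p.1‖ₑ ^ 2) (ω.prod ω) :=
    hK.aemeasurable.mul (hf2.comp_quasiMeasurePreserving Measure.quasiMeasurePreserving_fst)
  have hm2 : AEMeasurable (fun p : BulkPoint d × BulkPoint d =>
      ‖bulkHeat a ε p.1 p.2‖ₑ * ‖f p.2‖ₑ ^ 2) (ω.prod ω) :=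
    hK.aemeasurable.mul (hf2.comp_quasiMeasurePreserving Measure.quasiMeasurePreserving_snd)
  have e1 : ∫⁻ p, ‖bulkHeat a ε p.1 p.2‖ₑ * ‖f p.1‖ₑ ^ 2 ∂(ω.prod ω) = ∫⁻ X, ‖f X‖ₑ ^ 2 ∂ω := by
    rw [lintegral_prod _ hm1]
    refine lintegral_congr fun X => ?_
    have h := (lintegral_mul_const'' (‖f X‖ₑ ^ 2) (integrable_bulkHeat ha hε X).1.enorm)
    rwa [lintegral_enorm_bulkHeat ha hε, one_mul] at h
  have e2 : ∫⁻ p, ‖bulkHeat a ε p.1 p.2‖ₑ * ‖f p.2‖ₑ ^ 2 ∂(ω.prod ω) = ∫⁻ X, ‖f X‖ₑ ^ 2 ∂ω := by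
    rw [lintegral_prod_symm _ hm2]
    refine lintegral_congr fun X => ?_
    simp_rw [bulkHeat_comm (a := a) (ε : ℂ) _ X]
    have h := (lintegral_mul_const'' (‖f X‖ₑ ^ 2) (integrable_bulkHeat ha hε X).1.enorm)
    rwa [lintegral_enorm_bulkHeat ha hε, one_mul] at h
  have key : ∀ p : BulkPoint d × BulkPoint d, 2 * ‖bulkHeat a ε p.1 p.2 * (f p.1 * conj (f p.2))‖ₑ
      ≤ ‖bulkHeat a ε p.1 p.2‖ₑ * ‖f p.1‖ₑ ^ 2 + ‖bulkHeat a ε p.1 p.2‖ₑ * ‖f p.2‖ₑ ^ 2 := by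
    intro p
    rw [enorm_mul, enorm_mul, RCLike.enorm_conj, ← mul_add]
    have h : 2 * (‖f p.1‖ₑ * ‖f p.2‖ₑ) ≤ ‖f p.1‖ₑ ^ 2 + ‖f p.2‖ₑ ^ 2 := by
      have := two_mul_le_add_sq ‖f p.1‖₊ ‖f p.2‖₊
      simp only [enorm_eq_nnnorm]
      rw [← mul_assoc]
      exact_mod_cast this
    calc _ = ‖bulkHeat a ε p.1 p.2‖ₑ * (2 * (‖f p.1‖ₑ * ‖f p.2‖ₑ)) := by ring
      _ ≤ _ := by gcongr
  have h2 := lintegral_mono (μ := ω.prod ω) key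
  rw [lintegral_add_left' hm1, e1, e2, ← two_mul, lintegral_const_mul' _ _ (by norm_num)] at h2
  exact (ENNReal.mul_le_mul_iff_right (by norm_num) (by norm_num)).1 h2

lemma lintegral_exp_mul_fourierBessel (ha : 0 ≤ a) (hf : Integrable f (halfSpaceMeasure d a))
    {ε : ℝ} (hε : 0 < ε) :
    ∫⁻ Ξ, ENNReal.ofReal (Real.exp (-ε * bulkSymbol Ξ)) * ‖fourierBessel a f Ξ‖ₑ ^ 2
        ∂(halfSpaceMeasure d a)
      = ‖∫ p, bulkHeat a ε p.1 p.2 * (f p.1 * conj (f p.2))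
          ∂((halfSpaceMeasure d a).prod (halfSpaceMeasure d a))‖ₑ := by
  have hw : 0 < (ε : ℂ).re := by simpa using hε
  rw [← integral_exp_mul_fourierBessel ha hf hf hw]
  have e (Ξ : BulkPoint d) : Complex.exp (-(ε : ℂ) * (bulkSymbol Ξ : ℂ)) *
      (fourierBessel a f Ξ * conj (fourierBessel a f Ξ))
      = ((Real.exp (-ε * bulkSymbol Ξ) * ‖fourierBessel a f Ξ‖ ^ 2 : ℝ) : ℂ) := by
    rw [Complex.mul_conj, Complex.normSq_eq_norm_sq]
    push_cast
    rfl
  simp_rw [e]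
  have hcont := continuous_fourierBessel ha hf
  have hint : Integrable (fun Ξ => Real.exp (-ε * bulkSymbol Ξ) * ‖fourierBessel a f Ξ‖ ^ 2)
      (halfSpaceMeasure d a) := by
    have h := (integrable_exp_neg_mul_bulkSymbol (d := d) ha hε).bdd_mul
      (c := (hankelBound a * ∫ X, ‖f X‖ ∂(halfSpaceMeasure d a)) ^ 2)
      (hcont.norm.pow 2).aestronglyMeasurable (ae_of_all _ fun Ξ => ?_)
    · exact h.congr (ae_of_all _ fun Ξ => mul_comm _ _)
    · simp only [Pi.pow_apply]
      rw [norm_pow, norm_norm]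
      gcongr
      exact norm_fourierBessel_le ha hf Ξ
  have hnn : ∀ Ξ, 0 ≤ Real.exp (-ε * bulkSymbol Ξ) * ‖fourierBessel a f Ξ‖ ^ 2 := fun Ξ => by
    positivity
  rw [integral_complex_ofReal, ← ofReal_norm, Complex.norm_real,
    Real.norm_of_nonneg (integral_nonneg hnn),
    ofReal_integral_eq_lintegral_ofReal hint (ae_of_all _ hnn)]
  refine lintegral_congr fun Ξ => ?_
  rw [ENNReal.ofReal_mul (Real.exp_pos _).le, ENNReal.ofReal_pow (norm_nonneg _),
    ofReal_norm]

/-- The Fourier-Bessel transform does not increase the `L²` norm. -/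
lemma eLpNorm_fourierBessel_le (ha : 0 ≤ a) (hf : Integrable f (halfSpaceMeasure d a)) :
    eLpNorm (fourierBessel a f) 2 (halfSpaceMeasure d a) ≤ eLpNorm f 2 (halfSpaceMeasure d a) := by
  rw [← ENNReal.pow_le_pow_left_iff two_ne_zero, eLpNorm_two_sq, eLpNorm_two_sq]
  have hcs := continuous_bulkSymbol (d := d)
  have hcf := continuous_fourierBessel ha hf
  let u : ℕ → BulkPoint d → ℝ≥0∞ := fun n Ξ =>
    ENNReal.ofReal (Real.exp (-(1 / ((n : ℝ) + 1)) * bulkSymbol Ξ)) * ‖fourierBessel a f Ξ‖ₑ ^ 2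
  have hlim (Ξ : BulkPoint d) : Filter.Tendsto (fun n => u n Ξ) Filter.atTop
      (nhds (‖fourierBessel a f Ξ‖ₑ ^ 2)) := by
    have h1 : Filter.Tendsto (fun n : ℕ => Real.exp (-(1 / ((n : ℝ) + 1)) * bulkSymbol Ξ))
        Filter.atTop (nhds (Real.exp (-0 * bulkSymbol Ξ))) :=
      (Real.continuous_exp.tendsto _).comp
        ((tendsto_one_div_add_atTop_nhds_zero_nat.neg).mul_const _)
    have h2 := ENNReal.Tendsto.mul_const (b := ‖fourierBessel a f Ξ‖ₑ ^ 2)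
      (ENNReal.tendsto_ofReal h1) (Or.inr (by simp))
    simpa [u] using h2
  have hmeas (n : ℕ) : Measurable (u n) := by
    have : Measurable fun Ξ => ‖fourierBessel a f Ξ‖ₑ := hcf.measurable.enorm
    simp only [u]
    fun_prop
  calc ∫⁻ Ξ, ‖fourierBessel a f Ξ‖ₑ ^ 2 ∂(halfSpaceMeasure d a)
      = ∫⁻ Ξ, Filter.liminf (fun n => u n Ξ) Filter.atTop ∂(halfSpaceMeasure d a) :=
        lintegral_congr fun Ξ => (hlim Ξ).liminf_eq.symm
    _ ≤ Filter.liminf (fun n => ∫⁻ Ξ, u n Ξ ∂(halfSpaceMeasure d a)) Filter.atTop :=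
        lintegral_liminf_le hmeas
    _ ≤ Filter.liminf (fun _ : ℕ => ∫⁻ X, ‖f X‖ₑ ^ 2 ∂(halfSpaceMeasure d a)) Filter.atTop := by
        refine Filter.liminf_le_liminf (Filter.Eventually.of_forall fun n => ?_)
        have hε : (0 : ℝ) < 1 / ((n : ℝ) + 1) := by positivity
        simp only [u]
        rw [lintegral_exp_mul_fourierBessel ha hf hε]
        exact (enorm_integral_le_lintegral_enorm _).trans (lintegral_bulkHeat_quadratic_le ha hε hf)
    _ = _ := by simp

lemma memLp_fourierBessel (ha : 0 ≤ a) (hf : Integrable f (halfSpaceMeasure d a))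
    (hf2 : MemLp f 2 (halfSpaceMeasure d a)) :
    MemLp (fourierBessel a f) 2 (halfSpaceMeasure d a) :=
  ⟨(continuous_fourierBessel ha hf).aestronglyMeasurable,
    (eLpNorm_fourierBessel_le ha hf).trans_lt hf2.2⟩

end transform

/-! ### The heat kernel as an approximate identity -/

section approx

variable {d : ℕ} {a : ℝ} {f g : BulkPoint d → ℂ}

lemma ofReal_norm_bulkHeat (ha : 0 ≤ a) {ε : ℝ} (hε : 0 < ε) (X Y : BulkPoint d) :
    ((‖bulkHeat a ε X Y‖ : ℝ) : ℂ) = bulkHeat a ε X Y := by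
  obtain ⟨r, hr, e⟩ := bulkHeat_ofReal_nonneg ha hε X Y
  rw [e, Complex.norm_real, Real.norm_of_nonneg hr]

lemma integral_norm_bulkHeat_mul_gaussian (ha : 0 ≤ a) {ε s σ : ℝ} (hε : 0 < ε) (hs : 0 ≤ s)
    (hσ : 0 ≤ σ) (X : BulkPoint d) :
    ∫ Y, ‖bulkHeat a ε X Y‖ * (Real.exp (-s * Y.2 ^ 2) * Real.exp (-σ * ‖X.1 - Y.1‖ ^ 2))
        ∂(halfSpaceMeasure d a)
      = (1 + 4 * ε * s) ^ (-((a + 1) / 2)) * Real.exp (-(s * X.2 ^ 2 / (1 + 4 * ε * s))) *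
          (1 + 4 * ε * σ) ^ (-(d : ℝ) / 2) := by
  have h := integral_bulkHeat_mul_gaussian ha hε hs hσ X
  rw [← Complex.ofReal_inj, ← h, ← integral_complex_ofReal]
  refine integral_congr_ae (ae_of_all _ fun Y => ?_)
  simp only
  push_cast
  rw [ofReal_norm_bulkHeat ha hε X Y]

lemma integrable_norm_bulkHeat_mul_gaussian (ha : 0 ≤ a) {ε s σ : ℝ} (hε : 0 < ε) (hs : 0 ≤ s)
    (hσ : 0 ≤ σ) (X : BulkPoint d) :
    Integrable (fun Y => ‖bulkHeat a ε X Y‖ *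
      (Real.exp (-s * Y.2 ^ 2) * Real.exp (-σ * ‖X.1 - Y.1‖ ^ 2))) (halfSpaceMeasure d a) := by
  refine not_imp_comm.1 integral_undef ?_
  rw [integral_norm_bulkHeat_mul_gaussian ha hε hs hσ]
  positivity

/-- A nonnegative function of `Y` that, on the half-space, vanishes only at `X`, and whose averages
with respect to the heat kernel are explicit. -/
noncomputable def gaussianGap {d : ℕ} (X Y : BulkPoint d) : ℝ :=
  (1 - Real.exp (-1 * ‖X.1 - Y.1‖ ^ 2)) + (Real.exp (-1 * Y.2 ^ 2) - Real.exp (-1 * X.2 ^ 2)) ^ 2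

lemma one_sub_exp_nonneg (r : ℝ) : 0 ≤ 1 - Real.exp (-1 * r ^ 2) := by
  rw [sub_nonneg, Real.exp_le_one_iff]
  nlinarith [sq_nonneg r]

lemma gaussianGap_nonneg (X Y : BulkPoint d) : 0 ≤ gaussianGap X Y :=
  add_nonneg (one_sub_exp_nonneg _) (sq_nonneg _)

lemma exists_gaussianGap_lt {X : BulkPoint d} (hX : 0 < X.2) {U : Set (BulkPoint d)}
    (hU : U ∈ nhds X) :
    ∃ η > 0, ∀ Y : BulkPoint d, 0 < Y.2 → gaussianGap X Y < η → Y ∈ U := by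
  obtain ⟨δ, hδ, hball⟩ := Metric.mem_nhds_iff.1 hU
  -- `Y.2` is recovered from its Gaussian by a function that is continuous at the point in question
  have hG : ContinuousAt (fun s : ℝ => √(-Real.log s)) (Real.exp (-1 * X.2 ^ 2)) :=
    (Real.continuousAt_log (Real.exp_pos _).ne').neg.sqrt
  have hval (z : ℝ) (hz : 0 < z) : √(-Real.log (Real.exp (-1 * z ^ 2))) = z := by
    rw [Real.log_exp, neg_mul, neg_neg, one_mul, Real.sqrt_sq hz.le]
  obtain ⟨η, hη, h⟩ := Metric.continuousAt_iff.1 hG δ hδ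
  have hδ1 : 0 < 1 - Real.exp (-1 * δ ^ 2) := by
    rw [sub_pos, Real.exp_lt_one_iff]
    nlinarith [sq_pos_of_pos hδ]
  refine ⟨min (1 - Real.exp (-1 * δ ^ 2)) (η ^ 2), lt_min hδ1 (by positivity), fun Y hY hgap => ?_⟩
  have h1 : 1 - Real.exp (-1 * ‖X.1 - Y.1‖ ^ 2) < 1 - Real.exp (-1 * δ ^ 2) :=
    (le_add_of_nonneg_right (sq_nonneg _)).trans_lt (hgap.trans_le (min_le_left _ _))
  have h2 : (Real.exp (-1 * Y.2 ^ 2) - Real.exp (-1 * X.2 ^ 2)) ^ 2 < η ^ 2 :=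
    (le_add_of_nonneg_left (one_sub_exp_nonneg _)).trans_lt (hgap.trans_le (min_le_right _ _))
  have h3 := h (x := Real.exp (-1 * Y.2 ^ 2)) (by
    rw [Real.dist_eq]; exact abs_lt_of_sq_lt_sq h2 hη.le)
  rw [hval _ hY, hval _ hX] at h3
  have h4 : ‖X.1 - Y.1‖ < δ := by
    have := Real.exp_lt_exp.1 ((sub_lt_sub_iff_left _).1 h1)
    exact lt_of_pow_lt_pow_left₀ 2 hδ.le (by linarith)
  refine hball ?_
  rw [Metric.mem_ball, Prod.dist_eq]
  refine max_lt ?_ h3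
  rwa [dist_comm, dist_eq_norm]

lemma tendsto_integral_gaussianGap (ha : 0 ≤ a) (X : BulkPoint d) :
    Filter.Tendsto (fun ε : ℝ => ∫ Y, ‖bulkHeat a ε X Y‖ * gaussianGap X Y ∂(halfSpaceMeasure d a))
      (nhdsWithin 0 (Ioi 0)) (nhds 0) := by
  let r : ℝ → ℝ → ℝ → ℝ := fun s σ ε =>
    (1 + 4 * ε * s) ^ (-((a + 1) / 2)) * Real.exp (-(s * X.2 ^ 2 / (1 + 4 * ε * s))) *
          (1 + 4 * ε * σ) ^ (-(d : ℝ) / 2)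
  have hr (s σ : ℝ) : Filter.Tendsto (r s σ) (nhdsWithin 0 (Ioi 0))
      (nhds (Real.exp (-(s * X.2 ^ 2)))) := by
    have hc : ContinuousAt (r s σ) 0 := by
      refine ContinuousAt.mul (ContinuousAt.mul ?_ ?_) ?_
      · exact ContinuousAt.rpow_const (by fun_prop) (Or.inl (by norm_num))
      · refine Real.continuous_exp.continuousAt.comp ?_
        exact (continuousAt_const.div (by fun_prop) (by norm_num)).neg
      · exact ContinuousAt.rpow_const (by fun_prop) (Or.inl (by norm_num))
    have h := hc.tendsto.mono_left (nhdsWithin_le_nhds (s := Ioi 0))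
    simpa [r] using h
  have hlim : Filter.Tendsto (fun ε => (r 0 0 ε - r 0 1 ε) + (r 2 0 ε
      - 2 * Real.exp (-1 * X.2 ^ 2) * r 1 0 ε + Real.exp (-1 * X.2 ^ 2) ^ 2 * r 0 0 ε))
      (nhdsWithin 0 (Ioi 0)) (nhds 0) := by
    have h := ((hr 0 0).sub (hr 0 1)).add
      (((hr 2 0).sub ((hr 1 0).const_mul (2 * Real.exp (-1 * X.2 ^ 2)))).add
        ((hr 0 0).const_mul (Real.exp (-1 * X.2 ^ 2) ^ 2)))
    convert h using 2
    have e2 : Real.exp (-(2 * X.2 ^ 2)) = Real.exp (-X.2 ^ 2) ^ 2 := by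
      rw [← Real.exp_nat_mul]; push_cast; ring_nf
    rw [e2]
    simp
    ring
  refine hlim.congr' ?_
  filter_upwards [self_mem_nhdsWithin] with ε hε
  have hε' : 0 < ε := hε
  have hi (s σ : ℝ) (hs : 0 ≤ s) (hσ : 0 ≤ σ) :=
    integrable_norm_bulkHeat_mul_gaussian ha hε' hs hσ X
  have hv (s σ : ℝ) (hs : 0 ≤ s) (hσ : 0 ≤ σ) : ∫ Y, ‖bulkHeat a ε X Y‖ *
      (Real.exp (-s * Y.2 ^ 2) * Real.exp (-σ * ‖X.1 - Y.1‖ ^ 2)) ∂(halfSpaceMeasure d a)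
      = r s σ ε := integral_norm_bulkHeat_mul_gaussian ha hε' hs hσ X
  have h00 := hi 0 0 le_rfl le_rfl
  have h01 := hi 0 1 le_rfl zero_le_one
  have h20 := hi 2 0 zero_le_two le_rfl
  have h10 := (hi 1 0 zero_le_one le_rfl).const_mul (2 * Real.exp (-1 * X.2 ^ 2))
  have h00' := h00.const_mul (Real.exp (-1 * X.2 ^ 2) ^ 2)
  have e2 (Y : BulkPoint d) : Real.exp (-2 * Y.2 ^ 2) = Real.exp (-1 * Y.2 ^ 2) ^ 2 := by
    rw [← Real.exp_nat_mul]; push_cast; ring_nf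
  rw [← hv 0 0 le_rfl le_rfl, ← hv 0 1 le_rfl zero_le_one, ← hv 2 0 zero_le_two le_rfl,
    ← hv 1 0 zero_le_one le_rfl, ← integral_const_mul, ← integral_const_mul, ← integral_sub h00 h01,
    ← integral_sub h20 h10]
  have s1 := integral_add (h20.sub h10) h00'
  have s2 := integral_add (h00.sub h01) ((h20.sub h10).add h00')
  simp only [Pi.add_apply, Pi.sub_apply] at s1 s2
  rw [← s1, ← s2]
  refine integral_congr_ae (ae_of_all _ fun Y => ?_)
  simp only [gaussianGap, e2, neg_zero, zero_mul, Real.exp_zero]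
  ring

/-- The heat kernel is an approximate identity at the points of continuity of a bounded function. -/
lemma tendsto_integral_bulkHeat_mul (ha : 0 ≤ a) {M : ℝ}
    (hf : AEStronglyMeasurable f (halfSpaceMeasure d a)) (hM : ∀ X, 0 < X.2 → ‖f X‖ ≤ M)
    {X : BulkPoint d} (hX : 0 < X.2) (hc : ContinuousAt f X) :
    Filter.Tendsto (fun ε : ℝ => ∫ Y, bulkHeat a ε X Y * f Y ∂(halfSpaceMeasure d a))
      (nhdsWithin 0 (Ioi 0)) (nhds (f X)) := by
  have hM0 : 0 ≤ M := (norm_nonneg _).trans (hM X hX)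
  rw [Metric.tendsto_nhds]
  intro δ hδ
  obtain ⟨η, hη, hU⟩ := exists_gaussianGap_lt hX (Metric.continuousAt_iff'.1 hc (δ / 2) (by positivity))
  have hsmall : ∀ᶠ ε : ℝ in nhdsWithin 0 (Ioi 0),
      (2 * M / η) * ∫ Y, ‖bulkHeat a ε X Y‖ * gaussianGap X Y ∂(halfSpaceMeasure d a) < δ / 2 := by
    have h := (tendsto_integral_gaussianGap ha X).const_mul (2 * M / η)
    rw [mul_zero] at h
    exact h.eventually_lt_const (by positivity)
  filter_upwards [hsmall, self_mem_nhdsWithin] with ε h1 hε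
  have hε' : 0 < ε := hε
  have hgapint : Integrable (fun Y => ‖bulkHeat a ε X Y‖ * gaussianGap X Y)
      (halfSpaceMeasure d a) := by
    have h := (integrable_bulkHeat ha hε' X).norm.bdd_mul (c := 2) (f := fun Y => gaussianGap X Y)
      (by unfold gaussianGap; fun_prop) (ae_of_all _ fun Y => ?_)
    · exact h.congr (ae_of_all _ fun Y => mul_comm _ _)
    · rw [Real.norm_of_nonneg (gaussianGap_nonneg X Y), gaussianGap]
      have e1 := Real.exp_pos (-1 * ‖X.1 - Y.1‖ ^ 2)
      have e2 := Real.exp_pos (-1 * Y.2 ^ 2)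
      have e3 := Real.exp_pos (-1 * X.2 ^ 2)
      have e4 := one_sub_exp_nonneg Y.2
      have e5 := one_sub_exp_nonneg X.2
      nlinarith
  have hKf : Integrable (fun Y => bulkHeat a ε X Y * f Y) (halfSpaceMeasure d a) := by
    have h := (integrable_bulkHeat ha hε' X).bdd_mul (c := M) hf (by
      filter_upwards [ae_halfSpace_pos d a] with Y hY using hM Y hY)
    exact h.congr (ae_of_all _ fun Y => mul_comm _ _)
  have hKc := (integrable_bulkHeat ha hε' X).mul_const (f X)
  have e : ∫ Y, bulkHeat a ε X Y * f Y ∂(halfSpaceMeasure d a) - f X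
      = ∫ Y, bulkHeat a ε X Y * (f Y - f X) ∂(halfSpaceMeasure d a) := by
    simp_rw [mul_sub]
    rw [integral_sub hKf hKc, integral_mul_const, integral_bulkHeat ha hε', one_mul]
  rw [dist_eq_norm, e]
  have hbound : ∀ᵐ Y ∂(halfSpaceMeasure d a), ‖bulkHeat a ε X Y * (f Y - f X)‖
      ≤ δ / 2 * ‖bulkHeat a ε X Y‖ + (2 * M / η) * (‖bulkHeat a ε X Y‖ * gaussianGap X Y) := by
    filter_upwards [ae_halfSpace_pos d a] with Y hY
    rw [norm_mul]
    have key : ‖f Y - f X‖ ≤ δ / 2 + (2 * M / η) * gaussianGap X Y := by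
      have hg := gaussianGap_nonneg X Y
      by_cases hlt : gaussianGap X Y < η
      · have := hU Y hY hlt
        have h2 : dist (f Y) (f X) < δ / 2 := this
        rw [dist_eq_norm] at h2
        have : 0 ≤ (2 * M / η) * gaussianGap X Y := by positivity
        linarith
      · have h2 : ‖f Y - f X‖ ≤ 2 * M := by
          refine (norm_sub_le _ _).trans ?_
          have := hM Y hY
          have := hM X hX
          linarith
        have h3 : 2 * M ≤ (2 * M / η) * gaussianGap X Y := by
          rw [div_mul_eq_mul_div, le_div_iff₀ hη]
          gcongr
          exact not_lt.1 hlt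
        linarith
    calc _ ≤ ‖bulkHeat a ε X Y‖ * (δ / 2 + (2 * M / η) * gaussianGap X Y) := by gcongr
      _ = _ := by ring
  have hKn := (integrable_bulkHeat ha hε' X).norm
  calc _ ≤ ∫ Y, (δ / 2 * ‖bulkHeat a ε X Y‖
        + (2 * M / η) * (‖bulkHeat a ε X Y‖ * gaussianGap X Y)) ∂(halfSpaceMeasure d a) :=
        norm_integral_le_of_norm_le ((hKn.const_mul _).add (hgapint.const_mul _)) hbound
    _ = δ / 2 + (2 * M / η) * ∫ Y, ‖bulkHeat a ε X Y‖ * gaussianGap X Y ∂(halfSpaceMeasure d a) := by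
        rw [integral_add (hKn.const_mul _) (hgapint.const_mul _), integral_const_mul,
          integral_const_mul, integral_norm_bulkHeat ha hε', mul_one]
    _ < δ := by linarith

/-- Plancherel's theorem for bounded, continuous, integrable functions. -/
lemma eLpNorm_fourierBessel_eq (ha : 0 ≤ a) {M : ℝ} (hf : Integrable f (halfSpaceMeasure d a))
    (hM : ∀ X, 0 < X.2 → ‖f X‖ ≤ M) (hc : ∀ X : BulkPoint d, 0 < X.2 → ContinuousAt f X) :
    eLpNorm (fourierBessel a f) 2 (halfSpaceMeasure d a) = eLpNorm f 2 (halfSpaceMeasure d a) := by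
  refine le_antisymm (eLpNorm_fourierBessel_le ha hf) ?_
  rw [← ENNReal.pow_le_pow_left_iff two_ne_zero, eLpNorm_two_sq, eLpNorm_two_sq]
  set ω := halfSpaceMeasure d a
  have hfc : AEStronglyMeasurable (fun X => conj (f X)) ω :=
    Complex.continuous_conj.comp_aestronglyMeasurable hf.1
  have hcM : ∀ X : BulkPoint d, 0 < X.2 → ‖conj (f X)‖ ≤ M := fun X hX => by
    rw [RCLike.norm_conj]; exact hM X hX
  have hM' : ∀ᵐ X ∂ω, ‖conj (f X)‖ ≤ M := by
    filter_upwards [ae_halfSpace_pos d a] with X hX using hcM X hX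
  let u : ℕ → ℝ := fun n => 1 / ((n : ℝ) + 1)
  have hu0 : ∀ n, 0 < u n := fun n => by positivity
  have hu : Filter.Tendsto u Filter.atTop (nhdsWithin 0 (Ioi 0)) :=
    tendsto_nhdsWithin_iff.2 ⟨tendsto_one_div_add_atTop_nhds_zero_nat,
      Filter.Eventually.of_forall hu0⟩
  let A : ℕ → BulkPoint d → ℂ := fun n X => f X * ∫ Y, bulkHeat a (u n : ℂ) X Y * conj (f Y) ∂ω
  have hKf (n : ℕ) (X : BulkPoint d) : Integrable (fun Y => bulkHeat a (u n : ℂ) X Y * conj (f Y)) ω := by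
    have h := (integrable_bulkHeat ha (hu0 n) X).bdd_mul (c := M) hfc hM'
    exact h.congr (ae_of_all _ fun Y => mul_comm _ _)
  have hlim : Filter.Tendsto (fun n => ∫ X, A n X ∂ω) Filter.atTop
      (nhds (∫ X, f X * conj (f X) ∂ω)) := by
    refine tendsto_integral_of_dominated_convergence (fun X => ‖f X‖ * M) (fun n => ?_)
      (hf.norm.mul_const M) (fun n => ?_) ?_
    · have hK : StronglyMeasurable fun p : BulkPoint d × BulkPoint d => bulkHeat a (u n : ℂ) p.1 p.2 :=
        (continuous_bulkHeat (d := d) ha (u n : ℂ)).stronglyMeasurable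
      have hf2 : AEStronglyMeasurable (fun p : BulkPoint d × BulkPoint d => conj (f p.2)) (ω.prod ω) :=
        hfc.comp_snd
      exact hf.1.mul (hK.aestronglyMeasurable.mul hf2).integral_prod_right'
    · refine ae_of_all _ fun X => ?_
      rw [norm_mul]
      gcongr
      calc _ ≤ ∫ Y, ‖bulkHeat a (u n : ℂ) X Y‖ * M ∂ω := by
            refine norm_integral_le_of_norm_le ((integrable_bulkHeat ha (hu0 n) X).norm.mul_const M) ?_
            filter_upwards [hM'] with Y hY
            rw [norm_mul]
            gcongr
        _ = M := by rw [integral_mul_const, integral_norm_bulkHeat ha (hu0 n), one_mul]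
    · filter_upwards [ae_halfSpace_pos d a] with X hX
      refine Filter.Tendsto.const_mul _ ?_
      exact (tendsto_integral_bulkHeat_mul ha hfc hcM hX
        (Complex.continuous_conj.continuousAt.comp (hc X hX))).comp hu
  have hA (n : ℕ) : ∫ p, bulkHeat a (u n : ℂ) p.1 p.2 * (f p.1 * conj (f p.2)) ∂(ω.prod ω)
      = ∫ X, A n X ∂ω := by
    rw [integral_prod]
    · refine integral_congr_ae (ae_of_all _ fun X => ?_)
      simp only [A]
      rw [← integral_const_mul]
      refine integral_congr_ae (ae_of_all _ fun Y => ?_)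
      simp only
      ring
    · have hK : StronglyMeasurable fun p : BulkPoint d × BulkPoint d => bulkHeat a (u n : ℂ) p.1 p.2 :=
        (continuous_bulkHeat (d := d) ha (u n : ℂ)).stronglyMeasurable
      have hfc' : Integrable (fun X => conj (f X)) ω :=
        ⟨hfc, by simpa only [HasFiniteIntegral, RCLike.enorm_conj] using hf.2⟩
      have hw : (u n : ℂ) ≠ 0 := by exact_mod_cast (hu0 n).ne'
      exact (hf.mul_prod hfc').bdd_mul (hK.aestronglyMeasurable)
        (ae_of_all _ fun p => norm_bulkHeat_le ha (by simpa using (hu0 n).le) hw p.1 p.2)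
  have hlim2 : Filter.Tendsto (fun n => ‖∫ X, A n X ∂ω‖ₑ) Filter.atTop
      (nhds ‖∫ X, f X * conj (f X) ∂ω‖ₑ) := (continuous_enorm.tendsto _).comp hlim
  have hval : ‖∫ X, f X * conj (f X) ∂ω‖ₑ = ∫⁻ X, ‖f X‖ₑ ^ 2 ∂ω := by
    have e : ∀ X, f X * conj (f X) = ((‖f X‖ ^ 2 : ℝ) : ℂ) := fun X => by
      rw [Complex.mul_conj, Complex.normSq_eq_norm_sq]
    have hint : Integrable (fun X => ‖f X‖ ^ 2) ω := by
      have h := hf.norm.bdd_mul (c := M) (f := fun X => ‖f X‖) hf.1.norm (by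
        filter_upwards [hM'] with X hX
        rwa [norm_norm, ← RCLike.norm_conj (f X)])
      exact h.congr (ae_of_all _ fun X => (sq _).symm)
    simp_rw [e]
    rw [integral_complex_ofReal, ← ofReal_norm, Complex.norm_real,
      Real.norm_of_nonneg (integral_nonneg fun _ => by positivity),
      ofReal_integral_eq_lintegral_ofReal hint (ae_of_all _ fun _ => by positivity)]
    refine lintegral_congr fun X => ?_
    rw [ENNReal.ofReal_pow (norm_nonneg _), ofReal_norm]
  rw [← hval]
  refine le_of_tendsto hlim2 (Filter.Eventually.of_forall fun n => ?_)
  rw [← hA n, ← lintegral_exp_mul_fourierBessel ha hf (hu0 n)]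
  refine lintegral_mono fun Ξ => ?_
  refine mul_le_of_le_one_left bot_le ?_
  rw [ENNReal.ofReal_le_one, Real.exp_le_one_iff]
  have := mul_nonneg (hu0 n).le (bulkSymbol_nonneg Ξ)
  linarith

end approx

/-! ### The Schrödinger group on integrable data -/

/-- The Schrödinger propagator, `t ≠ 0`, as an integral operator with kernel the heat kernel at the
time `i t`. -/
noncomputable def schrodinger {d : ℕ} (a t : ℝ) (f : BulkPoint d → ℂ) (X : BulkPoint d) : ℂ :=
  ∫ Y, bulkHeat a (Complex.I * t) X Y * f Y ∂(halfSpaceMeasure d a)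

section group

variable {d : ℕ} {a : ℝ} {f g : BulkPoint d → ℂ}

lemma propagator_eq_schrodinger {t : ℝ} (ht : t ≠ 0) (f : BulkPoint d → ℂ) {X : BulkPoint d}
    (hX : 0 < X.2) : propagator a t f X = schrodinger a t f X := by
  rw [propagator, if_neg ht, schrodinger]
  refine integral_congr_ae ?_
  filter_upwards [ae_halfSpace_pos d a] with Y hY
  rw [bulkHeat_I_mul ht hX hY]

lemma norm_I_mul_ofReal (t : ℝ) : ‖Complex.I * (t : ℂ)‖ = |t| := by simp

lemma norm_bulkHeat_I_mul_le (ha : 0 ≤ a) {t : ℝ} (ht : t ≠ 0) (X Y : BulkPoint d) :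
    ‖bulkHeat a (Complex.I * t) X Y‖ ≤ dispersiveConst d a * |t| ^ (-(((d : ℝ) + a + 1) / 2)) := by
  have := norm_bulkHeat_le ha (w := Complex.I * t) (by simp) (I_mul_ofReal_ne_zero ht) X Y
  rwa [norm_I_mul_ofReal] at this

lemma continuous_bulkHeat_left (ha : 0 ≤ a) (w : ℂ) (Y : BulkPoint d) :
    Continuous fun X => bulkHeat a w X Y := by
  have h2 : Continuous fun X : BulkPoint d => (X, Y) := by fun_prop
  have h3 := (continuous_bulkHeat ha w).comp h2
  exact h3

lemma continuous_bulkHeat_right (ha : 0 ≤ a) (w : ℂ) (X : BulkPoint d) :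
    Continuous fun Y => bulkHeat a w X Y := by
  simp_rw [bulkHeat_comm w X]
  exact continuous_bulkHeat_left ha w X

lemma integrable_bulkHeat_I_mul (ha : 0 ≤ a) {t : ℝ} (ht : t ≠ 0)
    (hf : Integrable f (halfSpaceMeasure d a)) (X : BulkPoint d) :
    Integrable (fun Y => bulkHeat a (Complex.I * t) X Y * f Y) (halfSpaceMeasure d a) :=
  hf.bdd_mul (continuous_bulkHeat_right ha _ X).aestronglyMeasurable
    (ae_of_all _ fun Y => norm_bulkHeat_I_mul_le ha ht X Y)

lemma norm_schrodinger_le (ha : 0 ≤ a) {t : ℝ} (ht : t ≠ 0)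
    (hf : Integrable f (halfSpaceMeasure d a)) (X : BulkPoint d) :
    ‖schrodinger a t f X‖ ≤ dispersiveConst d a * |t| ^ (-(((d : ℝ) + a + 1) / 2)) *
      ∫ Y, ‖f Y‖ ∂(halfSpaceMeasure d a) := by
  rw [schrodinger, ← integral_const_mul]
  refine norm_integral_le_of_norm_le (hf.norm.const_mul _) (ae_of_all _ fun Y => ?_)
  rw [norm_mul]
  gcongr
  exact norm_bulkHeat_I_mul_le ha ht X Y

lemma continuous_schrodinger (ha : 0 ≤ a) {t : ℝ} (ht : t ≠ 0)
    (hf : Integrable f (halfSpaceMeasure d a)) : Continuous (schrodinger a t f) := by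
  refine continuous_of_dominated (bound := fun Y =>
    dispersiveConst d a * |t| ^ (-(((d : ℝ) + a + 1) / 2)) * ‖f Y‖)
    (fun X => (integrable_bulkHeat_I_mul ha ht hf X).1) (fun X => ae_of_all _ fun Y => ?_)
    (hf.norm.const_mul _) (ae_of_all _ fun Y => ?_)
  · rw [norm_mul]
    gcongr
    exact norm_bulkHeat_I_mul_le ha ht X Y
  · have h := (continuous_bulkHeat_left ha (Complex.I * t) Y).mul (continuous_const (y := f Y))
    exact h

lemma schrodinger_add (ha : 0 ≤ a) {t : ℝ} (ht : t ≠ 0) (hf : Integrable f (halfSpaceMeasure d a))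
    (hg : Integrable g (halfSpaceMeasure d a)) (X : BulkPoint d) :
    schrodinger a t (fun Y => f Y + g Y) X = schrodinger a t f X + schrodinger a t g X := by
  simp only [schrodinger, mul_add]
  exact integral_add (integrable_bulkHeat_I_mul ha ht hf X) (integrable_bulkHeat_I_mul ha ht hg X)

lemma schrodinger_smul (c : ℂ) (t : ℝ) (X : BulkPoint d) :
    schrodinger a t (fun Y => c * f Y) X = c * schrodinger a t f X := by
  simp only [schrodinger]
  rw [← integral_const_mul]
  refine integral_congr_ae (ae_of_all _ fun Y => ?_)
  simp only
  ring

lemma stronglyMeasurable_schrodinger (ha : 0 ≤ a) {F : BulkPoint d × ℝ → ℂ}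
    (hF : StronglyMeasurable F) (s : ℝ) :
    StronglyMeasurable fun p : BulkPoint d × ℝ =>
      schrodinger a (s * p.2) (fun Y => F (Y, p.2)) p.1 := by
  unfold schrodinger
  have h1 : Measurable fun q : (BulkPoint d × ℝ) × BulkPoint d =>
      bulkHeat a (Complex.I * ((s * q.1.2 : ℝ) : ℂ)) q.1.1 q.2 := by
    have h2 : Measurable fun q : (BulkPoint d × ℝ) × BulkPoint d =>
      (Complex.I * ((s * q.1.2 : ℝ) : ℂ), (q.1.1, q.2)) := by fun_prop
    have h3 := (measurable_bulkHeat (d := d) ha).comp h2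
    exact h3
  have h4 : StronglyMeasurable fun q : (BulkPoint d × ℝ) × BulkPoint d => F (q.2, q.1.2) :=
    hF.comp_measurable (by fun_prop)
  exact (h1.stronglyMeasurable.mul h4).integral_prod_right'

/-- On `L¹ ∩ L²`, the kernel of the Schrödinger group is that of the multiplier
`exp (-i t (4 π² |ξ|² + ζ²))` of the Fourier-Bessel transform: let the real part of the complex time
tend to zero. -/
lemma integral_exp_mul_fourierBessel_eq (ha : 0 ≤ a) {t : ℝ} (ht : t ≠ 0)
    (hf : Integrable f (halfSpaceMeasure d a)) (hf2 : MemLp f 2 (halfSpaceMeasure d a))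
    (hg : Integrable g (halfSpaceMeasure d a)) (hg2 : MemLp g 2 (halfSpaceMeasure d a)) :
    ∫ Ξ, Complex.exp (-(Complex.I * t) * (bulkSymbol Ξ : ℂ)) *
        (fourierBessel a f Ξ * conj (fourierBessel a g Ξ)) ∂(halfSpaceMeasure d a)
      = ∫ X, schrodinger a t f X * conj (g X) ∂(halfSpaceMeasure d a) := by
  set ω := halfSpaceMeasure d a
  let u : ℕ → ℝ := fun n => 1 / ((n : ℝ) + 1)
  have hu0 : ∀ n, 0 < u n := fun n => by positivity
  have hu : Filter.Tendsto u Filter.atTop (nhdsWithin 0 (Ioi 0)) :=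
    tendsto_nhdsWithin_iff.2 ⟨tendsto_one_div_add_atTop_nhds_zero_nat,
      Filter.Eventually.of_forall hu0⟩
  let w : ℕ → ℂ := fun n => (u n : ℂ) + Complex.I * t
  have hwre (n : ℕ) : (w n).re = u n := by simp [w]
  have hw0 (n : ℕ) : w n ≠ 0 := fun h => by
    have := hwre n
    rw [h] at this
    exact (hu0 n).ne this
  have hwabs (n : ℕ) : |t| ≤ ‖w n‖ := by
    have := Complex.abs_im_le_norm (w n)
    simpa [w] using this
  have hgc : Integrable (fun X => conj (g X)) ω :=
    ⟨Complex.continuous_conj.comp_aestronglyMeasurable hg.1, by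
      simpa only [HasFiniteIntegral, RCLike.enorm_conj] using hg.2⟩
  have hfg : Integrable (fun p : BulkPoint d × BulkPoint d => f p.1 * conj (g p.2)) (ω.prod ω) :=
    hf.mul_prod hgc
  have hFG := integrable_mul_conj_of_memLp_two (memLp_fourierBessel ha hf hf2)
    (memLp_fourierBessel ha hg hg2)
  have hsym := continuous_bulkSymbol (d := d)
  have lim1 : Filter.Tendsto (fun n => ∫ Ξ, Complex.exp (-(w n) * (bulkSymbol Ξ : ℂ)) *
      (fourierBessel a f Ξ * conj (fourierBessel a g Ξ)) ∂ω) Filter.atTop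
      (nhds (∫ Ξ, Complex.exp (-(Complex.I * t) * (bulkSymbol Ξ : ℂ)) *
        (fourierBessel a f Ξ * conj (fourierBessel a g Ξ)) ∂ω)) := by
    refine tendsto_integral_of_dominated_convergence
      (fun Ξ => ‖fourierBessel a f Ξ * conj (fourierBessel a g Ξ)‖) (fun n => ?_) hFG.norm
      (fun n => ae_of_all _ fun Ξ => ?_) (ae_of_all _ fun Ξ => ?_)
    · have hc : Continuous fun Ξ : BulkPoint d => Complex.exp (-(w n) * (bulkSymbol Ξ : ℂ)) := by
        fun_prop
      exact hc.aestronglyMeasurable.mul hFG.1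
    · rw [norm_mul]
      refine mul_le_of_le_one_left (norm_nonneg _) ?_
      rw [norm_exp_neg_mul_bulkSymbol, Real.exp_le_one_iff, hwre]
      have := mul_nonneg (hu0 n).le (bulkSymbol_nonneg Ξ)
      linarith
    · refine Filter.Tendsto.mul_const _ ?_
      have hc : Continuous fun ε : ℝ => Complex.exp (-((ε : ℂ) + Complex.I * t) * (bulkSymbol Ξ : ℂ)) := by
        fun_prop
      have h := (hc.tendsto 0).comp tendsto_one_div_add_atTop_nhds_zero_nat
      simpa [w, u, Function.comp_def] using h
  have lim2 : Filter.Tendsto (fun n => ∫ p, bulkHeat a (w n) p.1 p.2 * (f p.1 * conj (g p.2))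
      ∂(ω.prod ω)) Filter.atTop
      (nhds (∫ p, bulkHeat a (Complex.I * t) p.1 p.2 * (f p.1 * conj (g p.2)) ∂(ω.prod ω))) := by
    refine tendsto_integral_of_dominated_convergence
      (fun p => dispersiveConst d a * |t| ^ (-(((d : ℝ) + a + 1) / 2)) * ‖f p.1 * conj (g p.2)‖)
      (fun n => ?_) (hfg.norm.const_mul _) (fun n => ae_of_all _ fun p => ?_)
      (ae_of_all _ fun p => ?_)
    · exact (continuous_bulkHeat ha (w n)).aestronglyMeasurable.mul hfg.1
    · rw [norm_mul]
      gcongr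
      refine (norm_bulkHeat_le ha (by rw [hwre]; exact (hu0 n).le) (hw0 n) p.1 p.2).trans ?_
      have := (dispersiveConst_pos (d := d) ha).le
      refine mul_le_mul_of_nonneg_left ?_ this
      refine Real.rpow_le_rpow_of_nonpos (abs_pos.2 ht) (hwabs n) ?_
      have : (0 : ℝ) ≤ ((d : ℝ) + a + 1) / 2 := by positivity
      linarith
    · exact ((tendsto_bulkHeat ha ht p.1 p.2).comp hu).mul_const _
  have heq (n : ℕ) := integral_exp_mul_fourierBessel ha hf hg (w := w n)
    (by rw [hwre]; exact hu0 n)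
  rw [tendsto_nhds_unique (lim1.congr heq) lim2, integral_prod_symm]
  · refine integral_congr_ae (ae_of_all _ fun Y => ?_)
    simp only [schrodinger]
    rw [← integral_mul_const]
    refine integral_congr_ae (ae_of_all _ fun X => ?_)
    simp only
    rw [bulkHeat_comm]
    ring
  · exact hfg.bdd_mul (continuous_bulkHeat ha (Complex.I * t)).aestronglyMeasurable
      (ae_of_all _ fun p => norm_bulkHeat_I_mul_le ha ht p.1 p.2)

lemma enorm_integral_schrodinger_mul_le (ha : 0 ≤ a) {t : ℝ} (ht : t ≠ 0)
    (hf : Integrable f (halfSpaceMeasure d a)) (hf2 : MemLp f 2 (halfSpaceMeasure d a))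
    (hg : Integrable g (halfSpaceMeasure d a)) (hg2 : MemLp g 2 (halfSpaceMeasure d a)) :
    ‖∫ X, schrodinger a t f X * conj (g X) ∂(halfSpaceMeasure d a)‖ₑ
      ≤ eLpNorm f 2 (halfSpaceMeasure d a) * eLpNorm g 2 (halfSpaceMeasure d a) := by
  rw [← integral_exp_mul_fourierBessel_eq ha ht hf hf2 hg hg2]
  calc _ ≤ ∫⁻ Ξ, ‖Complex.exp (-(Complex.I * t) * (bulkSymbol Ξ : ℂ)) *
        (fourierBessel a f Ξ * conj (fourierBessel a g Ξ))‖ₑ ∂(halfSpaceMeasure d a) :=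
        enorm_integral_le_lintegral_enorm _
    _ = ∫⁻ Ξ, ‖fourierBessel a f Ξ‖ₑ * ‖fourierBessel a g Ξ‖ₑ ∂(halfSpaceMeasure d a) := by
        refine lintegral_congr fun Ξ => ?_
        have h1 : ‖Complex.exp (-(Complex.I * t) * (bulkSymbol Ξ : ℂ))‖ₑ = 1 := by
          rw [← ofReal_norm, norm_exp_neg_mul_bulkSymbol]
          simp
        rw [enorm_mul, h1, one_mul, enorm_mul, RCLike.enorm_conj]
    _ ≤ eLpNorm (fourierBessel a f) 2 (halfSpaceMeasure d a) *
          eLpNorm (fourierBessel a g) 2 (halfSpaceMeasure d a) :=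
        lintegral_enorm_mul_le_eLpNorm_two (continuous_fourierBessel ha hf).aestronglyMeasurable
          (continuous_fourierBessel ha hg).aestronglyMeasurable
    _ ≤ _ := by
        gcongr <;> exact eLpNorm_fourierBessel_le ha ‹_›

/-- The Schrödinger propagator does not increase the `L²` norm. -/
lemma eLpNorm_schrodinger_le (ha : 0 ≤ a) {t : ℝ} (ht : t ≠ 0)
    (hf : Integrable f (halfSpaceMeasure d a)) (hf2 : MemLp f 2 (halfSpaceMeasure d a)) :
    eLpNorm (schrodinger a t f) 2 (halfSpaceMeasure d a) ≤ eLpNorm f 2 (halfSpaceMeasure d a) := by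
  set ω := halfSpaceMeasure d a
  refine eLpNorm_two_le_of_spanningSets fun n => ?_
  set S := spanningSets ω n
  have hS : MeasurableSet S := measurableSet_spanningSets ω n
  have hSfin : ω S < ∞ := measure_spanningSets_lt_top ω n
  have hcont := continuous_schrodinger ha ht hf
  set g : BulkPoint d → ℂ := S.indicator (schrodinger a t f)
  have hgtop : MemLp g ∞ ω := by
    refine memLp_top_of_bound (hcont.aestronglyMeasurable.indicator hS) _
      (ae_of_all _ fun X => (norm_indicator_le_norm_self _ _).trans (norm_schrodinger_le ha ht hf X))
  have hgp (p : ℝ≥0∞) : MemLp g p ω :=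
    hgtop.mono_exponent_of_measure_support_ne_top (s := S)
      (fun X hX => indicator_of_notMem hX _) hSfin.ne le_top
  have hg1 : Integrable g ω := memLp_one_iff_integrable.1 (hgp 1)
  have h := enorm_integral_schrodinger_mul_le ha ht hf hf2 hg1 (hgp 2)
  have hg : ∀ X, ‖g X‖ₑ ^ 2 = S.indicator (fun X => ‖schrodinger a t f X‖ₑ ^ 2) X := fun X => by
    by_cases hX : X ∈ S <;> simp [g, hX]
  have hgint : ∫⁻ X in S, ‖schrodinger a t f X‖ₑ ^ 2 ∂ω = eLpNorm g 2 ω ^ 2 := by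
    rw [eLpNorm_two_sq, ← lintegral_indicator hS]
    exact lintegral_congr fun X => (hg X).symm
  have hval : ‖∫ X, schrodinger a t f X * conj (g X) ∂ω‖ₑ = eLpNorm g 2 ω ^ 2 := by
    have e : ∀ X, schrodinger a t f X * conj (g X) = ((‖g X‖ ^ 2 : ℝ) : ℂ) := fun X => by
      by_cases hX : X ∈ S
      · simp only [g, indicator_of_mem hX]
        rw [Complex.mul_conj, Complex.normSq_eq_norm_sq]
      · simp [g, hX]
    have hint : Integrable (fun X => ‖g X‖ ^ 2) ω := (hgp 2).integrable_norm_pow two_ne_zero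
    simp_rw [e]
    rw [integral_complex_ofReal, ← ofReal_norm, Complex.norm_real,
      Real.norm_of_nonneg (integral_nonneg fun _ => by positivity),
      ofReal_integral_eq_lintegral_ofReal hint (ae_of_all _ fun _ => by positivity), eLpNorm_two_sq]
    refine lintegral_congr fun X => ?_
    rw [ENNReal.ofReal_pow (norm_nonneg _), ofReal_norm]
  rw [hval, sq] at h
  rw [hgint]
  by_cases h0 : eLpNorm g 2 ω = 0
  · simp [h0]
  · gcongr
    exact (ENNReal.mul_le_mul_iff_left h0 (hgp 2).2.ne).1 h

lemma memLp_schrodinger (ha : 0 ≤ a) {t : ℝ} (ht : t ≠ 0)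
    (hf : Integrable f (halfSpaceMeasure d a)) (hf2 : MemLp f 2 (halfSpaceMeasure d a)) :
    MemLp (schrodinger a t f) 2 (halfSpaceMeasure d a) :=
  ⟨(continuous_schrodinger ha ht hf).aestronglyMeasurable,
    (eLpNorm_schrodinger_le ha ht hf hf2).trans_lt hf2.2⟩

end group

/-! ### Interpolation and fractional integration -/

lemma lintegral_Ioc_rpow {e b : ℝ} (he : -1 < e) (hb : 0 ≤ b) :
    ∫⁻ x in Ioc 0 b, ENNReal.ofReal (x ^ e) = ENNReal.ofReal (b ^ (e + 1) / (e + 1)) := by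
  have hi : IntegrableOn (fun x : ℝ => x ^ e) (Ioc 0 b) :=
    (intervalIntegrable_iff_integrableOn_Ioc_of_le hb).1 (intervalIntegral.intervalIntegrable_rpow' he)
  rw [← ofReal_integral_eq_lintegral_ofReal hi]
  · rw [← intervalIntegral.integral_of_le hb, integral_rpow (Or.inl he),
      Real.zero_rpow (by linarith), sub_zero]
  · filter_upwards [ae_restrict_mem measurableSet_Ioc] with x hx using Real.rpow_nonneg hx.1.le _

lemma lintegral_Ioi_rpow {e c : ℝ} (he : e < -1) (hc : 0 < c) :
    ∫⁻ x in Ioi c, ENNReal.ofReal (x ^ e) = ENNReal.ofReal (-c ^ (e + 1) / (e + 1)) := by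
  rw [← ofReal_integral_eq_lintegral_ofReal (integrableOn_Ioi_rpow_of_lt he hc)]
  · rw [integral_Ioi_rpow_of_lt he hc]
  · filter_upwards [ae_restrict_mem measurableSet_Ioi] with x hx using
      Real.rpow_nonneg (hc.trans hx).le _

lemma lintegral_comp_abs (g : ℝ → ℝ≥0∞) :
    ∫⁻ u, g |u| = 2 * ∫⁻ u in Ioi 0, g u := by
  have h1 : ∫⁻ u in Ioi (0 : ℝ), g |u| = ∫⁻ u in Ioi 0, g u :=
    setLIntegral_congr_fun measurableSet_Ioi fun u hu => by rw [abs_of_pos hu]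
  have h2 : ∫⁻ u in Iic (0 : ℝ), g |u| = ∫⁻ u in Ioi 0, g u := by
    rw [← setLIntegral_congr (Iio_ae_eq_Iic (a := (0 : ℝ)))]
    have h3 := (Measure.measurePreserving_neg (volume : Measure ℝ)).setLIntegral_comp_preimage_emb
      (MeasurableEquiv.neg ℝ).measurableEmbedding (fun u => g |u|) (Ioi 0)
    have e : Neg.neg ⁻¹' Ioi (0 : ℝ) = Iio 0 := by ext u; simp
    rw [e] at h3
    simp only [abs_neg] at h3
    rw [h3, h1]
  rw [← lintegral_add_compl _ (measurableSet_Ioi (a := (0 : ℝ))), compl_Ioi, h1, h2, two_mul]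

lemma integrable_rpow_norm_of_memLp_two {α : Type*} [MeasurableSpace α] {μ : Measure α} {p : ℝ}
    (hp1 : 1 ≤ p) (hp2 : p ≤ 2) {f : α → ℂ} (hf : Integrable f μ) (hf2 : MemLp f 2 μ) :
    Integrable (fun x => ‖f x‖ ^ p) μ := by
  refine (hf.norm.add (hf2.integrable_norm_pow two_ne_zero)).mono'
    (hf.aestronglyMeasurable.norm.aemeasurable.pow_const p).aestronglyMeasurable
    (ae_of_all _ fun x => ?_)
  have hx := norm_nonneg (f x)
  rw [Real.norm_of_nonneg (by positivity), Pi.add_apply]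
  simp only
  rcases le_total ‖f x‖ 1 with h | h
  · have := Real.rpow_le_rpow_of_exponent_ge' hx h zero_le_one hp1
    rw [Real.rpow_one] at this
    have := sq_nonneg ‖f x‖
    linarith
  · have := Real.rpow_le_rpow_of_exponent_le h hp2
    rw [Real.rpow_two] at this
    linarith

/-- The constant in `lintegral_rpow_le_of_weak_bounds`. -/
noncomputable def interpolationConst (r : ℝ) : ℝ := 4 * r * 2 ^ (r - 2) / (r - 2)

/-- Interpolation between `L¹ → L^∞` and `L² → L²`, in the manner of Marcinkiewicz: at the level `lam`
the datum is cut at a height for which the `L^∞` norm of the image of the upper part is at most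
`lam / 2`. -/
lemma lintegral_rpow_le_of_weak_bounds {α : Type*} [MeasurableSpace α] {μ : Measure α} [SFinite μ]
    {T : (α → ℂ) → α → ℂ} {A : ℝ} (hA : 0 < A)
    (hadd : ∀ f g, Integrable f μ → Integrable g μ → ∀ x, T (fun y => f y + g y) x = T f x + T g x)
    (hmeas : ∀ f, Integrable f μ → MemLp f 2 μ → AEStronglyMeasurable (T f) μ)
    (hinf : ∀ f, Integrable f μ → ∀ x, ‖T f x‖ ≤ A * ∫ y, ‖f y‖ ∂μ)
    (htwo : ∀ f, Integrable f μ → MemLp f 2 μ → eLpNorm (T f) 2 μ ≤ eLpNorm f 2 μ)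
    {p r : ℝ} (hr : 2 < r) (hp : p = r / (r - 1)) {f : α → ℂ} (hfm : StronglyMeasurable f)
    (hf : Integrable f μ) (hf2 : MemLp f 2 μ) :
    ∫⁻ x, ENNReal.ofReal (‖T f x‖ ^ r) ∂μ
      ≤ ENNReal.ofReal (interpolationConst r * A ^ (r - 2) * (∫ x, ‖f x‖ ^ p ∂μ) ^ (r - 1)) := by
  have hr1 : 0 < r - 1 := by linarith
  have hr2 : 0 < r - 2 := by linarith
  have hp1 : p - 1 = 1 / (r - 1) := by rw [hp]; field_simp; ring
  have hp1pos : 0 < p - 1 := by rw [hp1]; positivity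
  have hp2 : p ≤ 2 := by
    rw [hp, div_le_iff₀ hr1]; linarith
  have hp0 : 0 < p := by linarith
  have hfp := integrable_rpow_norm_of_memLp_two (by linarith : 1 ≤ p) hp2 hf hf2
  set N := ∫ x, ‖f x‖ ^ p ∂μ with hN
  have hN0 : 0 ≤ N := integral_nonneg fun x => by positivity
  rcases hN0.eq_or_lt with hzero | hNpos
  · have h1 : (fun x => ‖f x‖ ^ p) =ᵐ[μ] 0 :=
      (integral_eq_zero_iff_of_nonneg (fun x => by positivity) hfp).1 hzero.symm
    have h2 : ∫ y, ‖f y‖ ∂μ = 0 := by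
      refine integral_eq_zero_of_ae ?_
      filter_upwards [h1] with x hx
      exact ((Real.rpow_eq_zero_iff_of_nonneg (norm_nonneg _)).1 hx).1
    have h3 : ∀ x, ENNReal.ofReal (‖T f x‖ ^ r) = 0 := fun x => by
      have := hinf f hf x
      rw [h2, mul_zero] at this
      rw [le_antisymm this (norm_nonneg _), Real.zero_rpow (by linarith), ENNReal.ofReal_zero]
    simp [h3]
  have hB : 0 < 2 * A * N := by positivity
  -- The points at which the datum is below the height that belongs to the level `lam`.
  let S : ℝ → Set α := fun lam => {x | ‖f x‖ ^ (p - 1) * lam ≤ 2 * A * N}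
  have hS : MeasurableSet {q : ℝ × α | ‖f q.2‖ ^ (p - 1) * q.1 ≤ 2 * A * N} := by
    have : Measurable fun x => ‖f x‖ := hfm.norm.measurable
    exact measurableSet_le (((this.comp measurable_snd).pow_const _).mul measurable_fst)
      measurable_const
  have hSl (lam : ℝ) : MeasurableSet (S lam) := hS.preimage measurable_prodMk_left
  have weak (lam : ℝ) (hlam : 0 < lam) : μ {x | lam < ‖T f x‖}
      ≤ ENNReal.ofReal (4 * lam ^ (-2 : ℝ)) * ∫⁻ x, (S lam).indicator (fun x => ‖f x‖ₑ ^ 2) x ∂μ := by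
    set f₁ := (S lam)ᶜ.indicator f
    set f₂ := (S lam).indicator f
    have h1 : Integrable f₁ μ := hf.indicator (hSl lam).compl
    have h2 : Integrable f₂ μ := hf.indicator (hSl lam)
    have h22 : MemLp f₂ 2 μ := hf2.indicator (hSl lam)
    have hsplit (x : α) : T f x = T f₁ x + T f₂ x := by
      rw [← hadd f₁ f₂ h1 h2 x]
      congr 1
      ext y
      by_cases hy : y ∈ S lam <;> simp [f₁, f₂, hy]
    have hbound (x : α) : ‖T f₁ x‖ ≤ lam / 2 := by
      refine (hinf f₁ h1 x).trans ?_
      have : ∫ y, ‖f₁ y‖ ∂μ ≤ ∫ y, (lam / (2 * A * N)) * ‖f y‖ ^ p ∂μ := by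
        refine integral_mono h1.norm (hfp.const_mul _) fun y => ?_
        by_cases hy : y ∈ S lam
        · simp only [f₁, indicator_of_notMem (notMem_compl_iff.2 hy), norm_zero]
          positivity
        · simp only [f₁, indicator_of_mem (mem_compl hy)]
          have hy' : 2 * A * N < ‖f y‖ ^ (p - 1) * lam := not_le.1 hy
          rw [div_mul_eq_mul_div, le_div_iff₀ hB]
          have hf0 : ‖f y‖ ≠ 0 := fun h => by
            rw [h, Real.zero_rpow hp1pos.ne', zero_mul] at hy'
            linarith
          have e : ‖f y‖ ^ p = ‖f y‖ * ‖f y‖ ^ (p - 1) := by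
            have hpos := (norm_nonneg (f y)).lt_of_ne' hf0
            nth_rewrite 2 [← Real.rpow_one ‖f y‖]
            rw [← Real.rpow_add hpos]
            ring_nf
          rw [e]
          have := mul_le_mul_of_nonneg_left hy'.le (norm_nonneg (f y))
          linarith
      rw [integral_const_mul] at this
      calc A * ∫ y, ‖f₁ y‖ ∂μ ≤ A * (lam / (2 * A * N) * N) := by gcongr
        _ = lam / 2 := by field_simp
    have hsub : {x | lam < ‖T f x‖} ⊆ {x | ENNReal.ofReal ((lam / 2) ^ 2) ≤ ‖T f₂ x‖ₑ ^ 2} := by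
      intro x hx
      have hx' : lam < ‖T f x‖ := hx
      rw [hsplit] at hx'
      have h3 := norm_add_le (T f₁ x) (T f₂ x)
      have h4 := hbound x
      have h5 : lam / 2 ≤ ‖T f₂ x‖ := by linarith
      change ENNReal.ofReal ((lam / 2) ^ 2) ≤ ‖T f₂ x‖ₑ ^ 2
      rw [ENNReal.ofReal_pow (by positivity), ← ofReal_norm]
      gcongr
    have hcheb := mul_meas_ge_le_lintegral₀ (μ := μ) ((hmeas f₂ h2 h22).enorm.pow_const 2)
      (ENNReal.ofReal ((lam / 2) ^ 2))
    have h6 : ∫⁻ x, ‖T f₂ x‖ₑ ^ 2 ∂μ ≤ ∫⁻ x, (S lam).indicator (fun x => ‖f x‖ₑ ^ 2) x ∂μ := by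
      have e : ∀ x, (S lam).indicator (fun x => ‖f x‖ₑ ^ 2) x = ‖f₂ x‖ₑ ^ 2 := fun x => by
        by_cases hx : x ∈ S lam <;> simp [f₂, hx]
      simp_rw [e]
      rw [← eLpNorm_two_sq, ← eLpNorm_two_sq]
      gcongr
      exact htwo f₂ h2 h22
    have h7 : ENNReal.ofReal (4 * lam ^ (-2 : ℝ)) * ENNReal.ofReal ((lam / 2) ^ 2) = 1 := by
      rw [← ENNReal.ofReal_mul (by positivity), Real.rpow_neg hlam.le, Real.rpow_two,
        ← ENNReal.ofReal_one]
      congr 1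
      field_simp
      norm_num
    calc μ {x | lam < ‖T f x‖} ≤ μ {x | ENNReal.ofReal ((lam / 2) ^ 2) ≤ ‖T f₂ x‖ₑ ^ 2} :=
          measure_mono hsub
      _ = ENNReal.ofReal (4 * lam ^ (-2 : ℝ)) * (ENNReal.ofReal ((lam / 2) ^ 2) *
            μ {x | ENNReal.ofReal ((lam / 2) ^ 2) ≤ ‖T f₂ x‖ₑ ^ 2}) := by
          rw [← mul_assoc, h7, one_mul]
      _ ≤ _ := by
          gcongr
          exact hcheb.trans h6
  rw [lintegral_rpow_eq_lintegral_meas_lt_mul μ (ae_of_all _ fun x => norm_nonneg _)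
    (hmeas f hf hf2).norm.aemeasurable (by linarith : 0 < r)]
  have step1 : ∫⁻ lam in Ioi 0, μ {x | lam < ‖T f x‖} * ENNReal.ofReal (lam ^ (r - 1))
      ≤ ∫⁻ lam in Ioi 0, ∫⁻ x, ENNReal.ofReal (4 * lam ^ (r - 3)) *
          (S lam).indicator (fun x => ‖f x‖ₑ ^ 2) x ∂μ := by
    refine setLIntegral_mono' measurableSet_Ioi fun lam hlam => ?_
    have hlam' : 0 < lam := hlam
    have hm : Measurable ((S lam).indicator fun x => ‖f x‖ₑ ^ 2) :=
      (hfm.enorm.pow_const 2).indicator (hSl lam)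
    rw [lintegral_const_mul _ hm]
    calc _ ≤ (ENNReal.ofReal (4 * lam ^ (-2 : ℝ)) *
          ∫⁻ x, (S lam).indicator (fun x => ‖f x‖ₑ ^ 2) x ∂μ) * ENNReal.ofReal (lam ^ (r - 1)) := by
          gcongr
          exact weak lam hlam'
      _ = (ENNReal.ofReal (4 * lam ^ (-2 : ℝ)) * ENNReal.ofReal (lam ^ (r - 1))) *
          ∫⁻ x, (S lam).indicator (fun x => ‖f x‖ₑ ^ 2) x ∂μ := by ring
      _ = _ := by
          rw [← ENNReal.ofReal_mul (by positivity), mul_assoc, ← Real.rpow_add hlam']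
          ring_nf
  have hjoint : Measurable (Function.uncurry fun (lam : ℝ) (x : α) =>
      ENNReal.ofReal (4 * lam ^ (r - 3)) * (S lam).indicator (fun x => ‖f x‖ₑ ^ 2) x) := by
    have h1 : Measurable fun q : ℝ × α => ENNReal.ofReal (4 * q.1 ^ (r - 3)) := by fun_prop
    have h2 : Measurable fun q : ℝ × α => ‖f q.2‖ₑ ^ 2 :=
      (hfm.enorm.comp measurable_snd).pow_const 2
    have h3 := h1.mul (h2.indicator hS)
    exact h3
  have hdens : ∫⁻ lam in Ioi 0, ∫⁻ x, ENNReal.ofReal (4 * lam ^ (r - 3)) *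
          (S lam).indicator (fun x => ‖f x‖ₑ ^ 2) x ∂μ
      ≤ ∫⁻ x, ENNReal.ofReal (4 * (2 * A * N) ^ (r - 2) / (r - 2) * ‖f x‖ ^ p) ∂μ := by
    rw [lintegral_lintegral_swap hjoint.aemeasurable]
    refine lintegral_mono fun x => ?_
    rcases (norm_nonneg (f x)).eq_or_lt with h0 | h0
    · have h1 : ∀ lam : ℝ, (S lam).indicator (fun x => ‖f x‖ₑ ^ 2) x = 0 := fun lam =>
        indicator_apply_eq_zero.2 fun _ => by simp [norm_eq_zero.1 h0.symm]
      simp [h1]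
    · have hb : 0 < 2 * A * N / ‖f x‖ ^ (p - 1) := by positivity
      have h1 : ∫⁻ lam in Ioi (0 : ℝ), ENNReal.ofReal (4 * lam ^ (r - 3)) *
            (S lam).indicator (fun x => ‖f x‖ₑ ^ 2) x
          = ∫⁻ lam in Ioc (0 : ℝ) (2 * A * N / ‖f x‖ ^ (p - 1)),
            ENNReal.ofReal (4 * ‖f x‖ ^ 2) * ENNReal.ofReal (lam ^ (r - 3)) := by
        rw [← lintegral_indicator measurableSet_Ioi, ← lintegral_indicator measurableSet_Ioc]
        congr 1
        ext lam
        by_cases hl : 0 < lam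
        · by_cases hl2 : lam ≤ 2 * A * N / ‖f x‖ ^ (p - 1)
          · have hx : x ∈ S lam := by
              rw [le_div_iff₀ (by positivity)] at hl2
              change ‖f x‖ ^ (p - 1) * lam ≤ 2 * A * N
              linarith
            rw [indicator_of_mem (mem_Ioi.2 hl), indicator_of_mem (mem_Ioc.2 ⟨hl, hl2⟩),
              indicator_of_mem hx, ← ofReal_norm, ← ENNReal.ofReal_pow h0.le,
              ← ENNReal.ofReal_mul (by positivity), ← ENNReal.ofReal_mul (by positivity)]
            ring_nf
          · have hx : x ∉ S lam := fun hx => hl2 (by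
              rw [le_div_iff₀ (by positivity)]
              have hx' : ‖f x‖ ^ (p - 1) * lam ≤ 2 * A * N := hx
              linarith)
            rw [indicator_of_mem (mem_Ioi.2 hl), indicator_of_notMem (fun h : lam ∈ Ioc _ _ => hl2 h.2),
              indicator_of_notMem hx]
            simp
        · rw [indicator_of_notMem (fun h : lam ∈ Ioi 0 => hl h),
            indicator_of_notMem (fun h : lam ∈ Ioc _ _ => hl h.1)]
      rw [h1, lintegral_const_mul _ (by fun_prop), lintegral_Ioc_rpow (by linarith) hb.le,
        ← ENNReal.ofReal_mul (by positivity)]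
      refine ENNReal.ofReal_le_ofReal (le_of_eq ?_)
      have e1 : r - 3 + 1 = r - 2 := by ring
      rw [e1, Real.div_rpow hB.le (by positivity), ← Real.rpow_mul h0.le]
      have e2 : ‖f x‖ ^ 2 = ‖f x‖ ^ p * ‖f x‖ ^ ((p - 1) * (r - 2)) := by
        rw [← Real.rpow_add h0, ← Real.rpow_two]
        congr 1
        rw [hp]
        field_simp
        ring
      rw [e2]
      field_simp
  have hfin := step1.trans hdens
  have hNint : ∫⁻ x, ENNReal.ofReal (4 * (2 * A * N) ^ (r - 2) / (r - 2) * ‖f x‖ ^ p) ∂μ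
      = ENNReal.ofReal (4 * (2 * A * N) ^ (r - 2) / (r - 2) * N) := by
    rw [← ofReal_integral_eq_lintegral_ofReal (hfp.const_mul _), integral_const_mul]
    exact ae_of_all _ fun x => by positivity
  rw [hNint] at hfin
  calc _ ≤ ENNReal.ofReal r * ENNReal.ofReal (4 * (2 * A * N) ^ (r - 2) / (r - 2) * N) := by
        gcongr
    _ = _ := by
        rw [← ENNReal.ofReal_mul (by linarith), interpolationConst]
        congr 1
        have e : N ^ (r - 1) = N ^ (r - 2) * N := by
          nth_rewrite 3 [← Real.rpow_one N]
          rw [← Real.rpow_add hNpos]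
          ring_nf
        rw [e, Real.mul_rpow (by positivity) hNpos.le, Real.mul_rpow (by norm_num) hA.le]
        field_simp

/-- The constant in `lintegral_lintegral_mul_rpow_le`. -/
noncomputable def fractionalConst (q : ℝ) : ℝ := 2 * (2 / (1 - 2 / q) + 2 ^ (1 / q))

lemma fractionalConst_pos {q : ℝ} (hq : 2 < q) : 0 < fractionalConst q := by
  have : 0 < 1 - 2 / q := by
    rw [sub_pos, div_lt_one (by linarith)]
    exact hq
  unfold fractionalConst
  positivity

/-- The fractional integral of a function that is at most `h` everywhere: the kernel is cut at the
distance `N / h ^ p`, at which the trivial bound and Hölder's inequality are of the same size. -/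
lemma lintegral_mul_rpow_le_of_le {q p h N : ℝ} (hq : 2 < q) (hp : p = q / (q - 1)) (hh : 0 < h)
    (hN : 0 < N) {f : ℝ → ℝ≥0∞} (hf : Measurable f) (hfh : ∀ t, f t ≤ ENNReal.ofReal h)
    (hfN : ∫⁻ t, f t ^ p ≤ ENNReal.ofReal N) (s : ℝ) :
    ∫⁻ t, f t * ENNReal.ofReal (|s - t| ^ (-(2 / q)))
      ≤ ENNReal.ofReal ((2 / (1 - 2 / q) + 2 ^ (1 / q)) * N ^ (1 - 2 / q) * h ^ (p - 1)) := by
  have hq1 : 0 < q - 1 := by linarith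
  have hq0 : 0 < q := by linarith
  have hσ : 0 < 1 - 2 / q := by
    rw [sub_pos, div_lt_one hq0]
    exact hq
  set R := N * h ^ (-p) with hR
  have hRpos : 0 < R := by positivity
  have hp0 : 0 < p := by rw [hp]; positivity
  have near : ∫⁻ t in {t | |s - t| ≤ R}, f t * ENNReal.ofReal (|s - t| ^ (-(2 / q)))
      ≤ ENNReal.ofReal (2 / (1 - 2 / q) * N ^ (1 - 2 / q) * h ^ (p - 1)) := by
    have hS : MeasurableSet {t : ℝ | |s - t| ≤ R} := measurableSet_le (by fun_prop) (by fun_prop)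
    calc _ ≤ ∫⁻ t in {t | |s - t| ≤ R}, ENNReal.ofReal h * ENNReal.ofReal (|s - t| ^ (-(2 / q))) := by
          gcongr with t
          exact hfh t
      _ = ENNReal.ofReal h * ∫⁻ t, (Iic R).indicator (fun u => ENNReal.ofReal (u ^ (-(2 / q)))) |s - t| := by
          rw [lintegral_const_mul _ (by fun_prop), ← lintegral_indicator hS]
          rfl
      _ = ENNReal.ofReal h * (2 * ∫⁻ u in Ioc 0 R, ENNReal.ofReal (u ^ (-(2 / q)))) := by
          rw [lintegral_sub_left_eq_self
            (fun u : ℝ => (Iic R).indicator (fun u => ENNReal.ofReal (u ^ (-(2 / q)))) |u|) s,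
            lintegral_comp_abs, setLIntegral_indicator measurableSet_Iic, inter_comm, Ioi_inter_Iic]
      _ = _ := by
          rw [lintegral_Ioc_rpow (by linarith) hRpos.le, ← ENNReal.ofReal_ofNat,
            ← ENNReal.ofReal_mul (by norm_num), ← ENNReal.ofReal_mul hh.le]
          congr 1
          have e1 : -(2 / q) + 1 = 1 - 2 / q := by ring
          have e2 : h ^ (p - 1) = h * h ^ (-p * (1 - 2 / q)) := by
            nth_rewrite 2 [← Real.rpow_one h]
            rw [← Real.rpow_add hh]
            congr 1
            rw [hp]
            field_simp
            ring
          rw [e1, e2, hR, Real.mul_rpow hN.le (by positivity), ← Real.rpow_mul hh.le]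
          field_simp
  have far : ∫⁻ t in {t | |s - t| ≤ R}ᶜ, f t * ENNReal.ofReal (|s - t| ^ (-(2 / q)))
      ≤ ENNReal.ofReal (2 ^ (1 / q) * N ^ (1 - 2 / q) * h ^ (p - 1)) := by
    have hS : MeasurableSet {t : ℝ | |s - t| ≤ R} := measurableSet_le (by fun_prop) (by fun_prop)
    have hpq : p.HolderConjugate q := by
      rw [hp]
      exact (Real.HolderConjugate.conjExponent (by linarith : 1 < q)).symm
    have hK : ∫⁻ t in {t | |s - t| ≤ R}ᶜ, ENNReal.ofReal (|s - t| ^ (-(2 / q))) ^ q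
        = ENNReal.ofReal (2 / R) := by
      calc _ = ∫⁻ t in {t | |s - t| ≤ R}ᶜ, ENNReal.ofReal (|s - t| ^ (-2 : ℝ)) := by
            refine lintegral_congr fun t => ?_
            rw [ENNReal.ofReal_rpow_of_nonneg (by positivity) hq0.le, ← Real.rpow_mul (abs_nonneg _)]
            congr 2
            field_simp
        _ = ∫⁻ t, (Ioi R).indicator (fun u => ENNReal.ofReal (u ^ (-2 : ℝ))) |s - t| := by
            rw [← lintegral_indicator hS.compl]
            refine lintegral_congr fun t => ?_
            by_cases ht : |s - t| ≤ R
            · rw [indicator_of_notMem (fun h : t ∈ {t | |s - t| ≤ R}ᶜ => h ht),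
                indicator_of_notMem (notMem_Ioi.2 ht)]
            · rw [indicator_of_mem (show t ∈ {t | |s - t| ≤ R}ᶜ from ht),
                indicator_of_mem (mem_Ioi.2 (not_le.1 ht))]
        _ = 2 * ∫⁻ u in Ioi R, ENNReal.ofReal (u ^ (-2 : ℝ)) := by
            rw [lintegral_sub_left_eq_self
              (fun u : ℝ => (Ioi R).indicator (fun u => ENNReal.ofReal (u ^ (-2 : ℝ))) |u|) s,
              lintegral_comp_abs, setLIntegral_indicator measurableSet_Ioi, Ioi_inter_Ioi,
              sup_eq_left.2 hRpos.le]
        _ = _ := by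
            rw [lintegral_Ioi_rpow (by norm_num) hRpos, ← ENNReal.ofReal_ofNat,
              ← ENNReal.ofReal_mul (by norm_num)]
            congr 1
            have : (-2 : ℝ) + 1 = -1 := by norm_num
            rw [this, Real.rpow_neg_one]
            field_simp
    calc _ ≤ (∫⁻ t in {t | |s - t| ≤ R}ᶜ, f t ^ p) ^ (1 / p) *
          (∫⁻ t in {t | |s - t| ≤ R}ᶜ, ENNReal.ofReal (|s - t| ^ (-(2 / q))) ^ q) ^ (1 / q) :=
          ENNReal.lintegral_mul_le_Lp_mul_Lq _ hpq hf.aemeasurable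
            (by fun_prop : Measurable _).aemeasurable
      _ ≤ ENNReal.ofReal N ^ (1 / p) * ENNReal.ofReal (2 / R) ^ (1 / q) := by
          rw [hK]
          gcongr
          exact (setLIntegral_le_lintegral _ _).trans hfN
      _ = _ := by
          rw [ENNReal.ofReal_rpow_of_nonneg hN.le (by positivity),
            ENNReal.ofReal_rpow_of_nonneg (by positivity) (by positivity),
            ← ENNReal.ofReal_mul (by positivity)]
          congr 1
          have e2 : (2 / R) ^ (1 / q) = 2 ^ (1 / q) * (N ^ (-(1 / q)) * h ^ (p - 1)) := by
            have e3 : p - 1 = p * (1 / q) := by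
              rw [hp]
              field_simp
              ring
            have e4 : 2 / R = 2 * (N⁻¹ * h ^ p) := by
              rw [hR, Real.rpow_neg hh.le]
              field_simp
            rw [e3, e4, Real.mul_rpow (by norm_num) (by positivity),
              Real.mul_rpow (by positivity) (by positivity), Real.rpow_mul hh.le,
              Real.inv_rpow hN.le, Real.rpow_neg hN.le]
          have e5 : N ^ (1 - 2 / q) = N ^ (1 / p) * N ^ (-(1 / q)) := by
            rw [← Real.rpow_add hN]
            congr 1
            rw [hp]
            field_simp
            ring
          rw [e2, e5]
          ring
  rw [← lintegral_add_compl _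
    (measurableSet_le (by fun_prop) (by fun_prop) : MeasurableSet {t : ℝ | |s - t| ≤ R})]
  refine (add_le_add near far).trans ?_
  rw [← ENNReal.ofReal_add (by positivity) (by positivity)]
  refine ENNReal.ofReal_le_ofReal (le_of_eq ?_)
  ring

/-- The Hardy–Littlewood–Sobolev inequality on the line, in the diagonal case. By symmetry only the
pairs with `f t ≤ f s` matter, and for them the fractional integral has a pointwise bound. -/
lemma lintegral_lintegral_mul_rpow_le {q : ℝ} (hq : 2 < q) {f : ℝ → ℝ≥0∞} (hf : Measurable f) :
    ∫⁻ s, ∫⁻ t, f s * f t * ENNReal.ofReal (|s - t| ^ (-(2 / q)))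
      ≤ ENNReal.ofReal (fractionalConst q) * (∫⁻ t, f t ^ (q / (q - 1))) ^ (2 - 2 / q) := by
  have hq1 : 0 < q - 1 := by linarith
  have hq0 : 0 < q := by linarith
  have hσ : 0 < 1 - 2 / q := by
    rw [sub_pos, div_lt_one hq0]
    exact hq
  set p := q / (q - 1) with hp
  have hp0 : 0 < p := by positivity
  set N := ∫⁻ t, f t ^ p with hNdef
  rcases eq_or_ne N ∞ with hNtop | hNtop
  · rw [hNtop, ENNReal.top_rpow_of_pos (by linarith), ENNReal.mul_top]
    · exact le_top
    · exact (ENNReal.ofReal_pos.2 (fractionalConst_pos hq)).ne'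
  rcases eq_or_ne N 0 with hN0 | hN0
  · have h0 : ∀ᵐ t, f t = 0 := by
      have := (lintegral_eq_zero_iff (hf.pow_const p)).1 hN0
      filter_upwards [this] with t ht
      exact (ENNReal.rpow_eq_zero_iff_of_pos hp0).1 ht
    have : ∫⁻ s, ∫⁻ t, f s * f t * ENNReal.ofReal (|s - t| ^ (-(2 / q))) = 0 := by
      rw [lintegral_congr_ae (g := 0), Pi.zero_def, lintegral_zero]
      filter_upwards [h0] with s hs
      simp [hs]
    rw [this]
    exact bot_le
  let G : ℝ → ℝ → ℝ≥0∞ := fun s t =>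
    f s * ({q : ℝ × ℝ | f q.2 ≤ f q.1}.indicator (fun q => f q.2) (s, t)
      * ENNReal.ofReal (|s - t| ^ (-(2 / q))))
  have hSm : MeasurableSet {q : ℝ × ℝ | f q.2 ≤ f q.1} :=
    measurableSet_le (hf.comp measurable_snd) (hf.comp measurable_fst)
  have hGm : Measurable (Function.uncurry G) := by
    have h1 : Measurable fun w : ℝ × ℝ => ENNReal.ofReal (|w.1 - w.2| ^ (-(2 / q))) := by fun_prop
    exact (hf.comp measurable_fst).mul (((hf.comp measurable_snd).indicator hSm).mul h1)
  have hle (s t : ℝ) : f s * f t * ENNReal.ofReal (|s - t| ^ (-(2 / q))) ≤ G s t + G t s := by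
    rcases le_total (f t) (f s) with h | h
    · have : G s t = f s * f t * ENNReal.ofReal (|s - t| ^ (-(2 / q))) := by
        simp only [G, mul_assoc]
        rw [indicator_of_mem (show (s, t) ∈ {q : ℝ × ℝ | f q.2 ≤ f q.1} from h)]
      rw [← this]
      exact le_self_add
    · have : G t s = f s * f t * ENNReal.ofReal (|s - t| ^ (-(2 / q))) := by
        simp only [G]
        rw [indicator_of_mem (show (t, s) ∈ {q : ℝ × ℝ | f q.2 ≤ f q.1} from h), abs_sub_comm]
        ring
      rw [← this]
      exact le_add_self
  have hsymm : ∫⁻ s, ∫⁻ t, G t s = ∫⁻ s, ∫⁻ t, G s t :=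
    lintegral_lintegral_swap (f := fun s t => G t s) (hGm.comp measurable_swap).aemeasurable
  have hfin : ∀ᵐ s, f s < ∞ := by
    filter_upwards [ae_lt_top (hf.pow_const p) hNtop] with s hs
    exact (ENNReal.rpow_lt_top_iff_of_pos hp0).1 hs
  have hNr : ENNReal.ofReal N.toReal = N := ENNReal.ofReal_toReal hNtop
  have hNpos : 0 < N.toReal := ENNReal.toReal_pos hN0 hNtop
  set c := 2 / (1 - 2 / q) + 2 ^ (1 / q) with hc
  have hc0 : 0 < c := by positivity
  have hG : ∫⁻ s, ∫⁻ t, G s t ≤ ENNReal.ofReal c * N ^ (2 - 2 / q) := by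
    calc _ ≤ ∫⁻ s, ENNReal.ofReal c * N ^ (1 - 2 / q) * f s ^ p := by
          refine lintegral_mono_ae ?_
          filter_upwards [hfin] with s hs
          have hm : Measurable fun t => {q : ℝ × ℝ | f q.2 ≤ f q.1}.indicator (fun q => f q.2) (s, t) :=
            ((hf.comp measurable_snd).indicator hSm).comp measurable_prodMk_left
          have hk : Measurable fun t => ENNReal.ofReal (|s - t| ^ (-(2 / q))) := by fun_prop
          simp only [G]
          have hmk := hm.mul hk
          simp only [Pi.mul_def] at hmk
          rw [lintegral_const_mul _ hmk]
          rcases eq_or_ne (f s) 0 with h0 | h0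
          · simp [h0]
          have hhpos := ENNReal.toReal_pos h0 hs.ne
          have hhr := ENNReal.ofReal_toReal hs.ne
          have hind : ∀ t, {q : ℝ × ℝ | f q.2 ≤ f q.1}.indicator (fun q => f q.2) (s, t)
              ≤ f t := fun t => indicator_apply_le fun _ => le_rfl
          have key := lintegral_mul_rpow_le_of_le hq hp hhpos hNpos hm
            (fun t => by
              rw [hhr]
              exact indicator_apply_le' (fun h => h) (fun _ => bot_le))
            (by
              rw [hNr, hNdef]
              gcongr with t
              exact hind t) s
          calc _ ≤ f s * ENNReal.ofReal (c * N.toReal ^ (1 - 2 / q) * (f s).toReal ^ (p - 1)) := by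
                gcongr
            _ = _ := by
                rw [ENNReal.ofReal_mul (by positivity), ENNReal.ofReal_mul hc0.le,
                  ← ENNReal.ofReal_rpow_of_pos hNpos, ← ENNReal.ofReal_rpow_of_pos hhpos, hNr, hhr]
                have : f s ^ p = f s * f s ^ (p - 1) := by
                  nth_rewrite 2 [← ENNReal.rpow_one (f s)]
                  rw [← ENNReal.rpow_add _ _ h0 hs.ne]
                  ring_nf
                rw [this]
                ring
      _ = _ := by
          rw [lintegral_const_mul _ (hf.pow_const p), ← hNdef, mul_assoc]
          congr 1
          nth_rewrite 2 [← ENNReal.rpow_one N]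
          rw [← ENNReal.rpow_add _ _ hN0 hNtop]
          ring_nf
  have hG2 : Measurable fun s => ∫⁻ t, G s t := hGm.lintegral_prod_right'
  calc _ ≤ ∫⁻ s, ∫⁻ t, (G s t + G t s) := by
        gcongr with s t
        exact hle s t
    _ = ∫⁻ s, ((∫⁻ t, G s t) + ∫⁻ t, G t s) :=
        lintegral_congr fun s => lintegral_add_left (hGm.comp measurable_prodMk_left) _
    _ = (∫⁻ s, ∫⁻ t, G s t) + ∫⁻ s, ∫⁻ t, G s t := by
        rw [lintegral_add_left hG2, hsymm]
    _ ≤ ENNReal.ofReal c * N ^ (2 - 2 / q) + ENNReal.ofReal c * N ^ (2 - 2 / q) := add_le_add hG hG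
    _ = _ := by
        rw [fractionalConst, ENNReal.ofReal_mul (by norm_num), ENNReal.ofReal_ofNat, ← hc]
        ring

/-! ### The dual Strichartz inequality for regular data -/

section Dispersive

variable {d : ℕ} {a : ℝ} {f g : BulkPoint d → ℂ}

/-- The constant in the estimate `L^{r'} → L^r` of the propagator. -/
noncomputable def dispersiveLpConst (d : ℕ) (a r : ℝ) : ℝ :=
  interpolationConst r ^ (1 / r) * dispersiveConst d a ^ ((r - 2) / r)

lemma interpolationConst_pos {r : ℝ} (hr : 2 < r) : 0 < interpolationConst r := by
  have : 0 < r - 2 := by linarith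
  unfold interpolationConst
  positivity

lemma dispersiveLpConst_pos (ha : 0 ≤ a) {r : ℝ} (hr : 2 < r) : 0 < dispersiveLpConst d a r :=
  mul_pos (Real.rpow_pos_of_pos (interpolationConst_pos hr) _)
    (Real.rpow_pos_of_pos (dispersiveConst_pos ha) _)

lemma lintegral_schrodinger_rpow_le (ha : 0 ≤ a) {q r t : ℝ} (hr : 2 < r)
    (hqr : 2 / q = ((d : ℝ) + a + 1) * (1 / 2 - 1 / r)) (ht : t ≠ 0) (hfm : StronglyMeasurable f)
    (hf : Integrable f (halfSpaceMeasure d a)) (hf2 : MemLp f 2 (halfSpaceMeasure d a)) :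
    (∫⁻ X, ‖schrodinger a t f X‖ₑ ^ r ∂(halfSpaceMeasure d a)) ^ (1 / r)
      ≤ ENNReal.ofReal (dispersiveLpConst d a r * |t| ^ (-(2 / q))) *
        (∫⁻ X, ‖f X‖ₑ ^ r.conjExponent ∂(halfSpaceMeasure d a)) ^ (1 / r.conjExponent) := by
  have hr0 : 0 < r := by linarith
  have hr1 : 0 < r - 1 := by linarith
  have ht' : 0 < |t| := abs_pos.2 ht
  have hA := mul_pos (dispersiveConst_pos (d := d) ha)
    (Real.rpow_pos_of_pos ht' (-(((d : ℝ) + a + 1) / 2)))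
  have key := lintegral_rpow_le_of_weak_bounds (T := schrodinger a t) hA
    (fun f g hf hg x => schrodinger_add ha ht hf hg x)
    (fun f hf hf2 => (memLp_schrodinger ha ht hf hf2).1)
    (fun f hf x => norm_schrodinger_le ha ht hf x)
    (fun f hf hf2 => eLpNorm_schrodinger_le ha ht hf hf2) hr rfl hfm hf hf2
  have hp : r.conjExponent = r / (r - 1) := rfl
  have hp1 : 1 ≤ r / (r - 1) := by
    rw [le_div_iff₀ hr1]
    linarith
  have hp2 : r / (r - 1) ≤ 2 := by
    rw [div_le_iff₀ hr1]
    linarith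
  have hp0 : 0 < r / (r - 1) := by positivity
  have hfp := integrable_rpow_norm_of_memLp_two hp1 hp2 hf hf2
  have e1 : ∀ X, ‖schrodinger a t f X‖ₑ ^ r = ENNReal.ofReal (‖schrodinger a t f X‖ ^ r) := fun X => by
    rw [← ofReal_norm, ENNReal.ofReal_rpow_of_nonneg (norm_nonneg _) hr0.le]
  have e2 : ∀ X, ‖f X‖ₑ ^ (r / (r - 1)) = ENNReal.ofReal (‖f X‖ ^ (r / (r - 1))) := fun X => by
    rw [← ofReal_norm, ENNReal.ofReal_rpow_of_nonneg (norm_nonneg _) hp0.le]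
  have hI := interpolationConst_pos hr
  have hN : 0 ≤ ∫ X, ‖f X‖ ^ (r / (r - 1)) ∂(halfSpaceMeasure d a) :=
    integral_nonneg fun X => by positivity
  simp_rw [hp, e1, e2]
  rw [← ofReal_integral_eq_lintegral_ofReal hfp (ae_of_all _ fun X => by positivity)]
  calc _ ≤ _ := ENNReal.rpow_le_rpow key (by positivity)
    _ = _ := by
      have hD := dispersiveConst_pos (d := d) ha
      have hL := dispersiveLpConst_pos (d := d) ha hr
      rw [ENNReal.ofReal_rpow_of_nonneg (by positivity) (by positivity),
        ENNReal.ofReal_rpow_of_nonneg hN (by positivity),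
        ← ENNReal.ofReal_mul (by positivity)]
      congr 1
      rw [Real.mul_rpow (by positivity) (by positivity), Real.mul_rpow hI.le (by positivity),
        ← Real.rpow_mul hA.le, ← Real.rpow_mul hN, Real.mul_rpow hD.le (by positivity),
        ← Real.rpow_mul (abs_nonneg t), dispersiveLpConst]
      have x1 : (r - 2) * (1 / r) = (r - 2) / r := by ring
      have x2 : (r - 1) * (1 / r) = 1 / (r / (r - 1)) := by field_simp
      have x3 : -(((d : ℝ) + a + 1) / 2) * ((r - 2) * (1 / r)) = -(2 / q) := by
        rw [hqr]
        field_simp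
      rw [x3, x1, x2]
      ring

/-- The dispersive inequality in its bilinear form. -/
lemma enorm_integral_schrodinger_mul_le_rpow (ha : 0 ≤ a) {q r t : ℝ} (hr : 2 < r)
    (hqr : 2 / q = ((d : ℝ) + a + 1) * (1 / 2 - 1 / r)) (ht : t ≠ 0) (hfm : StronglyMeasurable f)
    (hf : Integrable f (halfSpaceMeasure d a)) (hf2 : MemLp f 2 (halfSpaceMeasure d a))
    (hg : AEStronglyMeasurable g (halfSpaceMeasure d a)) :
    ‖∫ X, schrodinger a t f X * conj (g X) ∂(halfSpaceMeasure d a)‖ₑ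
      ≤ ENNReal.ofReal (dispersiveLpConst d a r * |t| ^ (-(2 / q))) *
        ((∫⁻ X, ‖f X‖ₑ ^ r.conjExponent ∂(halfSpaceMeasure d a)) ^ (1 / r.conjExponent) *
        (∫⁻ X, ‖g X‖ₑ ^ r.conjExponent ∂(halfSpaceMeasure d a)) ^ (1 / r.conjExponent)) := by
  have hpq : r.HolderConjugate r.conjExponent := Real.HolderConjugate.conjExponent (by linarith)
  have h1 := ENNReal.lintegral_mul_le_Lp_mul_Lq (halfSpaceMeasure d a) hpq
    (memLp_schrodinger ha ht hf hf2).1.enorm hg.enorm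
  calc _ ≤ ∫⁻ X, ‖schrodinger a t f X * conj (g X)‖ₑ ∂(halfSpaceMeasure d a) :=
        enorm_integral_le_lintegral_enorm _
    _ = ∫⁻ X, ‖schrodinger a t f X‖ₑ * ‖g X‖ₑ ∂(halfSpaceMeasure d a) := by
        refine lintegral_congr fun X => ?_
        rw [enorm_mul, RCLike.enorm_conj]
    _ ≤ _ := h1
    _ ≤ _ := by
        rw [← mul_assoc]
        gcongr
        exact lintegral_schrodinger_rpow_le ha hr hqr ht hfm hf hf2

end Dispersive

section Fubini

variable {α β : Type*} [MeasurableSpace α] [MeasurableSpace β] {μ : Measure α} {τ : Measure β}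
  [SigmaFinite μ] [SigmaFinite τ]

lemma integrable_mul_conj_prod {E H : α × β → ℂ} (hE : StronglyMeasurable E)
    (hH : StronglyMeasurable H)
    (h : ∫⁻ t, eLpNorm (fun x => E (x, t)) 2 μ * eLpNorm (fun x => H (x, t)) 2 μ ∂τ < ∞) :
    Integrable (fun p => E p * conj (H p)) (μ.prod τ) := by
  have hm : StronglyMeasurable fun p => E p * conj (H p) :=
    hE.mul (Complex.continuous_conj.comp_stronglyMeasurable hH)
  refine ⟨hm.aestronglyMeasurable, ?_⟩
  rw [HasFiniteIntegral, lintegral_prod_symm _ hm.enorm.aemeasurable]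
  refine lt_of_le_of_lt (lintegral_mono fun t => ?_) h
  have h1 : StronglyMeasurable fun x => E (x, t) := hE.comp_measurable measurable_prodMk_right
  have h2 : StronglyMeasurable fun x => H (x, t) := hH.comp_measurable measurable_prodMk_right
  refine le_trans (le_of_eq (lintegral_congr fun x => ?_))
    (lintegral_enorm_mul_le_eLpNorm_two h1.aestronglyMeasurable h2.aestronglyMeasurable)
  rw [enorm_mul, RCLike.enorm_conj]

lemma measurable_eLpNorm_two_slice {E : α × β → ℂ} (hE : StronglyMeasurable E) :
    Measurable fun t => eLpNorm (fun x => E (x, t)) 2 μ := by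
  have h1 : Measurable fun t => ∫⁻ x, ‖E (x, t)‖ₑ ^ 2 ∂μ :=
    Measurable.lintegral_prod_left' (f := fun p => ‖E p‖ₑ ^ 2) (hE.enorm.pow_const 2)
  have h2 : (fun t => eLpNorm (fun x => E (x, t)) 2 μ)
      = fun t => (∫⁻ x, ‖E (x, t)‖ₑ ^ 2 ∂μ) ^ (1 / 2 : ℝ) := by
    ext t
    rw [← eLpNorm_two_sq, ← ENNReal.rpow_natCast, ← ENNReal.rpow_mul]
    norm_num
  rw [h2]
  exact h1.pow_const _

/-- A square-integrable superposition may be paired with a square-integrable function under the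
integral sign. -/
lemma integral_integral_mul_conj {E : α × β → ℂ} (hE : StronglyMeasurable E)
    (h : ∫⁻ t, eLpNorm (fun x => E (x, t)) 2 μ ∂τ < ∞) {v : α → ℂ} (hv : StronglyMeasurable v)
    (hv2 : MemLp v 2 μ) :
    ∫ x, (∫ t, E (x, t) ∂τ) * conj (v x) ∂μ = ∫ t, ∫ x, E (x, t) * conj (v x) ∂μ ∂τ := by
  have hi := integrable_mul_conj_prod (μ := μ) (τ := τ) (H := fun p => v p.1) hE
    (hv.comp_measurable measurable_fst) (by
      simp only
      rw [lintegral_mul_const _ (measurable_eLpNorm_two_slice hE)]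
      exact ENNReal.mul_lt_top h hv2.2)
  rw [integral_integral_swap (f := fun t x => E (x, t) * conj (v x)) hi.swap]
  refine integral_congr_ae (ae_of_all _ fun x => ?_)
  simp only
  rw [integral_mul_const]

/-- The squared norm of a superposition, as a double integral of inner products. -/
lemma eLpNorm_two_sq_integral_le {E : α × β → ℂ} (hE : StronglyMeasurable E)
    (h : ∫⁻ t, eLpNorm (fun x => E (x, t)) 2 μ ∂τ < ∞) :
    eLpNorm (fun x => ∫ t, E (x, t) ∂τ) 2 μ ^ 2
      ≤ ∫⁻ s, ∫⁻ t, ‖∫ x, E (x, t) * conj (E (x, s)) ∂μ‖ₑ ∂τ ∂τ := by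
  have hm := measurable_eLpNorm_two_slice (μ := μ) hE
  have hE1 : StronglyMeasurable fun p : α × (β × β) => E (p.1, p.2.2) :=
    hE.comp_measurable (by fun_prop)
  have hE2 : StronglyMeasurable fun p : α × (β × β) => E (p.1, p.2.1) :=
    hE.comp_measurable (by fun_prop)
  have hi := integrable_mul_conj_prod (μ := μ) (τ := τ.prod τ) hE1 hE2 (by
    have hmm : Measurable fun w : β × β =>
        eLpNorm (fun x => E (x, w.2)) 2 μ * eLpNorm (fun x => E (x, w.1)) 2 μ :=
      (hm.comp measurable_snd).mul (hm.comp measurable_fst)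
    simp only
    rw [lintegral_prod _ hmm.aemeasurable]
    simp only
    rw [lintegral_congr fun s => lintegral_mul_const _ hm, lintegral_const_mul _ hm]
    exact ENNReal.mul_lt_top h h)
  have hG : ∀ x, ((‖∫ t, E (x, t) ∂τ‖ ^ 2 : ℝ) : ℂ)
      = ∫ w, E (x, w.2) * conj (E (x, w.1)) ∂(τ.prod τ) := fun x => by
    have h1 := integral_prod_mul (μ := τ) (ν := τ) (fun s => conj (E (x, s))) (fun t => E (x, t))
    have h2 : ∫ w, E (x, w.2) * conj (E (x, w.1)) ∂(τ.prod τ)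
        = ∫ w, conj (E (x, w.1)) * E (x, w.2) ∂(τ.prod τ) := by
      congr 1
      ext w
      ring
    rw [h2, h1, integral_conj, Complex.conj_mul']
    push_cast
    rfl
  have hreal : ∫⁻ x, ‖∫ t, E (x, t) ∂τ‖ₑ ^ 2 ∂μ
      = ‖∫ x, ((‖∫ t, E (x, t) ∂τ‖ ^ 2 : ℝ) : ℂ) ∂μ‖ₑ := by
    have hint : Integrable (fun x => ((‖∫ t, E (x, t) ∂τ‖ ^ 2 : ℝ) : ℂ)) μ := by
      simp_rw [hG]
      exact hi.integral_prod_left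
    have hint' : Integrable (fun x => ‖∫ t, E (x, t) ∂τ‖ ^ 2) μ := by
      have := hint.re
      simpa only [RCLike.re_to_complex, Complex.ofReal_re] using this
    rw [integral_complex_ofReal, ← ofReal_norm, Complex.norm_real,
      Real.norm_of_nonneg (integral_nonneg fun x => by positivity),
      ofReal_integral_eq_lintegral_ofReal hint' (ae_of_all _ fun x => by positivity)]
    refine lintegral_congr fun x => ?_
    rw [ENNReal.ofReal_pow (norm_nonneg _), ofReal_norm]
  have hswap := integral_integral_swap
    (f := fun x (w : β × β) => E (x, w.2) * conj (E (x, w.1))) hi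
  rw [eLpNorm_two_sq, hreal]
  simp_rw [hG]
  rw [hswap]
  refine (enorm_integral_le_lintegral_enorm _).trans (lintegral_prod_le _)

end Fubini

section DualFourier

variable {d : ℕ} {a : ℝ} {F : BulkPoint d × ℝ → ℂ} {u : BulkPoint d → ℂ}

/-- Functions on space-time for which the Fourier-Bessel side of the dual Strichartz operator is
given by absolutely convergent integrals. -/
structure IsRegularDatum (a : ℝ) (F : BulkPoint d × ℝ → ℂ) : Prop where
  stronglyMeasurable : StronglyMeasurable F
  integrable_slice (t : ℝ) : Integrable (fun X => F (X, t)) (halfSpaceMeasure d a)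
  memLp_slice (t : ℝ) : MemLp (fun X => F (X, t)) 2 (halfSpaceMeasure d a)
  lintegral_lt_top : ∫⁻ t, eLpNorm (fun X => F (X, t)) 2 (halfSpaceMeasure d a) < ∞

/-- The integrand `exp (i t (4 π² |ξ|² + ζ²))` times the Fourier-Bessel transform of `F (·, t)`. -/
noncomputable def dualFourierIntegrand (a : ℝ) (F : BulkPoint d × ℝ → ℂ) (p : BulkPoint d × ℝ) : ℂ :=
  Complex.exp (Complex.I * p.2 * (bulkSymbol p.1 : ℂ)) * fourierBessel a (fun X => F (X, p.2)) p.1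

/-- The Fourier-Bessel transform of the dual Strichartz operator applied to `F`. -/
noncomputable def dualFourier (a : ℝ) (F : BulkPoint d × ℝ → ℂ) (Ξ : BulkPoint d) : ℂ :=
  ∫ t, dualFourierIntegrand a F (Ξ, t)

lemma enorm_dualFourierIntegrand (p : BulkPoint d × ℝ) :
    ‖dualFourierIntegrand a F p‖ₑ = ‖fourierBessel a (fun X => F (X, p.2)) p.1‖ₑ := by
  rw [dualFourierIntegrand, enorm_mul]
  have h : ‖Complex.exp (Complex.I * p.2 * (bulkSymbol p.1 : ℂ))‖ₑ = 1 := by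
    have e : Complex.I * p.2 * (bulkSymbol p.1 : ℂ) = ((p.2 * bulkSymbol p.1 : ℝ) : ℂ) * Complex.I := by
      push_cast
      ring
    rw [← ofReal_norm, e, Complex.norm_exp_ofReal_mul_I, ENNReal.ofReal_one]
  rw [h, one_mul]

lemma stronglyMeasurable_dualFourierIntegrand (ha : 0 ≤ a) (hF : StronglyMeasurable F) :
    StronglyMeasurable (dualFourierIntegrand a F) := by
  have h1 : StronglyMeasurable fun p : BulkPoint d × ℝ =>
      fourierBessel a (fun X => F (X, p.2)) p.1 := by
    unfold fourierBessel
    have h2 : StronglyMeasurable fun q : (BulkPoint d × ℝ) × BulkPoint d =>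
        fourierBesselKernel a q.1.1 q.2 := by
      have h3 : Continuous fun q : (BulkPoint d × ℝ) × BulkPoint d => (q.1.1, q.2) := by fun_prop
      have h4 := (continuous_fourierBesselKernel (d := d) ha).comp h3
      exact h4.stronglyMeasurable
    have h5 : StronglyMeasurable fun q : (BulkPoint d × ℝ) × BulkPoint d => F (q.2, q.1.2) :=
      hF.comp_measurable (by fun_prop)
    exact (h2.mul h5).integral_prod_right'
  have h6 : Continuous fun p : BulkPoint d × ℝ =>
      Complex.exp (Complex.I * p.2 * (bulkSymbol p.1 : ℂ)) := by
    have := continuous_bulkSymbol (d := d)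
    fun_prop
  exact h6.stronglyMeasurable.mul h1

lemma IsRegularDatum.lintegral_dualFourierIntegrand_lt_top (ha : 0 ≤ a) (hF : IsRegularDatum a F) :
    ∫⁻ t, eLpNorm (fun Ξ => dualFourierIntegrand a F (Ξ, t)) 2 (halfSpaceMeasure d a) < ∞ := by
  refine lt_of_le_of_lt (lintegral_mono fun t => ?_) hF.lintegral_lt_top
  refine le_trans (le_of_eq ?_) (eLpNorm_fourierBessel_le ha (hF.integrable_slice t))
  exact eLpNorm_congr_enorm_ae (ae_of_all _ fun Ξ => enorm_dualFourierIntegrand (Ξ, t))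

lemma stronglyMeasurable_dualFourier (ha : 0 ≤ a) (hF : StronglyMeasurable F) :
    StronglyMeasurable (dualFourier a F) :=
  (stronglyMeasurable_dualFourierIntegrand ha hF).integral_prod_right'

/-- The constant in the dual Strichartz inequality. -/
noncomputable def dualStrichartzConst (d : ℕ) (a q r : ℝ) : ℝ :=
  (dispersiveLpConst d a r * fractionalConst q) ^ (1 / 2 : ℝ)

lemma dualStrichartzConst_pos (ha : 0 ≤ a) {q r : ℝ} (hq : 2 < q) (hr : 2 < r) :
    0 < dualStrichartzConst d a q r :=
  Real.rpow_pos_of_pos (mul_pos (dispersiveLpConst_pos ha hr) (fractionalConst_pos hq)) _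

/-- The `L^r` norms of the time slices. -/
noncomputable def sliceNorm {d : ℕ} (a r : ℝ) (F : BulkPoint d × ℝ → ℂ) (t : ℝ) : ℝ≥0∞ :=
  (∫⁻ X, ‖F (X, t)‖ₑ ^ r ∂(halfSpaceMeasure d a)) ^ (1 / r)

lemma measurable_sliceNorm (hF : StronglyMeasurable F) (r : ℝ) : Measurable (sliceNorm a r F) := by
  have h1 : Measurable fun t => ∫⁻ X, ‖F (X, t)‖ₑ ^ r ∂(halfSpaceMeasure d a) :=
    Measurable.lintegral_prod_left' (f := fun p => ‖F p‖ₑ ^ r) (hF.enorm.pow_const _)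
  exact h1.pow_const _

lemma lintegral_sliceNorm_rpow {q r : ℝ} (hq : 2 < q) :
    (∫⁻ t, sliceNorm a r.conjExponent F t ^ (q / (q - 1))) ^ (2 - 2 / q)
      = mixedNorm a q.conjExponent r.conjExponent F ^ 2 := by
  have hq0 : 0 < q := by linarith
  have hq1 : 0 < q - 1 := by linarith
  have e1 : ∀ t, sliceNorm a r.conjExponent F t ^ (q / (q - 1)) =
      (∫⁻ X, ‖F (X, t)‖ₑ ^ r.conjExponent ∂(halfSpaceMeasure d a)) ^
        (q.conjExponent / r.conjExponent) := fun t => by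
    rw [sliceNorm, ← ENNReal.rpow_mul, Real.conjExponent, Real.conjExponent]
    congr 1
    ring
  simp_rw [e1]
  rw [mixedNorm, ← ENNReal.rpow_natCast, ← ENNReal.rpow_mul]
  congr 1
  rw [Real.conjExponent]
  push_cast
  field_simp

lemma dualFourierIntegrand_mul_conj (s t : ℝ) (Ξ : BulkPoint d) :
    dualFourierIntegrand a F (Ξ, t) * conj (dualFourierIntegrand a F (Ξ, s))
      = Complex.exp (-(Complex.I * ((s - t : ℝ) : ℂ)) * (bulkSymbol Ξ : ℂ)) *
        (fourierBessel a (fun X => F (X, t)) Ξ *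
          conj (fourierBessel a (fun X => F (X, s)) Ξ)) := by
  simp only [dualFourierIntegrand, map_mul]
  rw [← Complex.exp_conj]
  simp only [map_mul, Complex.conj_I, Complex.conj_ofReal]
  have : Complex.exp (-(Complex.I * ((s - t : ℝ) : ℂ)) * (bulkSymbol Ξ : ℂ))
      = Complex.exp (Complex.I * t * (bulkSymbol Ξ : ℂ)) *
        Complex.exp (-Complex.I * s * (bulkSymbol Ξ : ℂ)) := by
    rw [← Complex.exp_add]
    congr 1
    push_cast
    ring
  rw [this]
  ring

lemma IsRegularDatum.enorm_integral_dualFourierIntegrand_le (ha : 0 ≤ a) {q r : ℝ} (hr : 2 < r)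
    (hqr : 2 / q = ((d : ℝ) + a + 1) * (1 / 2 - 1 / r)) (hF : IsRegularDatum a F) {s t : ℝ}
    (hst : t ≠ s) :
    ‖∫ Ξ, dualFourierIntegrand a F (Ξ, t) * conj (dualFourierIntegrand a F (Ξ, s))
        ∂(halfSpaceMeasure d a)‖ₑ
      ≤ ENNReal.ofReal (dispersiveLpConst d a r) *
        (sliceNorm a r.conjExponent F s * sliceNorm a r.conjExponent F t *
          ENNReal.ofReal (|s - t| ^ (-(2 / q)))) := by
  have hst' : s - t ≠ 0 := sub_ne_zero.2 hst.symm
  simp_rw [dualFourierIntegrand_mul_conj]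
  rw [integral_exp_mul_fourierBessel_eq ha hst' (hF.integrable_slice t) (hF.memLp_slice t)
    (hF.integrable_slice s) (hF.memLp_slice s)]
  have hsm : StronglyMeasurable fun X => F (X, t) :=
    hF.stronglyMeasurable.comp_measurable measurable_prodMk_right
  have h := enorm_integral_schrodinger_mul_le_rpow ha hr hqr hst' hsm (hF.integrable_slice t)
    (hF.memLp_slice t) (hF.memLp_slice s).1
  refine h.trans (le_of_eq ?_)
  rw [ENNReal.ofReal_mul (dispersiveLpConst_pos ha hr).le, sliceNorm, sliceNorm]
  ring

/-- The dual Strichartz inequality on the Fourier-Bessel side, by the `T T*` method: the squared norm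
is a double time integral of inner products to which the dispersive inequality applies, and the
remaining time integral is bounded by fractional integration. -/
lemma IsRegularDatum.eLpNorm_dualFourier_le (ha : 0 ≤ a) {q r : ℝ} (hq : 2 < q) (hr : 2 < r)
    (hqr : 2 / q = ((d : ℝ) + a + 1) * (1 / 2 - 1 / r)) (hF : IsRegularDatum a F) :
    eLpNorm (dualFourier a F) 2 (halfSpaceMeasure d a)
      ≤ ENNReal.ofReal (dualStrichartzConst d a q r) *
        mixedNorm a q.conjExponent r.conjExponent F := by
  have hL := dispersiveLpConst_pos (d := d) ha hr
  have hN : Measurable (sliceNorm a r.conjExponent F) :=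
    measurable_sliceNorm hF.stronglyMeasurable _
  have hsq := eLpNorm_two_sq_integral_le (stronglyMeasurable_dualFourierIntegrand ha
    hF.stronglyMeasurable) (hF.lintegral_dualFourierIntegrand_lt_top ha)
  have hC : ENNReal.ofReal (dispersiveLpConst d a r) * ENNReal.ofReal (fractionalConst q)
      = ENNReal.ofReal (dualStrichartzConst d a q r) ^ 2 := by
    rw [← ENNReal.ofReal_mul hL.le, ← ENNReal.ofReal_pow (dualStrichartzConst_pos ha hq hr).le,
      dualStrichartzConst, ← Real.rpow_natCast, ← Real.rpow_mul
        (mul_pos hL (fractionalConst_pos hq)).le]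
    norm_num
  rw [← ENNReal.pow_le_pow_left_iff two_ne_zero, mul_pow, ← hC, ← lintegral_sliceNorm_rpow hq,
    mul_assoc]
  refine hsq.trans ?_
  generalize hNe : sliceNorm a r.conjExponent F = N at hN
  calc _ ≤ ∫⁻ s, ∫⁻ t, ENNReal.ofReal (dispersiveLpConst d a r) *
        (N s * N t * ENNReal.ofReal (|s - t| ^ (-(2 / q)))) := by
        refine lintegral_mono fun s => lintegral_mono_ae ?_
        filter_upwards [Measure.ae_ne volume s] with t ht
        rw [← hNe]
        exact hF.enorm_integral_dualFourierIntegrand_le ha hr hqr ht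
    _ = ENNReal.ofReal (dispersiveLpConst d a r) *
        ∫⁻ s, ∫⁻ t, N s * N t * ENNReal.ofReal (|s - t| ^ (-(2 / q))) := by
        rw [← lintegral_const_mul' _ _ ENNReal.ofReal_ne_top]
        exact lintegral_congr fun s => lintegral_const_mul' _ _ ENNReal.ofReal_ne_top
    _ ≤ _ := mul_le_mul' le_rfl (lintegral_lintegral_mul_rpow_le hq hN)

lemma IsRegularDatum.integrable_mul_conj_schrodinger (ha : 0 ≤ a) (hF : IsRegularDatum a F)
    (hum : StronglyMeasurable u) (hu : Integrable u (halfSpaceMeasure d a))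
    (hu2 : MemLp u 2 (halfSpaceMeasure d a)) :
    Integrable (fun p => F p * conj (schrodinger a p.2 u p.1)) (spaceTimeMeasure d a) := by
  have hS : StronglyMeasurable fun p : BulkPoint d × ℝ => schrodinger a p.2 u p.1 := by
    have := stronglyMeasurable_schrodinger ha (F := fun p : BulkPoint d × ℝ => u p.1)
      (hum.comp_measurable measurable_fst) 1
    simpa only [one_mul] using this
  refine integrable_mul_conj_prod hF.stronglyMeasurable hS ?_
  calc _ ≤ ∫⁻ t, eLpNorm (fun X => F (X, t)) 2 (halfSpaceMeasure d a) *
        eLpNorm u 2 (halfSpaceMeasure d a) := by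
        refine lintegral_mono_ae ?_
        filter_upwards [Measure.ae_ne volume 0] with t ht
        gcongr
        exact eLpNorm_schrodinger_le ha ht hu hu2
    _ = (∫⁻ t, eLpNorm (fun X => F (X, t)) 2 (halfSpaceMeasure d a)) *
        eLpNorm u 2 (halfSpaceMeasure d a) :=
        lintegral_mul_const _ (measurable_eLpNorm_two_slice hF.stronglyMeasurable)
    _ < ∞ := ENNReal.mul_lt_top hF.lintegral_lt_top hu2.2

/-- The Strichartz operator and its dual are adjoint to each other, on the Fourier-Bessel side. -/
lemma IsRegularDatum.integral_mul_conj_schrodinger (ha : 0 ≤ a) (hF : IsRegularDatum a F)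
    (hum : StronglyMeasurable u) (hu : Integrable u (halfSpaceMeasure d a))
    (hu2 : MemLp u 2 (halfSpaceMeasure d a)) :
    ∫ p, F p * conj (schrodinger a p.2 u p.1) ∂(spaceTimeMeasure d a)
      = ∫ Ξ, dualFourier a F Ξ * conj (fourierBessel a u Ξ) ∂(halfSpaceMeasure d a) := by
  have h1 := integral_prod_symm _ (hF.integrable_mul_conj_schrodinger ha hum hu hu2)
  have h2 := integral_integral_mul_conj (μ := halfSpaceMeasure d a) (τ := volume)
    (stronglyMeasurable_dualFourierIntegrand ha hF.stronglyMeasurable)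
    (hF.lintegral_dualFourierIntegrand_lt_top ha)
    (v := fourierBessel a u) (continuous_fourierBessel ha hu).stronglyMeasurable
    (memLp_fourierBessel ha hu hu2)
  unfold dualFourier
  rw [h2]
  refine h1.trans (integral_congr_ae ?_)
  filter_upwards [Measure.ae_ne volume 0] with t ht
  have key := integral_exp_mul_fourierBessel_eq ha ht hu hu2 (hF.integrable_slice t)
    (hF.memLp_slice t)
  have key' := congrArg conj key
  rw [← integral_conj, ← integral_conj] at key'
  refine Eq.trans ?_ (key'.symm.trans ?_)
  · refine integral_congr_ae (ae_of_all _ fun X => ?_)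
    simp only [map_mul, Complex.conj_conj]
    ring
  · refine integral_congr_ae (ae_of_all _ fun Ξ => ?_)
    simp only [dualFourierIntegrand, map_mul, Complex.conj_conj]
    rw [← Complex.exp_conj]
    simp only [map_mul, map_neg, Complex.conj_I, Complex.conj_ofReal]
    rw [show -(-Complex.I * (t : ℂ)) = Complex.I * t by ring]
    ring

lemma strichartz_ae_eq (u : BulkPoint d → ℂ) :
    strichartz a u =ᵐ[spaceTimeMeasure d a] fun p => schrodinger a p.2 u p.1 := by
  have h1 : ∀ᵐ p ∂(spaceTimeMeasure d a), 0 < p.1.2 :=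
    Measure.quasiMeasurePreserving_fst.ae (ae_halfSpace_pos d a)
  have h2 : ∀ᵐ p ∂(spaceTimeMeasure d a), p.2 ≠ 0 :=
    Measure.quasiMeasurePreserving_snd.ae (Measure.ae_ne volume 0)
  filter_upwards [h1, h2] with p hp1 hp2
  exact propagator_eq_schrodinger hp2 u hp1

lemma IsRegularDatum.enorm_integral_mul_conj_schrodinger_le (ha : 0 ≤ a) {q r : ℝ} (hq : 2 < q)
    (hr : 2 < r) (hqr : 2 / q = ((d : ℝ) + a + 1) * (1 / 2 - 1 / r)) (hF : IsRegularDatum a F)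
    (hum : StronglyMeasurable u) (hu : Integrable u (halfSpaceMeasure d a))
    (hu2 : MemLp u 2 (halfSpaceMeasure d a)) :
    ‖∫ p, F p * conj (schrodinger a p.2 u p.1) ∂(spaceTimeMeasure d a)‖ₑ
      ≤ ENNReal.ofReal (dualStrichartzConst d a q r) *
        mixedNorm a q.conjExponent r.conjExponent F * eLpNorm u 2 (halfSpaceMeasure d a) := by
  rw [hF.integral_mul_conj_schrodinger ha hum hu hu2]
  refine (enorm_integral_le_lintegral_enorm _).trans ?_
  simp_rw [enorm_mul, RCLike.enorm_conj]
  refine (lintegral_enorm_mul_le_eLpNorm_two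
    (stronglyMeasurable_dualFourier ha hF.stronglyMeasurable).aestronglyMeasurable
    (continuous_fourierBessel ha hu).aestronglyMeasurable).trans ?_
  exact mul_le_mul' (hF.eLpNorm_dualFourier_le ha hq hr hqr) (eLpNorm_fourierBessel_le ha hu)

lemma isRegularDatum_of_bounded {A : Set (BulkPoint d)} (hA : halfSpaceMeasure d a A < ∞)
    (hAm : MeasurableSet A) {M T : ℝ} (hF : StronglyMeasurable F) (hM : ∀ p, ‖F p‖ ≤ M)
    (hAF : ∀ p : BulkPoint d × ℝ, p.1 ∉ A → F p = 0) (hT : ∀ p : BulkPoint d × ℝ, T < |p.2| → F p = 0) :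
    IsRegularDatum a F := by
  have hM0 : 0 ≤ M := (norm_nonneg _).trans (hM 0)
  have hsm (t : ℝ) : StronglyMeasurable fun X => F (X, t) := hF.comp_measurable measurable_prodMk_right
  have hle (p : BulkPoint d × ℝ) : ‖F p‖ ≤ ‖A.indicator (fun _ => M) p.1‖ := by
    by_cases hp : p.1 ∈ A
    · rw [indicator_of_mem hp, Real.norm_of_nonneg hM0]
      exact hM p
    · rw [hAF p hp, norm_zero]
      exact norm_nonneg _
  have hc : MemLp (A.indicator fun _ => M) 2 (halfSpaceMeasure d a) :=
    memLp_indicator_const 2 hAm M (Or.inr hA.ne)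
  refine ⟨hF, fun t => ?_, fun t => ?_, ?_⟩
  · exact ((integrable_indicator_iff hAm).2 (integrableOn_const hA.ne)).mono
      (hsm t).aestronglyMeasurable (ae_of_all _ fun X => hle (X, t))
  · exact hc.mono (hsm t).aestronglyMeasurable (ae_of_all _ fun X => hle (X, t))
  · calc _ ≤ ∫⁻ t, (Icc (-T) T).indicator
          (fun _ => eLpNorm (A.indicator fun _ => M) 2 (halfSpaceMeasure d a)) t := by
          refine lintegral_mono fun t => ?_
          by_cases ht : t ∈ Icc (-T) T
          · rw [indicator_of_mem ht]
            exact eLpNorm_mono fun X => hle (X, t)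
          · have h0 : (fun X => F (X, t)) = 0 := by
              ext X
              refine hT (X, t) (lt_of_not_ge fun h => ht (abs_le.1 h))
            rw [h0, eLpNorm_zero]
            exact bot_le
      _ = eLpNorm (A.indicator fun _ => M) 2 (halfSpaceMeasure d a) * volume (Icc (-T) T) := by
          rw [lintegral_indicator_const measurableSet_Icc]
      _ < ∞ := ENNReal.mul_lt_top hc.2 measure_Icc_lt_top

lemma mixedNorm_mono {q r : ℝ} (hq : 0 < q) (hr : 0 < r) {F G : BulkPoint d × ℝ → ℂ}
    (h : ∀ p, ‖F p‖ₑ ≤ ‖G p‖ₑ) : mixedNorm a q r F ≤ mixedNorm a q r G := by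
  unfold mixedNorm
  gcongr with t X
  exact h (X, t)

lemma mixedNorm_congr {q r : ℝ} {F G : BulkPoint d × ℝ → ℂ}
    (h : F =ᵐ[spaceTimeMeasure d a] G) : mixedNorm a q r F = mixedNorm a q r G := by
  unfold mixedNorm
  congr 1
  have h1 : ∀ᵐ w : ℝ × BulkPoint d ∂(volume.prod (halfSpaceMeasure d a)), F w.swap = G w.swap :=
    Measure.measurePreserving_swap.quasiMeasurePreserving.ae h
  refine lintegral_congr_ae ?_
  filter_upwards [Measure.ae_ae_of_ae_prod h1] with t ht
  congr 1
  refine lintegral_congr_ae ?_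
  filter_upwards [ht] with X hX
  have : F (X, t) = G (X, t) := hX
  rw [this]

/-- The Strichartz pairing of a function of `L^{q'}_t L^{r'}_a` converges absolutely. The phase of
the propagator is absorbed in the function, which is first truncated. -/
lemma lintegral_enorm_mul_strichartz_le (ha : 0 ≤ a) {q r : ℝ} (hq : 2 < q) (hr : 2 < r)
    (hqr : 2 / q = ((d : ℝ) + a + 1) * (1 / 2 - 1 / r))
    (hF : AEStronglyMeasurable F (spaceTimeMeasure d a))
    (hum : StronglyMeasurable u) (hu : Integrable u (halfSpaceMeasure d a))
    (hu2 : MemLp u 2 (halfSpaceMeasure d a)) :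
    ∫⁻ p, ‖F p‖ₑ * ‖strichartz a u p‖ₑ ∂(spaceTimeMeasure d a)
      ≤ ENNReal.ofReal (dualStrichartzConst d a q r) *
        mixedNorm a q.conjExponent r.conjExponent F * eLpNorm u 2 (halfSpaceMeasure d a) := by
  have hq' : 0 < q.conjExponent := div_pos (by linarith) (by linarith)
  have hr' : 0 < r.conjExponent := div_pos (by linarith) (by linarith)
  obtain ⟨G, hGm, hFG⟩ := hF
  set v : BulkPoint d × ℝ → ℂ := fun p => schrodinger a p.2 u p.1 with hv
  have hvm : StronglyMeasurable v := by
    have := stronglyMeasurable_schrodinger ha (F := fun p : BulkPoint d × ℝ => u p.1)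
      (hum.comp_measurable measurable_fst) 1
    simpa only [one_mul] using this
  have hcongr : ∫⁻ p, ‖F p‖ₑ * ‖strichartz a u p‖ₑ ∂(spaceTimeMeasure d a)
      = ∫⁻ p, ‖G p‖ₑ * ‖v p‖ₑ ∂(spaceTimeMeasure d a) := by
    refine lintegral_congr_ae ?_
    filter_upwards [hFG, strichartz_ae_eq (a := a) u] with p h1 h2
    rw [h1, h2]
  rw [hcongr, mixedNorm_congr hFG]
  let A : ℕ → Set (BulkPoint d) := spanningSets (halfSpaceMeasure d a)
  -- Truncation in space, in time and in size makes the datum regular.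
  let E : ℕ → Set (BulkPoint d × ℝ) := fun n =>
    (A n ×ˢ Icc (-(n : ℝ)) n) ∩ {p | ‖G p‖ ≤ n}
  have hEm (n : ℕ) : MeasurableSet (E n) :=
    ((measurableSet_spanningSets _ n).prod measurableSet_Icc).inter
      (measurableSet_le hGm.norm.measurable measurable_const)
  have hEmono : Monotone E := fun m n hmn p hp => by
    have hmn' : (m : ℝ) ≤ n := by exact_mod_cast hmn
    exact ⟨⟨monotone_spanningSets _ hmn hp.1.1, by linarith [hp.1.2.1], by linarith [hp.1.2.2]⟩,
      (show ‖G p‖ ≤ m from hp.2).trans hmn'⟩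
  have hEunion : ⋃ n, E n = univ := by
    refine eq_univ_of_forall fun p => ?_
    have hp : p.1 ∈ ⋃ n, A n := by
      rw [iUnion_spanningSets]
      trivial
    obtain ⟨n₁, h1⟩ := mem_iUnion.1 hp
    obtain ⟨n₂, h2⟩ := exists_nat_ge |p.2|
    obtain ⟨n₃, h3⟩ := exists_nat_ge ‖G p‖
    have h4 := abs_le.1 h2
    refine mem_iUnion.2 ⟨n₁ + n₂ + n₃, ⟨monotone_spanningSets _ (by omega) h1, ?_, ?_⟩, ?_⟩
    · push_cast
      have : (0 : ℝ) ≤ n₁ := by positivity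
      have : (0 : ℝ) ≤ n₃ := by positivity
      linarith
    · push_cast
      have : (0 : ℝ) ≤ n₁ := by positivity
      have : (0 : ℝ) ≤ n₃ := by positivity
      linarith
    · change ‖G p‖ ≤ _
      push_cast
      have : (0 : ℝ) ≤ n₁ := by positivity
      have : (0 : ℝ) ≤ n₂ := by positivity
      linarith
  have hstep (n : ℕ) : ∫⁻ p in E n, ‖G p‖ₑ * ‖v p‖ₑ ∂(spaceTimeMeasure d a)
      ≤ ENNReal.ofReal (dualStrichartzConst d a q r) *
        mixedNorm a q.conjExponent r.conjExponent G * eLpNorm u 2 (halfSpaceMeasure d a) := by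
    -- Division by zero makes the phase vanish where `v` does.
    let H : BulkPoint d × ℝ → ℂ := (E n).indicator fun p => (‖G p‖ : ℂ) * (v p / (‖v p‖ : ℂ))
    have hphase (p : BulkPoint d × ℝ) : ‖v p / (‖v p‖ : ℂ)‖ ≤ 1 := by
      rw [norm_div, Complex.norm_real, norm_norm]
      exact div_self_le_one _
    have hHG (p : BulkPoint d × ℝ) : ‖H p‖ ≤ ‖G p‖ := by
      by_cases hp : p ∈ E n
      · simp only [H, indicator_of_mem hp]
        rw [norm_mul, Complex.norm_real, norm_norm]
        exact mul_le_of_le_one_right (norm_nonneg _) (hphase p)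
      · simp only [H, indicator_of_notMem hp, norm_zero]
        exact norm_nonneg _
    have hHm : StronglyMeasurable H := by
      have h1 : Measurable fun p => (‖G p‖ : ℂ) * (v p / (‖v p‖ : ℂ)) := by
        have := hGm.measurable
        have := hvm.measurable
        fun_prop
      exact h1.stronglyMeasurable.indicator (hEm n)
    have hreg : IsRegularDatum a H := by
      refine isRegularDatum_of_bounded (A := A n) (M := n) (T := n)
        (measure_spanningSets_lt_top _ n) (measurableSet_spanningSets _ n) hHm (fun p => ?_)
        (fun p hp => indicator_of_notMem (fun h => hp h.1.1) _)
        (fun p hp => indicator_of_notMem (fun h => not_le.2 hp (abs_le.2 h.1.2)) _)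
      by_cases hp : p ∈ E n
      · exact (hHG p).trans hp.2
      · simp [H, indicator_of_notMem hp]
    have hprod (p : BulkPoint d × ℝ) : H p * conj (v p)
        = (((E n).indicator (fun p => ‖G p‖ * ‖v p‖) p : ℝ) : ℂ) := by
      by_cases hp : p ∈ E n
      · simp only [H, indicator_of_mem hp]
        rcases eq_or_ne (v p) 0 with h0 | h0
        · simp [h0]
        · have h1 : (‖v p‖ : ℂ) ≠ 0 := by simpa using h0
          rw [mul_assoc, div_mul_eq_mul_div, Complex.mul_conj', pow_two, mul_div_assoc,
            div_self h1, mul_one]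
          push_cast
          rfl
      · simp [H, indicator_of_notMem hp]
    have h1 := hreg.enorm_integral_mul_conj_schrodinger_le ha hq hr hqr hum hu hu2
    have h2 := hreg.integrable_mul_conj_schrodinger ha hum hu hu2
    simp_rw [show ∀ p, H p * conj (schrodinger a p.2 u p.1) = _ from hprod] at h1 h2
    have h3 : Integrable ((E n).indicator fun p => ‖G p‖ * ‖v p‖) (spaceTimeMeasure d a) := by
      have := h2.re
      simpa only [RCLike.re_to_complex, Complex.ofReal_re] using this
    have h4 : ∀ p, 0 ≤ (E n).indicator (fun p => ‖G p‖ * ‖v p‖) p := fun p =>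
      indicator_nonneg (fun _ _ => by positivity) p
    rw [integral_complex_ofReal, ← ofReal_norm, Complex.norm_real,
      Real.norm_of_nonneg (integral_nonneg h4),
      ofReal_integral_eq_lintegral_ofReal h3 (ae_of_all _ h4)] at h1
    have h5 : ∫⁻ p in E n, ‖G p‖ₑ * ‖v p‖ₑ ∂(spaceTimeMeasure d a)
        = ∫⁻ p, ENNReal.ofReal ((E n).indicator (fun p => ‖G p‖ * ‖v p‖) p)
          ∂(spaceTimeMeasure d a) := by
      rw [← lintegral_indicator (hEm n)]
      refine lintegral_congr fun p => ?_
      by_cases hp : p ∈ E n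
      · rw [indicator_of_mem hp, indicator_of_mem hp, ENNReal.ofReal_mul (norm_nonneg _),
          ofReal_norm, ofReal_norm]
      · rw [indicator_of_notMem hp, indicator_of_notMem hp, ENNReal.ofReal_zero]
    rw [h5]
    refine h1.trans ?_
    gcongr
    refine mixedNorm_mono hq' hr' fun p => ?_
    rw [← ofReal_norm, ← ofReal_norm]
    exact ENNReal.ofReal_le_ofReal (hHG p)
  have hlim := setLIntegral_iUnion_of_directed (μ := spaceTimeMeasure d a)
    (fun p => ‖G p‖ₑ * ‖v p‖ₑ) hEmono.directed_le
  rw [hEunion, setLIntegral_univ] at hlim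
  rw [hlim]
  exact iSup_le hstep

end DualFourier

/-! ### Existence and uniqueness of the dual operator -/

section TemperateGrowth

variable {d : ℕ} {a : ℝ}

lemma hasTemperateGrowth_prod {E F : Type*} [NormedAddCommGroup E] [NormedAddCommGroup F]
    [MeasurableSpace E] [MeasurableSpace F] [OpensMeasurableSpace E] [OpensMeasurableSpace F]
    [SecondCountableTopology E] [SecondCountableTopology F]
    {μ : Measure E} {ν : Measure F} [SFinite μ] [SFinite ν] (hμ : μ.HasTemperateGrowth)
    (hν : ν.HasTemperateGrowth) : (μ.prod ν).HasTemperateGrowth := by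
  obtain ⟨m, hm⟩ := hμ.exists_integrable
  obtain ⟨n, hn⟩ := hν.exists_integrable
  have hpow (r : ℝ) (hr : 0 ≤ r) (k : ℕ) : (1 + r) ^ (-(k : ℝ)) = ((1 + r) ^ k)⁻¹ := by
    rw [Real.rpow_neg (by positivity), Real.rpow_natCast]
  simp only [hpow _ (norm_nonneg _)] at hm hn
  refine ⟨m + n, (hm.mul_prod hn).mono' ?_ (ae_of_all _ fun p => ?_)⟩
  · have h : Measurable fun p : E × F => (1 + ‖p‖) ^ (-((m + n : ℕ) : ℝ)) :=
      (measurable_const.add measurable_norm).pow_const _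
    exact h.aestronglyMeasurable
  · rw [Real.norm_of_nonneg (by positivity), hpow _ (norm_nonneg _), ← mul_inv, pow_add]
    have h1 : ‖p.1‖ ≤ ‖p‖ := norm_fst_le p
    have h2 : ‖p.2‖ ≤ ‖p‖ := norm_snd_le p
    gcongr

lemma hasTemperateGrowth_halfLineMeasure (ha : 0 ≤ a) : (halfLineMeasure a).HasTemperateGrowth := by
  obtain ⟨n, hn⟩ := exists_nat_ge a
  refine ⟨n + 2, integrable_halfLine_iff.2 ?_⟩
  have h : Integrable (fun z : ℝ => (1 + ‖z‖) ^ (-2 : ℝ)) :=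
    integrable_one_add_norm (by simp)
  have hm : Measurable fun z : ℝ => z ^ a • (1 + ‖z‖) ^ (-((n + 2 : ℕ) : ℝ)) := by fun_prop
  refine h.integrableOn.mono' hm.aestronglyMeasurable ?_
  filter_upwards [ae_restrict_mem measurableSet_Ioi] with z hz
  have hz' : 0 < z := hz
  have h1 : 1 ≤ 1 + ‖z‖ := by simp
  have h2 : z ^ a ≤ (1 + ‖z‖) ^ a :=
    Real.rpow_le_rpow hz'.le (by rw [Real.norm_of_nonneg hz'.le]; linarith) ha
  rw [smul_eq_mul, Real.norm_of_nonneg (by positivity)]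
  calc _ ≤ (1 + ‖z‖) ^ a * (1 + ‖z‖) ^ (-((n + 2 : ℕ) : ℝ)) := by gcongr
    _ = (1 + ‖z‖) ^ (a + -((n + 2 : ℕ) : ℝ)) := (Real.rpow_add (by positivity) _ _).symm
    _ ≤ _ := Real.rpow_le_rpow_of_exponent_le h1 (by push_cast; linarith)

lemma hasTemperateGrowth_halfSpaceMeasure (d : ℕ) (ha : 0 ≤ a) :
    (halfSpaceMeasure d a).HasTemperateGrowth :=
  hasTemperateGrowth_prod inferInstance (hasTemperateGrowth_halfLineMeasure ha)

lemma isFiniteMeasureOnCompacts_halfSpaceMeasure (d : ℕ) (ha : 0 ≤ a) :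
    IsFiniteMeasureOnCompacts (halfSpaceMeasure d a) := by
  obtain ⟨n, hn⟩ := (hasTemperateGrowth_halfSpaceMeasure d ha).exists_integrable
  refine ⟨fun K hK => ?_⟩
  obtain ⟨R, hR⟩ := hK.isBounded.exists_norm_le
  have hR0 : 0 ≤ max R 0 := le_max_right _ _
  refine lt_of_le_of_lt (measure_mono ?_)
    (hn.measure_norm_ge_lt_top (ε := (1 + max R 0) ^ (-(n : ℝ))) (by positivity))
  intro X hX
  have h1 : ‖X‖ ≤ max R 0 := (hR X hX).trans (le_max_left _ _)
  have h2 : (1 + max R 0) ^ (-(n : ℝ)) ≤ (1 + ‖X‖) ^ (-(n : ℝ)) :=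
    Real.rpow_le_rpow_of_nonpos (by positivity) (by linarith) (by simp)
  exact h2.trans (le_abs_self _)

lemma integrable_schwartz (ha : 0 ≤ a) (u : 𝓢(BulkPoint d, ℂ)) :
    Integrable u (halfSpaceMeasure d a) := by
  have := hasTemperateGrowth_halfSpaceMeasure d ha
  exact u.integrable

lemma memLp_schwartz (ha : 0 ≤ a) (u : 𝓢(BulkPoint d, ℂ)) (p : ℝ≥0∞) :
    MemLp u p (halfSpaceMeasure d a) := by
  have := hasTemperateGrowth_halfSpaceMeasure d ha
  exact u.memLp p _

end TemperateGrowth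

section Duality

variable {d : ℕ} {a : ℝ} {F : BulkPoint d × ℝ → ℂ}

lemma aestronglyMeasurable_strichartz (ha : 0 ≤ a) (u : 𝓢(BulkPoint d, ℂ)) :
    AEStronglyMeasurable (strichartz a u) (spaceTimeMeasure d a) := by
  have h := stronglyMeasurable_schrodinger ha (F := fun p : BulkPoint d × ℝ => u p.1)
    (u.continuous.stronglyMeasurable.comp_measurable measurable_fst) 1
  simp only [one_mul] at h
  exact h.aestronglyMeasurable.congr (strichartz_ae_eq (a := a) u).symm

lemma strichartz_add_ae (ha : 0 ≤ a) (u v : 𝓢(BulkPoint d, ℂ)) :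
    ∀ᵐ p ∂(spaceTimeMeasure d a), strichartz a (u + v) p = strichartz a u p + strichartz a v p := by
  have h : ∀ᵐ p ∂(spaceTimeMeasure d a), p.2 ≠ 0 :=
    Measure.quasiMeasurePreserving_snd.ae (Measure.ae_ne volume 0)
  filter_upwards [h, strichartz_ae_eq (a := a) u, strichartz_ae_eq (a := a) v,
    strichartz_ae_eq (a := a) (u + v)] with p hp h1 h2 h3
  rw [h1, h2, h3]
  exact schrodinger_add ha hp (integrable_schwartz ha u) (integrable_schwartz ha v) p.1

lemma strichartz_smul_ae (c : ℂ) (u : 𝓢(BulkPoint d, ℂ)) :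
    ∀ᵐ p ∂(spaceTimeMeasure d a), strichartz a (c • u) p = c * strichartz a u p := by
  filter_upwards [strichartz_ae_eq (a := a) u, strichartz_ae_eq (a := a) (c • u)] with p h1 h2
  rw [h1, h2]
  exact schrodinger_smul c p.2 p.1

lemma IsDualStrichartz.eq (ha : 0 ≤ a) {g h : Lp ℂ 2 (halfSpaceMeasure d a)}
    (hg : IsDualStrichartz a F g) (hh : IsDualStrichartz a F h) : g = h := by
  have := hasTemperateGrowth_halfSpaceMeasure d ha
  have := isFiniteMeasureOnCompacts_halfSpaceMeasure d ha
  have hd := SchwartzMap.denseRange_toLpCLM (E := BulkPoint d) (F := ℂ) (p := 2)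
    (μ := halfSpaceMeasure d a) (by norm_num)
  have key (f : Lp ℂ 2 (halfSpaceMeasure d a)) (u : 𝓢(BulkPoint d, ℂ)) :
      inner ℂ (u.toLp 2 (halfSpaceMeasure d a)) f
        = ∫ X, f X * conj (u X) ∂(halfSpaceMeasure d a) := by
    rw [L2.inner_def]
    refine integral_congr_ae ?_
    filter_upwards [u.coeFn_toLp 2 (halfSpaceMeasure d a)] with X hX
    rw [hX, RCLike.inner_apply]
  refine hd.eq_of_inner_left (𝕜 := ℂ) ?_
  intro u
  have h1 : inner ℂ (u.toLp 2 (halfSpaceMeasure d a)) g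
      = inner ℂ (u.toLp 2 (halfSpaceMeasure d a)) h := by
    rw [key, key, (hg u).2, (hh u).2]
  rw [← inner_conj_symm, ← inner_conj_symm h]
  exact congrArg conj h1

/-- Riesz representation: an absolutely convergent Strichartz pairing that is bounded in `L²` is given
by an element of `L²`. -/
lemma exists_isDualStrichartz (ha : 0 ≤ a) (hF : AEStronglyMeasurable F (spaceTimeMeasure d a))
    {K : ℝ} (hK0 : 0 ≤ K)
    (hK : ∀ u : 𝓢(BulkPoint d, ℂ), ∫⁻ p, ‖F p‖ₑ * ‖strichartz a u p‖ₑ ∂(spaceTimeMeasure d a)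
      ≤ ENNReal.ofReal K * eLpNorm u 2 (halfSpaceMeasure d a)) :
    ∃ g, IsDualStrichartz a F g ∧ ‖g‖ ≤ K := by
  have := hasTemperateGrowth_halfSpaceMeasure d ha
  have := isFiniteMeasureOnCompacts_halfSpaceMeasure d ha
  have hd := SchwartzMap.denseRange_toLpCLM (E := BulkPoint d) (F := ℂ) (p := 2)
    (μ := halfSpaceMeasure d a) (by norm_num)
  have hint (u : 𝓢(BulkPoint d, ℂ)) :
      Integrable (fun p => conj (F p) * strichartz a u p) (spaceTimeMeasure d a) := by
    refine ⟨(Complex.continuous_conj.comp_aestronglyMeasurable hF).mul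
      (aestronglyMeasurable_strichartz ha u), ?_⟩
    rw [HasFiniteIntegral]
    simp_rw [enorm_mul, RCLike.enorm_conj]
    exact (hK u).trans_lt (ENNReal.mul_lt_top ENNReal.ofReal_lt_top (memLp_schwartz ha u 2).2)
  let ℓ : 𝓢(BulkPoint d, ℂ) →ₗ[ℂ] ℂ :=
    { toFun := fun u => ∫ p, conj (F p) * strichartz a u p ∂(spaceTimeMeasure d a)
      map_add' := fun u v => by
        rw [← integral_add (hint u) (hint v)]
        refine integral_congr_ae ?_
        filter_upwards [strichartz_add_ae ha u v] with p hp
        rw [show strichartz a (⇑(u + v)) p = _ from hp]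
        ring
      map_smul' := fun c u => by
        rw [RingHom.id_apply, smul_eq_mul, ← integral_const_mul]
        refine integral_congr_ae ?_
        filter_upwards [strichartz_smul_ae (a := a) c u] with p hp
        rw [show strichartz a (⇑(c • u)) p = _ from hp]
        ring }
  let e : 𝓢(BulkPoint d, ℂ) →ₗ[ℂ] Lp ℂ 2 (halfSpaceMeasure d a) :=
    (SchwartzMap.toLpCLM ℂ ℂ 2 (halfSpaceMeasure d a)).toLinearMap
  have hbound (u : 𝓢(BulkPoint d, ℂ)) : ‖ℓ u‖ ≤ K * ‖e u‖ := by
    have h1 : ‖ℓ u‖ₑ ≤ ENNReal.ofReal K * eLpNorm u 2 (halfSpaceMeasure d a) := by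
      refine (enorm_integral_le_lintegral_enorm _).trans ?_
      simp_rw [enorm_mul, RCLike.enorm_conj]
      exact hK u
    have h2 : ‖e u‖ = (eLpNorm u 2 (halfSpaceMeasure d a)).toReal := SchwartzMap.norm_toLp
    have h3 := ENNReal.toReal_mono
      (ENNReal.mul_ne_top ENNReal.ofReal_ne_top (memLp_schwartz ha u 2).2.ne) h1
    rwa [toReal_enorm, ENNReal.toReal_mul, ENNReal.toReal_ofReal hK0, ← h2] at h3
  have hd' : DenseRange e := hd
  let L : Lp ℂ 2 (halfSpaceMeasure d a) →L[ℂ] ℂ := ℓ.extendOfNorm e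
  have hL (u : 𝓢(BulkPoint d, ℂ)) : L (e u) = ℓ u := LinearMap.extendOfNorm_eq hd' ⟨K, hbound⟩ u
  let g := (InnerProductSpace.toDual ℂ (Lp ℂ 2 (halfSpaceMeasure d a))).symm L
  refine ⟨g, fun u => ?_, ?_⟩
  · have hconj : ∀ p, F p * conj (strichartz a u p) = conj (conj (F p) * strichartz a u p) :=
      fun p => by simp
    constructor
    · have := (Complex.conjCLE : ℂ →L[ℝ] ℂ).integrable_comp (hint u)
      refine this.congr (ae_of_all _ fun p => ?_)
      simp
    · simp_rw [hconj]
      rw [integral_conj]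
      have h1 : ∫ p, conj (F p) * strichartz a u p ∂(spaceTimeMeasure d a) = inner ℂ g (e u) := by
        rw [InnerProductSpace.toDual_symm_apply, hL]
        rfl
      rw [h1, L2.inner_def, ← integral_conj]
      refine integral_congr_ae ?_
      filter_upwards [u.coeFn_toLp 2 (halfSpaceMeasure d a)] with X hX
      have hX' : (e u : BulkPoint d → ℂ) X = u X := hX
      rw [hX', RCLike.inner_apply]
      simp [mul_comm]
  · rw [LinearIsometryEquiv.norm_map]
    exact LinearMap.opNorm_extendOfNorm_le hd' hK0 hbound

lemma isDualStrichartz_dualStrichartz {g : Lp ℂ 2 (halfSpaceMeasure d a)}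
    (hg : IsDualStrichartz a F g) : IsDualStrichartz a F (dualStrichartz a F) :=
  Classical.epsilon_spec (p := fun g => IsDualStrichartz a F g) ⟨g, hg⟩

lemma dualStrichartz_eq (ha : 0 ≤ a) {g : Lp ℂ 2 (halfSpaceMeasure d a)}
    (hg : IsDualStrichartz a F g) : dualStrichartz a F = g :=
  (isDualStrichartz_dualStrichartz hg).eq ha hg

/-- The dual Strichartz inequality. -/
theorem dualStrichartz_of_memMixed (ha : 0 ≤ a) {q r : ℝ} (hq : 2 < q) (hr : 2 < r)
    (hqr : 2 / q = ((d : ℝ) + a + 1) * (1 / 2 - 1 / r))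
    (hF : MemMixed a q.conjExponent r.conjExponent F) :
    (∃! g, IsDualStrichartz a F g) ∧
      ‖dualStrichartz a F‖ₑ ≤ ENNReal.ofReal (dualStrichartzConst d a q r) *
        mixedNorm a q.conjExponent r.conjExponent F := by
  have hC := dualStrichartzConst_pos (d := d) ha hq hr
  obtain ⟨g, hg, hgK⟩ := exists_isDualStrichartz ha hF.1
    (K := dualStrichartzConst d a q r * (mixedNorm a q.conjExponent r.conjExponent F).toReal)
    (by positivity) (fun u => by
      rw [ENNReal.ofReal_mul hC.le, ENNReal.ofReal_toReal hF.2.ne]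
      exact lintegral_enorm_mul_strichartz_le ha hq hr hqr hF.1 u.continuous.stronglyMeasurable
        (integrable_schwartz ha u) (memLp_schwartz ha u 2))
  refine ⟨⟨g, hg, fun h hh => hh.eq ha hg⟩, ?_⟩
  rw [dualStrichartz_eq ha hg, ← ofReal_norm]
  refine (ENNReal.ofReal_le_ofReal hgK).trans ?_
  rw [ENNReal.ofReal_mul hC.le, ENNReal.ofReal_toReal hF.2.ne]

end Duality

/-! ### The integral formula for the dual operator -/

section Formula

variable {d : ℕ} {a : ℝ} {F : BulkPoint d × ℝ → ℂ}

/-- The integrand `S(-t) F(·, t)` of the formula for the dual operator. -/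
noncomputable def dualIntegrand (a : ℝ) (F : BulkPoint d × ℝ → ℂ) (p : BulkPoint d × ℝ) : ℂ :=
  schrodinger a (-p.2) (fun Y => F (Y, p.2)) p.1

/-- The time integral of `S(-t) F(·, t)`. -/
noncomputable def dualIntegral (a : ℝ) (F : BulkPoint d × ℝ → ℂ) (X : BulkPoint d) : ℂ :=
  ∫ t, dualIntegrand a F (X, t)

lemma stronglyMeasurable_dualIntegrand (ha : 0 ≤ a) (hF : StronglyMeasurable F) :
    StronglyMeasurable (dualIntegrand a F) := by
  have := stronglyMeasurable_schrodinger ha hF (-1)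
  simp only [neg_one_mul] at this
  exact this

lemma IsRegularDatum.lintegral_dualIntegrand_lt_top (ha : 0 ≤ a) (hF : IsRegularDatum a F) :
    ∫⁻ t, eLpNorm (fun X => dualIntegrand a F (X, t)) 2 (halfSpaceMeasure d a) < ∞ := by
  have h (t : ℝ) (ht : t ≠ 0) :
      eLpNorm (fun X => dualIntegrand a F (X, t)) 2 (halfSpaceMeasure d a)
        ≤ eLpNorm (fun X => F (X, t)) 2 (halfSpaceMeasure d a) := by
    have h1 := eLpNorm_schrodinger_le ha (neg_ne_zero.2 ht) (hF.integrable_slice t)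
      (hF.memLp_slice t)
    exact h1
  refine lt_of_le_of_lt (lintegral_mono_ae ?_) hF.lintegral_lt_top
  filter_upwards [Measure.ae_ne volume 0] with t ht
  exact h t ht

lemma IsRegularDatum.ae_integrable_dualIntegrand (ha : 0 ≤ a) (hF : IsRegularDatum a F) :
    ∀ᵐ X ∂(halfSpaceMeasure d a), Integrable fun t => dualIntegrand a F (X, t) := by
  have hP := stronglyMeasurable_dualIntegrand ha hF.stronglyMeasurable
  let K : ℕ → Set (BulkPoint d) := spanningSets (halfSpaceMeasure d a)
  have h1 (n : ℕ) : ∀ᵐ X ∂(halfSpaceMeasure d a),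
      Integrable fun t => dualIntegrand a F (X, t) * conj ((K n).indicator (fun _ => (1 : ℂ)) X) := by
    have hK : MeasurableSet (K n) := measurableSet_spanningSets _ n
    have hi : StronglyMeasurable ((K n).indicator fun _ => (1 : ℂ)) :=
      stronglyMeasurable_const.indicator hK
    have h2 := integrable_mul_conj_prod (μ := halfSpaceMeasure d a) (τ := volume)
      (H := fun p => (K n).indicator (fun _ => (1 : ℂ)) p.1) hP
      (hi.comp_measurable measurable_fst) (by
        simp only
        rw [lintegral_mul_const _ (measurable_eLpNorm_two_slice hP)]
        exact ENNReal.mul_lt_top (hF.lintegral_dualIntegrand_lt_top ha)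
          (memLp_indicator_const 2 hK (1 : ℂ) (Or.inr (measure_spanningSets_lt_top _ n).ne)).2)
    exact h2.prod_right_ae
  filter_upwards [ae_all_iff.2 h1] with X hX
  have hXK : X ∈ ⋃ n, K n := by
    rw [iUnion_spanningSets]
    trivial
  obtain ⟨n, hn⟩ := mem_iUnion.1 hXK
  have := hX n
  rw [indicator_of_mem hn] at this
  simpa using this

lemma IsRegularDatum.memLp_dualIntegral (ha : 0 ≤ a) (hF : IsRegularDatum a F) :
    MemLp (dualIntegral a F) 2 (halfSpaceMeasure d a) := by
  have hP := stronglyMeasurable_dualIntegrand ha hF.stronglyMeasurable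
  have hfin := hF.lintegral_dualIntegrand_lt_top ha
  refine ⟨hP.integral_prod_right'.aestronglyMeasurable, ?_⟩
  have h1 := eLpNorm_two_sq_integral_le (μ := halfSpaceMeasure d a) (τ := volume) hP hfin
  have hslice (t : ℝ) : AEStronglyMeasurable (fun X => dualIntegrand a F (X, t))
      (halfSpaceMeasure d a) :=
    (hP.comp_measurable measurable_prodMk_right).aestronglyMeasurable
  have hm := measurable_eLpNorm_two_slice (μ := halfSpaceMeasure d a) hP
  have h2 : eLpNorm (dualIntegral a F) 2 (halfSpaceMeasure d a) ^ 2 < ∞ := by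
    refine h1.trans_lt ?_
    calc _ ≤ ∫⁻ s, ∫⁻ t, eLpNorm (fun X => dualIntegrand a F (X, t)) 2 (halfSpaceMeasure d a) *
          eLpNorm (fun X => dualIntegrand a F (X, s)) 2 (halfSpaceMeasure d a) := by
          gcongr with s t
          refine (enorm_integral_le_lintegral_enorm _).trans ?_
          simp_rw [enorm_mul, RCLike.enorm_conj]
          exact lintegral_enorm_mul_le_eLpNorm_two (hslice t) (hslice s)
      _ = _ := by
          rw [lintegral_congr fun s => lintegral_mul_const _ hm, lintegral_const_mul _ hm]
      _ < ∞ := ENNReal.mul_lt_top hfin hfin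
  exact (ENNReal.pow_lt_top_iff.1 h2).resolve_right two_ne_zero

/-- For regular data the dual operator is given by the time integral of `S(-t) F(·, t)`. -/
lemma IsRegularDatum.isDualStrichartz (ha : 0 ≤ a) (hF : IsRegularDatum a F) :
    IsDualStrichartz a F (hF.memLp_dualIntegral ha).toLp := by
  intro u
  have hu := integrable_schwartz ha u
  have hu2 := memLp_schwartz ha u 2
  have hum : StronglyMeasurable u := u.continuous.stronglyMeasurable
  have hae : (fun p => F p * conj (strichartz a u p)) =ᵐ[spaceTimeMeasure d a]
      fun p => F p * conj (schrodinger a p.2 u p.1) := by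
    filter_upwards [strichartz_ae_eq (a := a) u] with p hp
    rw [hp]
  refine ⟨(hF.integrable_mul_conj_schrodinger ha hum hu hu2).congr hae.symm, ?_⟩
  rw [integral_congr_ae hae, hF.integral_mul_conj_schrodinger ha hum hu hu2]
  have h1 := integral_integral_mul_conj (μ := halfSpaceMeasure d a) (τ := volume)
    (stronglyMeasurable_dualFourierIntegrand ha hF.stronglyMeasurable)
    (hF.lintegral_dualFourierIntegrand_lt_top ha)
    (v := fourierBessel a u) (continuous_fourierBessel ha hu).stronglyMeasurable
    (memLp_fourierBessel ha hu hu2)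
  have h2 := integral_integral_mul_conj (μ := halfSpaceMeasure d a) (τ := volume)
    (stronglyMeasurable_dualIntegrand ha hF.stronglyMeasurable)
    (hF.lintegral_dualIntegrand_lt_top ha) hum hu2
  unfold dualFourier
  rw [h1]
  have h3 : ∫ X, (MemLp.toLp (dualIntegral a F) (hF.memLp_dualIntegral ha)) X * conj (u X) ∂(halfSpaceMeasure d a)
      = ∫ X, (∫ t, dualIntegrand a F (X, t)) * conj (u X) ∂(halfSpaceMeasure d a) := by
    refine integral_congr_ae ?_
    filter_upwards [(hF.memLp_dualIntegral ha).coeFn_toLp] with X hX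
    rw [hX, dualIntegral]
  rw [h3, h2]
  refine integral_congr_ae ?_
  filter_upwards [Measure.ae_ne volume 0] with t ht
  have key := integral_exp_mul_fourierBessel_eq ha (neg_ne_zero.2 ht) (hF.integrable_slice t)
    (hF.memLp_slice t) hu hu2
  refine key.symm.trans (integral_congr_ae (ae_of_all _ fun Ξ => ?_))
  simp only [dualFourierIntegrand]
  rw [show -(Complex.I * ((-t : ℝ) : ℂ)) = Complex.I * t by push_cast; ring]
  ring

lemma IsRegularDatum.ae_dualStrichartz (ha : 0 ≤ a) (hF : IsRegularDatum a F) :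
    ∀ᵐ X ∂(halfSpaceMeasure d a),
      Integrable (fun t : ℝ => propagator a (-t) (fun Y => F (Y, t)) X) ∧
      dualStrichartz a F X = ∫ t : ℝ, propagator a (-t) (fun Y => F (Y, t)) X := by
  rw [dualStrichartz_eq ha (hF.isDualStrichartz ha)]
  filter_upwards [ae_halfSpace_pos d a, hF.ae_integrable_dualIntegrand ha,
    (hF.memLp_dualIntegral ha).coeFn_toLp] with X hX hi hg
  have hae : (fun t : ℝ => propagator a (-t) (fun Y => F (Y, t)) X)
      =ᵐ[volume] fun t => dualIntegrand a F (X, t) := by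
    filter_upwards [Measure.ae_ne volume 0] with t ht
    exact propagator_eq_schrodinger (neg_ne_zero.2 ht) _ hX
  exact ⟨hi.congr hae.symm, by rw [hg, dualIntegral, integral_congr_ae hae]⟩

/-- When the Fourier-Bessel side is bounded, continuous and integrable, it has the norm of the dual
operator: the inverse transform is again a Fourier-Bessel transform, up to conjugations. -/
lemma IsRegularDatum.enorm_dualStrichartz (ha : 0 ≤ a) (hF : IsRegularDatum a F) {M : ℝ}
    (hc : Continuous (dualFourier a F)) (hi : Integrable (dualFourier a F) (halfSpaceMeasure d a))
    (hM : ∀ Ξ, ‖dualFourier a F Ξ‖ ≤ M) :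
    ‖dualStrichartz a F‖ₑ = eLpNorm (dualFourier a F) 2 (halfSpaceMeasure d a) := by
  set v : BulkPoint d → ℂ := fun Ξ => conj (dualFourier a F Ξ) with hv
  have hvc : Continuous v := Complex.continuous_conj.comp hc
  have hvi : Integrable v (halfSpaceMeasure d a) :=
    hi.mono hvc.aestronglyMeasurable (ae_of_all _ fun Ξ => by simp [hv])
  have hvM : ∀ Ξ, ‖v Ξ‖ ≤ M := fun Ξ => by
    rw [hv, RCLike.norm_conj]
    exact hM Ξ
  have hvn : eLpNorm v 2 (halfSpaceMeasure d a)
      = eLpNorm (dualFourier a F) 2 (halfSpaceMeasure d a) :=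
    eLpNorm_congr_enorm_ae (ae_of_all _ fun Ξ => by rw [hv, RCLike.enorm_conj])
  have hpl := eLpNorm_fourierBessel_eq ha hvi (fun Ξ _ => hvM Ξ) (fun Ξ _ => hvc.continuousAt)
  set g : BulkPoint d → ℂ := fun X => conj (fourierBessel a v X) with hg
  have hgc : Continuous g := Complex.continuous_conj.comp (continuous_fourierBessel ha hvi)
  have hgn : eLpNorm g 2 (halfSpaceMeasure d a)
      = eLpNorm (fourierBessel a v) 2 (halfSpaceMeasure d a) :=
    eLpNorm_congr_enorm_ae (ae_of_all _ fun X => by rw [hg, RCLike.enorm_conj])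
  have hv2 : MemLp v 2 (halfSpaceMeasure d a) := by
    rw [memLp_two_iff_integrable_sq_norm hvc.aestronglyMeasurable]
    refine (hvi.norm.const_mul M).mono' (hvc.norm.pow 2).aestronglyMeasurable
      (ae_of_all _ fun Ξ => ?_)
    rw [Real.norm_of_nonneg (by positivity), pow_two]
    exact mul_le_mul_of_nonneg_right (hvM Ξ) (norm_nonneg _)
  have hgL : MemLp g 2 (halfSpaceMeasure d a) :=
    ⟨hgc.aestronglyMeasurable, by rw [hgn, hpl]; exact hv2.2⟩
  have hdual : IsDualStrichartz a F hgL.toLp := by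
    intro u
    obtain ⟨h1, h2⟩ := hF.isDualStrichartz ha u
    refine ⟨h1, ?_⟩
    have hu := integrable_schwartz ha u
    have hae : (fun p => F p * conj (strichartz a u p)) =ᵐ[spaceTimeMeasure d a]
        fun p => F p * conj (schrodinger a p.2 u p.1) := by
      filter_upwards [strichartz_ae_eq (a := a) u] with p hp
      rw [hp]
    rw [integral_congr_ae hae, hF.integral_mul_conj_schrodinger ha
      u.continuous.stronglyMeasurable hu (memLp_schwartz ha u 2)]
    have h3 : ∫ X, (MemLp.toLp g hgL) X * conj (u X) ∂(halfSpaceMeasure d a)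
        = ∫ X, ∫ Ξ, conj (fourierBesselKernel a Ξ X) * (dualFourier a F Ξ * conj (u X))
          ∂(halfSpaceMeasure d a) ∂(halfSpaceMeasure d a) := by
      refine integral_congr_ae ?_
      filter_upwards [hgL.coeFn_toLp] with X hX
      rw [hX, hg]
      simp only [fourierBessel]
      rw [← integral_conj, ← integral_mul_const]
      refine integral_congr_ae (ae_of_all _ fun Ξ => ?_)
      simp only [hv, map_mul, Complex.conj_conj]
      rw [fourierBesselKernel_comm]
      ring
    have hcu : Continuous fun X => conj (u X) := Complex.continuous_conj.comp u.continuous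
    have hprod : Integrable (Function.uncurry fun (X Ξ : BulkPoint d) =>
        conj (fourierBesselKernel a Ξ X) * (dualFourier a F Ξ * conj (u X)))
        ((halfSpaceMeasure d a).prod (halfSpaceMeasure d a)) := by
      have hcui : Integrable (fun X => conj (u X)) (halfSpaceMeasure d a) :=
        hu.mono hcu.aestronglyMeasurable (ae_of_all _ fun X => by simp)
      have h4 := hcui.mul_prod hi
      have h5 : Continuous fun p : BulkPoint d × BulkPoint d =>
          conj (fourierBesselKernel a p.2 p.1) := by
        have h6 : Continuous fun p : BulkPoint d × BulkPoint d => (p.2, p.1) := by fun_prop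
        have h7 := (continuous_fourierBesselKernel (d := d) ha).comp h6
        exact Complex.continuous_conj.comp h7
      have h8 := Integrable.bdd_mul (c := hankelBound a) h4 h5.aestronglyMeasurable
        (ae_of_all _ fun p => by
          rw [RCLike.norm_conj]
          exact norm_fourierBesselKernel_le ha _ _)
      refine h8.congr (ae_of_all _ fun p => ?_)
      simp only [Function.uncurry]
      ring
    rw [h3, integral_integral_swap hprod]
    refine integral_congr_ae (ae_of_all _ fun Ξ => ?_)
    simp only [fourierBessel]
    rw [← integral_conj, ← integral_const_mul]
    refine integral_congr_ae (ae_of_all _ fun X => ?_)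
    simp only [map_mul]
    ring
  rw [dualStrichartz_eq ha hdual, Lp.enorm_def, eLpNorm_congr_ae hgL.coeFn_toLp, hgn, hpl, hvn]

end Formula

/-! ### Schwartz functions and the restriction operator -/

section Schwartz

variable {d : ℕ} {a : ℝ}

lemma hasTemperateGrowth_spaceTimeMeasure (d : ℕ) (ha : 0 ≤ a) :
    (spaceTimeMeasure d a).HasTemperateGrowth :=
  hasTemperateGrowth_prod (hasTemperateGrowth_halfSpaceMeasure d ha) inferInstance

lemma integrable_schwartz_spaceTime (ha : 0 ≤ a) (U : 𝓢(BulkPoint d × ℝ, ℂ)) :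
    Integrable U (spaceTimeMeasure d a) := by
  have := hasTemperateGrowth_spaceTimeMeasure d ha
  exact U.integrable

lemma exists_schwartz_prod_bound {E F : Type*} [NormedAddCommGroup E] [NormedSpace ℝ E]
    [NormedAddCommGroup F] [NormedSpace ℝ F] (U : 𝓢(E × F, ℂ)) (m n : ℕ) :
    ∃ C : ℝ, 0 ≤ C ∧ ∀ x y, ‖U (x, y)‖
      ≤ C * ((1 + ‖x‖) ^ (-(m : ℝ)) * (1 + ‖y‖) ^ (-(n : ℝ))) := by
  refine ⟨2 ^ (m + n) * (Finset.Iic ((m + n, 0) : ℕ × ℕ)).sup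
    (fun k => SchwartzMap.seminorm ℝ k.1 k.2) U, by positivity, fun x y => ?_⟩
  have h := SchwartzMap.one_add_le_sup_seminorm_apply (𝕜 := ℝ) (m := (m + n, 0)) (k := m + n)
    (n := 0) le_rfl le_rfl U (x, y)
  rw [norm_iteratedFDeriv_zero] at h
  simp only at h
  have h1 : ‖x‖ ≤ ‖(x, y)‖ := norm_fst_le (x, y)
  have h2 : ‖y‖ ≤ ‖(x, y)‖ := norm_snd_le (x, y)
  rw [Real.rpow_neg (by positivity), Real.rpow_neg (by positivity), Real.rpow_natCast,
    Real.rpow_natCast, ← mul_inv, ← div_eq_mul_inv, le_div_iff₀ (by positivity), mul_comm]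
  refine le_trans ?_ h
  rw [pow_add]
  gcongr

lemma integrable_japanese_real : Integrable fun t : ℝ => (1 + ‖t‖) ^ (-((2 : ℕ) : ℝ)) :=
  integrable_one_add_norm (by simp)

lemma exists_schwartz_slice_bound (ha : 0 ≤ a) (U : 𝓢(BulkPoint d × ℝ, ℂ)) :
    ∃ w : BulkPoint d → ℝ, Integrable w (halfSpaceMeasure d a) ∧ MemLp w 2 (halfSpaceMeasure d a) ∧
      ∀ X t, ‖U (X, t)‖ ≤ w X * (1 + ‖t‖) ^ (-((2 : ℕ) : ℝ)) := by
  obtain ⟨n, hn⟩ := (hasTemperateGrowth_halfSpaceMeasure d ha).exists_integrable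
  obtain ⟨C, hC0, hC⟩ := exists_schwartz_prod_bound U n 2
  have hm : Measurable fun X : BulkPoint d => (1 + ‖X‖) ^ (-(n : ℝ)) :=
    (measurable_const.add measurable_norm).pow_const _
  have h2 : MemLp (fun X : BulkPoint d => (1 + ‖X‖) ^ (-(n : ℝ))) 2 (halfSpaceMeasure d a) := by
    rw [memLp_two_iff_integrable_sq_norm hm.aestronglyMeasurable]
    refine hn.mono' (hm.norm.pow_const 2).aestronglyMeasurable (ae_of_all _ fun X => ?_)
    have h3 : (1 + ‖X‖) ^ (-(n : ℝ)) ≤ 1 :=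
      Real.rpow_le_one_of_one_le_of_nonpos (by simp) (by simp)
    have h4 : 0 ≤ (1 + ‖X‖) ^ (-(n : ℝ)) := by positivity
    rw [norm_pow, norm_norm, Real.norm_of_nonneg h4, pow_two]
    exact mul_le_of_le_one_left h4 h3
  exact ⟨fun X => C * (1 + ‖X‖) ^ (-(n : ℝ)), hn.const_mul C, h2.const_mul C,
    fun X t => (hC X t).trans_eq (by ring)⟩

lemma isRegularDatum_schwartz (ha : 0 ≤ a) (U : 𝓢(BulkPoint d × ℝ, ℂ)) : IsRegularDatum a U := by
  obtain ⟨w, hw, hw2, hU⟩ := exists_schwartz_slice_bound ha U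
  have hc (t : ℝ) : Continuous fun X => U (X, t) := U.continuous.comp (by fun_prop)
  have hle (X : BulkPoint d) (t : ℝ) : ‖U (X, t)‖ ≤ ‖(1 + ‖t‖) ^ (-((2 : ℕ) : ℝ)) * w X‖ := by
    rw [mul_comm]
    exact (hU X t).trans (le_abs_self _)
  refine ⟨U.continuous.stronglyMeasurable, fun t => ?_, fun t => ?_, ?_⟩
  · exact (hw.const_mul _).mono (hc t).aestronglyMeasurable (ae_of_all _ fun X => hle X t)
  · exact (hw2.const_mul _).mono (hc t).aestronglyMeasurable (ae_of_all _ fun X => hle X t)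
  · calc _ ≤ ∫⁻ t : ℝ, ‖(1 + ‖t‖) ^ (-((2 : ℕ) : ℝ))‖ₑ * eLpNorm w 2 (halfSpaceMeasure d a) := by
          refine lintegral_mono fun t => ?_
          rw [← eLpNorm_const_smul]
          exact eLpNorm_mono fun X => hle X t
      _ = (∫⁻ t : ℝ, ‖(1 + ‖t‖) ^ (-((2 : ℕ) : ℝ))‖ₑ) * eLpNorm w 2 (halfSpaceMeasure d a) :=
          lintegral_mul_const' _ _ hw2.2.ne
      _ < ∞ := ENNReal.mul_lt_top integrable_japanese_real.2 hw2.2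

lemma integrable_schwartz_time (U : 𝓢(BulkPoint d × ℝ, ℂ)) (X : BulkPoint d) :
    Integrable fun t => U (X, t) := by
  obtain ⟨C, hC0, hC⟩ := exists_schwartz_prod_bound U 0 2
  have hc : Continuous fun t => U (X, t) := U.continuous.comp (by fun_prop)
  refine (integrable_japanese_real.const_mul C).mono' hc.aestronglyMeasurable
    (ae_of_all _ fun t => ?_)
  simpa using hC X t

/-- The time integral of `U (X, ·)` against the phase `exp (i t (4 π² |ξ|² + ζ²))`. -/
noncomputable def timeTransform (U : BulkPoint d × ℝ → ℂ) (Ξ X : BulkPoint d) : ℂ :=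
  ∫ t : ℝ, Complex.exp (Complex.I * t * (bulkSymbol Ξ : ℂ)) * U (X, t)

lemma norm_exp_I_mul_bulkSymbol (t : ℝ) (Ξ : BulkPoint d) :
    ‖Complex.exp (Complex.I * t * (bulkSymbol Ξ : ℂ))‖ = 1 := by
  rw [show Complex.I * t * (bulkSymbol Ξ : ℂ) = ((t * bulkSymbol Ξ : ℝ) : ℂ) * Complex.I by
    push_cast; ring, Complex.norm_exp_ofReal_mul_I]

lemma integrable_kernel_mul_schwartz (ha : 0 ≤ a) (U : 𝓢(BulkPoint d × ℝ, ℂ)) (Ξ : BulkPoint d) :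
    Integrable (fun p : BulkPoint d × ℝ => (Complex.exp (Complex.I * p.2 * (bulkSymbol Ξ : ℂ)) *
      fourierBesselKernel a Ξ p.1) * U p) (spaceTimeMeasure d a) := by
  have h1 : Continuous fun p : BulkPoint d × ℝ => fourierBesselKernel a Ξ p.1 := by
    have h2 : Continuous fun p : BulkPoint d × ℝ => (Ξ, p.1) := by fun_prop
    have h3 := (continuous_fourierBesselKernel (d := d) ha).comp h2
    exact h3
  have h4 : Continuous fun p : BulkPoint d × ℝ =>
      Complex.exp (Complex.I * p.2 * (bulkSymbol Ξ : ℂ)) * fourierBesselKernel a Ξ p.1 := by fun_prop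
  exact Integrable.bdd_mul (c := hankelBound a) (integrable_schwartz_spaceTime ha U)
    h4.aestronglyMeasurable (ae_of_all _ fun p => by
      rw [norm_mul, norm_exp_I_mul_bulkSymbol, one_mul]
      exact norm_fourierBesselKernel_le ha _ _)

lemma integrable_kernel_mul_timeTransform (ha : 0 ≤ a) (U : 𝓢(BulkPoint d × ℝ, ℂ))
    (Ξ : BulkPoint d) :
    Integrable (fun X => fourierBesselKernel a Ξ X * timeTransform U Ξ X)
      (halfSpaceMeasure d a) := by
  refine (integrable_kernel_mul_schwartz ha U Ξ).integral_prod_left.congr (ae_of_all _ fun X => ?_)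
  simp only [timeTransform]
  rw [← integral_const_mul]
  refine integral_congr_ae (ae_of_all _ fun t => ?_)
  simp only
  ring

lemma dualFourier_eq_integral_timeTransform (ha : 0 ≤ a) (U : 𝓢(BulkPoint d × ℝ, ℂ))
    (Ξ : BulkPoint d) :
    dualFourier a U Ξ
      = ∫ X, fourierBesselKernel a Ξ X * timeTransform U Ξ X ∂(halfSpaceMeasure d a) := by
  have hi := integrable_kernel_mul_schwartz ha U Ξ
  have h1 := integral_prod_symm _ hi
  have h2 := integral_prod _ hi
  have h3 : dualFourier a U Ξ = ∫ t : ℝ, ∫ X, (Complex.exp (Complex.I * t * (bulkSymbol Ξ : ℂ)) *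
      fourierBesselKernel a Ξ X) * U (X, t) ∂(halfSpaceMeasure d a) := by
    refine integral_congr_ae (ae_of_all _ fun t => ?_)
    simp only [dualFourierIntegrand, fourierBessel]
    rw [← integral_const_mul]
    refine integral_congr_ae (ae_of_all _ fun X => ?_)
    simp only
    ring
  rw [h3, ← h1, h2]
  refine integral_congr_ae (ae_of_all _ fun X => ?_)
  simp only [timeTransform]
  rw [← integral_const_mul]
  refine integral_congr_ae (ae_of_all _ fun t => ?_)
  simp only
  ring

/-- The derivative in time of a Schwartz function on space-time. -/
noncomputable def timeDeriv (U : 𝓢(BulkPoint d × ℝ, ℂ)) : 𝓢(BulkPoint d × ℝ, ℂ) :=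
  LineDeriv.lineDerivOp ((0, 1) : BulkPoint d × ℝ) U

lemma hasDerivAt_schwartz_time (U : 𝓢(BulkPoint d × ℝ, ℂ)) (X : BulkPoint d) (t : ℝ) :
    HasDerivAt (fun t => U (X, t)) (timeDeriv U (X, t)) t := by
  have h1 : HasFDerivAt U (fderiv ℝ U (X, t)) (X, t) := U.differentiableAt.hasFDerivAt
  have h2 : HasDerivAt (fun t : ℝ => (X, t)) ((0, 1) : BulkPoint d × ℝ) t :=
    (hasDerivAt_const t X).prodMk (hasDerivAt_id t)
  have h3 := h1.comp_hasDerivAt t h2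
  exact h3

/-- Integration by parts in time. -/
lemma timeTransform_timeDeriv (U : 𝓢(BulkPoint d × ℝ, ℂ)) (Ξ X : BulkPoint d) :
    timeTransform (timeDeriv U) Ξ X = -(Complex.I * (bulkSymbol Ξ : ℂ)) * timeTransform U Ξ X := by
  have hexp : Continuous fun t : ℝ => Complex.exp (Complex.I * t * (bulkSymbol Ξ : ℂ)) := by fun_prop
  have hi (V : 𝓢(BulkPoint d × ℝ, ℂ)) :
      Integrable fun t : ℝ => Complex.exp (Complex.I * t * (bulkSymbol Ξ : ℂ)) * V (X, t) :=
    Integrable.bdd_mul (c := 1) (integrable_schwartz_time V X) hexp.aestronglyMeasurable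
      (ae_of_all _ fun t => (norm_exp_I_mul_bulkSymbol t Ξ).le)
  have hd (t : ℝ) : HasDerivAt
      (fun t : ℝ => Complex.exp (Complex.I * t * (bulkSymbol Ξ : ℂ)) * U (X, t))
      (Complex.I * (bulkSymbol Ξ : ℂ) *
        (Complex.exp (Complex.I * t * (bulkSymbol Ξ : ℂ)) * U (X, t)) +
        Complex.exp (Complex.I * t * (bulkSymbol Ξ : ℂ)) * timeDeriv U (X, t)) t := by
    have h1 : HasDerivAt (fun t : ℝ => Complex.I * t * (bulkSymbol Ξ : ℂ))
        (Complex.I * (bulkSymbol Ξ : ℂ)) t := by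
      have := ((hasDerivAt_id t).ofReal_comp.const_mul Complex.I).mul_const (bulkSymbol Ξ : ℂ)
      simpa using this
    have h2 := h1.cexp.mul (hasDerivAt_schwartz_time U X t)
    refine h2.congr_deriv ?_
    ring
  have h0 := integral_eq_zero_of_hasDerivAt_of_integrable hd
    (((hi U).const_mul _).add (hi (timeDeriv U))) (hi U)
  rw [integral_add ((hi U).const_mul _) (hi (timeDeriv U)), integral_const_mul] at h0
  unfold timeTransform
  linear_combination h0

lemma dualFourier_timeDeriv (ha : 0 ≤ a) (U : 𝓢(BulkPoint d × ℝ, ℂ)) (Ξ : BulkPoint d) :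
    dualFourier a (timeDeriv U) Ξ = -(Complex.I * (bulkSymbol Ξ : ℂ)) * dualFourier a U Ξ := by
  rw [dualFourier_eq_integral_timeTransform ha, dualFourier_eq_integral_timeTransform ha,
    ← integral_const_mul]
  refine integral_congr_ae (ae_of_all _ fun X => ?_)
  simp only [timeTransform_timeDeriv]
  ring

lemma norm_dualFourierIntegrand_le (ha : 0 ≤ a) (U : 𝓢(BulkPoint d × ℝ, ℂ)) :
    ∃ C : ℝ, ∀ Ξ t, ‖dualFourierIntegrand a U (Ξ, t)‖ ≤ C * (1 + ‖t‖) ^ (-((2 : ℕ) : ℝ)) := by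
  obtain ⟨w, hw, -, hU⟩ := exists_schwartz_slice_bound ha U
  refine ⟨hankelBound a * ∫ X, w X ∂(halfSpaceMeasure d a), fun Ξ t => ?_⟩
  rw [dualFourierIntegrand, norm_mul, norm_exp_I_mul_bulkSymbol, one_mul]
  refine (norm_fourierBessel_le ha ((isRegularDatum_schwartz ha U).integrable_slice t) Ξ).trans ?_
  rw [mul_assoc, ← integral_mul_const]
  refine mul_le_mul_of_nonneg_left ?_ (hankelBound_pos ha).le
  exact integral_mono ((isRegularDatum_schwartz ha U).integrable_slice t).norm (hw.mul_const _)
    fun X => hU X t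

lemma exists_norm_dualFourier_le (ha : 0 ≤ a) (U : 𝓢(BulkPoint d × ℝ, ℂ)) :
    ∃ M : ℝ, ∀ Ξ, ‖dualFourier a U Ξ‖ ≤ M := by
  obtain ⟨C, hC⟩ := norm_dualFourierIntegrand_le ha U
  refine ⟨∫ t : ℝ, C * (1 + ‖t‖) ^ (-((2 : ℕ) : ℝ)), fun Ξ => ?_⟩
  exact norm_integral_le_of_norm_le (integrable_japanese_real.const_mul C)
    (ae_of_all _ fun t => hC Ξ t)

lemma continuous_dualFourier (ha : 0 ≤ a) (U : 𝓢(BulkPoint d × ℝ, ℂ)) :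
    Continuous (dualFourier a U) := by
  obtain ⟨C, hC⟩ := norm_dualFourierIntegrand_le ha U
  have hm := stronglyMeasurable_dualFourierIntegrand (a := a) ha U.continuous.stronglyMeasurable
  refine continuous_of_dominated
    (fun Ξ => (hm.comp_measurable measurable_prodMk_left).aestronglyMeasurable)
    (fun Ξ => ae_of_all _ fun t => hC Ξ t) (integrable_japanese_real.const_mul C)
    (ae_of_all _ fun t => ?_)
  have h1 := continuous_fourierBessel ha ((isRegularDatum_schwartz ha U).integrable_slice t)
  have h2 := continuous_bulkSymbol (d := d)
  have h3 : Continuous fun Ξ : BulkPoint d =>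
      Complex.exp (Complex.I * t * (bulkSymbol Ξ : ℂ)) := by fun_prop
  exact h3.mul h1

lemma exists_bulkSymbol_pow_mul_le (ha : 0 ≤ a) (n : ℕ) (U : 𝓢(BulkPoint d × ℝ, ℂ)) :
    ∃ M : ℝ, ∀ Ξ, bulkSymbol Ξ ^ n * ‖dualFourier a U Ξ‖ ≤ M := by
  induction n generalizing U with
  | zero => simpa using exists_norm_dualFourier_le ha U
  | succ n ih =>
    obtain ⟨M, hM⟩ := ih (timeDeriv U)
    refine ⟨M, fun Ξ => le_trans (le_of_eq ?_) (hM Ξ)⟩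
    rw [dualFourier_timeDeriv ha, norm_mul, norm_neg, norm_mul, Complex.norm_I, one_mul,
      Complex.norm_real, Real.norm_of_nonneg (bulkSymbol_nonneg Ξ)]
    ring

lemma norm_sq_le_bulkSymbol (Ξ : BulkPoint d) : ‖Ξ‖ ^ 2 ≤ bulkSymbol Ξ := by
  have hpi : 1 ≤ 4 * Real.pi ^ 2 := by nlinarith [Real.pi_gt_three]
  have h1 := sq_nonneg ‖Ξ.1‖
  have h2 := sq_nonneg Ξ.2
  unfold bulkSymbol
  rcases max_choice ‖Ξ.1‖ ‖Ξ.2‖ with h | h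
  · rw [Prod.norm_def, h]
    nlinarith
  · rw [Prod.norm_def, h, Real.norm_eq_abs, sq_abs]
    nlinarith

lemma integrable_dualFourier (ha : 0 ≤ a) (U : 𝓢(BulkPoint d × ℝ, ℂ)) :
    Integrable (dualFourier a U) (halfSpaceMeasure d a) := by
  obtain ⟨n, hn⟩ := (hasTemperateGrowth_halfSpaceMeasure d ha).exists_integrable
  obtain ⟨M₀, h0⟩ := exists_bulkSymbol_pow_mul_le ha 0 U
  obtain ⟨M, hM⟩ := exists_bulkSymbol_pow_mul_le ha n U
  refine (hn.const_mul (4 ^ n * (M₀ + M))).mono' (continuous_dualFourier ha U).aestronglyMeasurable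
    (ae_of_all _ fun Ξ => ?_)
  rw [Real.rpow_neg (by positivity), Real.rpow_natCast, ← div_eq_mul_inv,
    le_div_iff₀ (by positivity)]
  have hφ := bulkSymbol_nonneg Ξ
  have h1 : (1 + ‖Ξ‖) ^ n ≤ 4 ^ n * (1 + bulkSymbol Ξ ^ n) := by
    have h2 : 1 + ‖Ξ‖ ≤ 2 * (1 + bulkSymbol Ξ) := by
      nlinarith [norm_sq_le_bulkSymbol Ξ, sq_nonneg (‖Ξ‖ - 1), norm_nonneg Ξ]
    have h3 : 1 + bulkSymbol Ξ ≤ 2 * max 1 (bulkSymbol Ξ) := by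
      linarith [le_max_left 1 (bulkSymbol Ξ), le_max_right 1 (bulkSymbol Ξ)]
    have h4 : max 1 (bulkSymbol Ξ) ^ n ≤ 1 + bulkSymbol Ξ ^ n := by
      rcases max_choice 1 (bulkSymbol Ξ) with h | h <;> rw [h]
      · simpa using pow_nonneg hφ n
      · linarith
    calc (1 + ‖Ξ‖) ^ n ≤ (4 * max 1 (bulkSymbol Ξ)) ^ n := by
          gcongr
          linarith
      _ ≤ _ := by
          rw [mul_pow]
          gcongr
  calc ‖dualFourier a U Ξ‖ * (1 + ‖Ξ‖) ^ n
      ≤ ‖dualFourier a U Ξ‖ * (4 ^ n * (1 + bulkSymbol Ξ ^ n)) := by gcongr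
    _ = 4 ^ n * (bulkSymbol Ξ ^ 0 * ‖dualFourier a U Ξ‖ +
        bulkSymbol Ξ ^ n * ‖dualFourier a U Ξ‖) := by ring
    _ ≤ _ := by
        gcongr
        · exact h0 Ξ
        · exact hM Ξ

lemma hankel_eq_integral {ζ : ℝ} (hζ : 0 < ζ) (φ : ℝ → ℂ) :
    hankel ((a - 1) / 2) φ ζ = ∫ z, hankelKernel a ζ z * φ z ∂(halfLineMeasure a) := by
  rw [hankel, integral_halfLine, ← integral_const_mul]
  refine setIntegral_congr_fun measurableSet_Ioi fun z hz => ?_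
  have hz' : 0 < z := hz
  rw [besselJ_eq (mul_pos hζ hz'), hankelKernel, Complex.real_smul]
  have e1 : (a - 1) / 2 + 1 = (a + 1) / 2 := by ring
  have e2 : ζ ^ (-((a - 1) / 2)) * (ζ * z / 2) ^ ((a - 1) / 2) * z ^ ((a + 1) / 2)
      = z ^ a * 2 ^ ((1 - a) / 2) := by
    have h1 : z ^ a = z ^ ((a - 1) / 2) * z ^ ((a + 1) / 2) := by
      rw [← Real.rpow_add hz']
      ring_nf
    have h2 : (2 : ℝ) ^ ((1 - a) / 2) = (2 ^ ((a - 1) / 2))⁻¹ := by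
      rw [← Real.rpow_neg (by norm_num)]
      ring_nf
    rw [h1, h2, Real.div_rpow (by positivity) (by norm_num), Real.mul_rpow hζ.le hz'.le,
      Real.rpow_neg hζ.le]
    field_simp
  rw [e1]
  have e3 := congrArg (fun r : ℝ => (r : ℂ)) e2
  simp only [Complex.ofReal_mul] at e3
  linear_combination (φ z * besselEntire ((a + 1) / 2) ((-((ζ * z) ^ 2 / 4) : ℝ) : ℂ)) * e3

lemma paraboloidRestriction_eq (ha : 0 ≤ a) (U : 𝓢(BulkPoint d × ℝ, ℂ)) {Ξ : BulkPoint d}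
    (hΞ : 0 < Ξ.2) : paraboloidRestriction a U Ξ = dualFourier a U Ξ := by
  rw [paraboloidRestriction, fourierHankel, hankel_eq_integral hΞ,
    dualFourier_eq_integral_timeTransform ha]
  have hsw := integral_prod_symm _ (integrable_kernel_mul_timeTransform ha U Ξ)
  refine Eq.trans ?_ hsw.symm
  refine integral_congr_ae (ae_of_all _ fun z => ?_)
  simp only [fourierXT, fourierBesselKernel]
  have hUi : Integrable fun p : EuclideanSpace ℝ (Fin d) × ℝ => U ((p.1, z), p.2) := by
    have hg := integrable_one_add_norm (E := EuclideanSpace ℝ (Fin d)) (μ := volume)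
      (r := ((d + 1 : ℕ) : ℝ)) (by simp)
    obtain ⟨C, hC0, hC⟩ := exists_schwartz_prod_bound U (d + 1) 2
    have hc : Continuous fun p : EuclideanSpace ℝ (Fin d) × ℝ => U ((p.1, z), p.2) :=
      U.continuous.comp (by fun_prop)
    refine ((hg.mul_prod integrable_japanese_real).const_mul C).mono' hc.aestronglyMeasurable
      (ae_of_all _ fun p => (hC (p.1, z) p.2).trans ?_)
    have h1 : ‖p.1‖ ≤ ‖((p.1, z) : BulkPoint d)‖ := norm_fst_le (p.1, z)
    have h2 : (1 + ‖((p.1, z) : BulkPoint d)‖) ^ (-((d + 1 : ℕ) : ℝ))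
        ≤ (1 + ‖p.1‖) ^ (-((d + 1 : ℕ) : ℝ)) :=
      Real.rpow_le_rpow_of_nonpos (by positivity) (by linarith)
        (neg_nonpos.2 (Nat.cast_nonneg _))
    gcongr
  have hexp : Continuous fun p : EuclideanSpace ℝ (Fin d) × ℝ =>
      Complex.exp (-(2 * Real.pi * Complex.I * ((inner ℝ Ξ.1 p.1 +
        -((4 * Real.pi ^ 2 * ‖Ξ.1‖ ^ 2 + Ξ.2 ^ 2) / (2 * Real.pi)) * p.2 : ℝ) : ℂ))) := by
    fun_prop
  have hint := Integrable.bdd_mul (c := 1) hUi hexp.aestronglyMeasurable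
    (ae_of_all _ fun p => by
      rw [show ∀ r : ℝ, -(2 * Real.pi * Complex.I * (r : ℂ)) = ((-(2 * Real.pi * r) : ℝ) : ℂ) *
        Complex.I from fun r => by push_cast; ring, Complex.norm_exp_ofReal_mul_I])
  have hpr := integral_prod _ hint
  rw [Measure.volume_eq_prod, hpr, ← integral_const_mul]
  refine integral_congr_ae (ae_of_all _ fun x => ?_)
  simp only [timeTransform]
  rw [mul_assoc (Complex.exp (-(2 * Real.pi * Complex.I * (inner ℝ Ξ.1 x : ℝ)))),
    mul_left_comm (Complex.exp (-(2 * Real.pi * Complex.I * (inner ℝ Ξ.1 x : ℝ))))]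
  congr 1
  rw [← integral_const_mul]
  refine integral_congr_ae (ae_of_all _ fun t => ?_)
  simp only
  rw [← mul_assoc, ← Complex.exp_add]
  congr 2
  simp only [bulkSymbol]
  have hpi : (Real.pi : ℂ) ≠ 0 := by exact_mod_cast Real.pi_ne_zero
  push_cast
  field_simp
  ring

lemma paraboloidRestriction_ae_eq (ha : 0 ≤ a) (U : 𝓢(BulkPoint d × ℝ, ℂ)) :
    paraboloidRestriction a U =ᵐ[halfSpaceMeasure d a] dualFourier a U := by
  filter_upwards [ae_halfSpace_pos d a] with Ξ hΞ using paraboloidRestriction_eq ha U hΞ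

end Schwartz

/-! ### The diagonal exponents and the theorem -/

lemma mixedNorm_self {d : ℕ} {a p : ℝ} (hp : 0 < p) {F : BulkPoint d × ℝ → ℂ}
    (hF : AEStronglyMeasurable F (spaceTimeMeasure d a)) :
    mixedNorm a p p F = eLpNorm F (ENNReal.ofReal p) (spaceTimeMeasure d a) := by
  rw [eLpNorm_eq_lintegral_rpow_enorm_toReal (ENNReal.ofReal_pos.2 hp).ne' ENNReal.ofReal_ne_top,
    ENNReal.toReal_ofReal hp.le, mixedNorm, div_self hp.ne']
  simp_rw [ENNReal.rpow_one]
  rw [spaceTimeMeasure, lintegral_prod_symm _ (hF.enorm.pow_const p)]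

lemma two_div_eq_iff_conjExponent {D q : ℝ} (hD : 0 < D) (hq : 2 < q) :
    2 / q = D * (1 / 2 - 1 / q) ↔ q.conjExponent = 2 * (D + 2) / (D + 4) := by
  have hq0 : 0 < q := by linarith
  have hq1 : 0 < q - 1 := by linarith
  rw [Real.conjExponent, div_eq_iff hq0.ne', div_eq_div_iff hq1.ne' (by linarith : D + 4 ≠ 0)]
  have e : D * (1 / 2 - 1 / q) * q = D * (q - 2) / 2 := by
    field_simp
  rw [e]
  constructor <;> intro h <;> linarith

theorem theoremT (d : ℕ) (hd : 1 ≤ d) (a : ℝ) (ha : 0 ≤ a) :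
    -- The mixed norm estimate, for all admissible exponents, and the restriction inequality.
    (∀ q r : ℝ, 2 < q → 2 < r → 2 / q = ((d : ℝ) + a + 1) * (1 / 2 - 1 / r) →
      ∃ C : ℝ, 0 < C ∧
        (∀ F : BulkPoint d × ℝ → ℂ, MemMixed a q.conjExponent r.conjExponent F →
          (∃! g, IsDualStrichartz a F g) ∧
          ‖dualStrichartz a F‖ₑ
            ≤ ENNReal.ofReal C * mixedNorm a q.conjExponent r.conjExponent F) ∧
        (∀ U : 𝓢(BulkPoint d × ℝ, ℂ),
          eLpNorm (paraboloidRestriction a U) 2 (halfSpaceMeasure d a)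
            ≤ ENNReal.ofReal C * mixedNorm a q.conjExponent r.conjExponent U)) ∧
    -- The diagonal case.
    (∀ q : ℝ, 2 < q → (2 / q = ((d : ℝ) + a + 1) * (1 / 2 - 1 / q) ↔
      q.conjExponent = 2 * ((d : ℝ) + a + 3) / ((d : ℝ) + a + 5))) ∧
    (∃ C : ℝ, 0 < C ∧
      (∀ F : BulkPoint d × ℝ → ℂ,
        MemLp F (ENNReal.ofReal (2 * ((d : ℝ) + a + 3) / ((d : ℝ) + a + 5)))
            (spaceTimeMeasure d a) →
          (∃! g, IsDualStrichartz a F g) ∧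
          ‖dualStrichartz a F‖ₑ
            ≤ ENNReal.ofReal C *
              eLpNorm F (ENNReal.ofReal (2 * ((d : ℝ) + a + 3) / ((d : ℝ) + a + 5)))
                (spaceTimeMeasure d a)) ∧
      (∀ U : 𝓢(BulkPoint d × ℝ, ℂ),
        eLpNorm (paraboloidRestriction a U) 2 (halfSpaceMeasure d a)
          ≤ ENNReal.ofReal C *
            eLpNorm U (ENNReal.ofReal (2 * ((d : ℝ) + a + 3) / ((d : ℝ) + a + 5)))
              (spaceTimeMeasure d a))) ∧
    -- On Schwartz functions: the integral formula for the dual operator, and the identity of its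
    -- norm with the norm of the restriction of the Fourier-Hankel transform.
    (∀ U : 𝓢(BulkPoint d × ℝ, ℂ),
      (∃! g, IsDualStrichartz a U g) ∧
      (∀ᵐ X ∂(halfSpaceMeasure d a),
        Integrable (fun t : ℝ => propagator a (-t) (fun Y => U (Y, t)) X) ∧
        dualStrichartz a U X = ∫ t : ℝ, propagator a (-t) (fun Y => U (Y, t)) X) ∧
      MemLp (paraboloidRestriction a U) 2 (halfSpaceMeasure d a) ∧
      eLpNorm (paraboloidRestriction a U) 2 (halfSpaceMeasure d a)
        = ‖dualStrichartz a U‖ₑ) := by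
  have part1 (q r : ℝ) (hq : 2 < q) (hr : 2 < r)
      (hqr : 2 / q = ((d : ℝ) + a + 1) * (1 / 2 - 1 / r)) :
      0 < dualStrichartzConst d a q r ∧
      (∀ F : BulkPoint d × ℝ → ℂ, MemMixed a q.conjExponent r.conjExponent F →
        (∃! g, IsDualStrichartz a F g) ∧
        ‖dualStrichartz a F‖ₑ ≤ ENNReal.ofReal (dualStrichartzConst d a q r) *
          mixedNorm a q.conjExponent r.conjExponent F) ∧
      (∀ U : 𝓢(BulkPoint d × ℝ, ℂ),
        eLpNorm (paraboloidRestriction a U) 2 (halfSpaceMeasure d a)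
          ≤ ENNReal.ofReal (dualStrichartzConst d a q r) *
            mixedNorm a q.conjExponent r.conjExponent U) := by
    refine ⟨dualStrichartzConst_pos ha hq hr,
      fun F hF => dualStrichartz_of_memMixed ha hq hr hqr hF, fun U => ?_⟩
    rw [eLpNorm_congr_ae (paraboloidRestriction_ae_eq ha U)]
    exact (isRegularDatum_schwartz ha U).eLpNorm_dualFourier_le ha hq hr hqr
  have hD : 0 < (d : ℝ) + a + 1 := by positivity
  have diag (q : ℝ) (hq : 2 < q) : 2 / q = ((d : ℝ) + a + 1) * (1 / 2 - 1 / q) ↔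
      q.conjExponent = 2 * ((d : ℝ) + a + 3) / ((d : ℝ) + a + 5) := by
    rw [two_div_eq_iff_conjExponent hD hq, show (d : ℝ) + a + 1 + 2 = d + a + 3 by ring,
      show (d : ℝ) + a + 1 + 4 = d + a + 5 by ring]
  refine ⟨fun q r hq hr hqr => ⟨_, part1 q r hq hr hqr⟩, diag, ?_, fun U => ?_⟩
  · -- The exponent of the diagonal admissible pair.
    set q : ℝ := 2 + 4 / ((d : ℝ) + a + 1) with hqdef
    have hq : 2 < q := by
      have : 0 < 4 / ((d : ℝ) + a + 1) := by positivity
      linarith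
    have hqq : 2 / q = ((d : ℝ) + a + 1) * (1 / 2 - 1 / q) := by
      rw [hqdef]
      field_simp
      ring
    have hp := (diag q hq).1 hqq
    have hp0 : 0 < q.conjExponent := div_pos (by linarith) (by linarith)
    obtain ⟨hC, hT, hR⟩ := part1 q q hq hq hqq
    refine ⟨_, hC, fun F hF => ?_, fun U => ?_⟩
    · rw [← hp] at hF ⊢
      rw [← mixedNorm_self hp0 hF.1]
      exact hT F ⟨hF.1, by rw [mixedNorm_self hp0 hF.1]; exact hF.2⟩
    · rw [← hp, ← mixedNorm_self hp0 U.continuous.aestronglyMeasurable]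
      exact hR U
  · have hreg := isRegularDatum_schwartz ha U
    have hdual := hreg.isDualStrichartz ha
    obtain ⟨M, hM⟩ := exists_norm_dualFourier_le ha U
    have hnorm := hreg.enorm_dualStrichartz ha (continuous_dualFourier ha U)
      (integrable_dualFourier ha U) hM
    have hRU := paraboloidRestriction_ae_eq ha U
    have heq : eLpNorm (paraboloidRestriction a U) 2 (halfSpaceMeasure d a)
        = ‖dualStrichartz a U‖ₑ := by
      rw [eLpNorm_congr_ae hRU, hnorm]
    refine ⟨⟨_, hdual, fun h hh => hh.eq ha hdual⟩, hreg.ae_dualStrichartz ha, ⟨?_, ?_⟩, heq⟩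
    · exact (continuous_dualFourier ha U).aestronglyMeasurable.congr hRU.symm
    · rw [heq]
      exact enorm_lt_top
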